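/- Let $\Omega\subseteq\mathbb R^2$ be open and star-shaped with respect to the origin, $0\in\Omega$, let $\delta\in\mathcal C^\infty(\Omega)$ be positive, and suppose that the (automatically non-compact and simply connected) Riemannian surface $M=(\Omega,\ \delta^{-2}(dx^2+dy^2))$ is complete. Let $K$ be its Gaussian curvature, and suppose that $K$ is bounded below, with $c=\inf_M K\le 0$. For $\tau\in\mathcal C^\infty(\Omega)$ put $$\mathbf C_{\delta,\tau}(x,y)=2\int_0^1 t\,\frac{\tau(tx,ty)}{\delta(tx,ty)^2}\,dt .$$ Let $\mathbb E^3(M,\tau)$ be $\Omega\times\mathbb R$ with the Riemannian metric $\delta^{-2}(dx^2+dy^2)+(dz+\mathbf C_{\delta,\tau}(y\,dx-x\,dy))^2$, and let $\mathbb L^3(M,\tau)$ be $\Omega\times\mathbb R$ with the Lorentzian metric $\delta^{-2}(dx^2+dy^2)-(dz-\mathbf C_{\delta,\tau}(y\,dx-x\,dy))^2$. An entire graph is a surface $\{z=u(x,y):(x,y)\in\Omega\}$ with $u\in\mathcal C^2(\Omega)$; its mean curvature in $\mathbb E^3(M,\tau)$ is half the trace of its second fundamental form with respect to the upward unit normal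 $N$ (that is, $\langle N,\partial_z\rangle>0$), regarded as a function on $\Omega$. A spacelike surface in $\mathbb L^3(M,\tau)$ is a non-empty (Hausdorff) surface $\Sigma$ without boundary of class $\mathcal C^2$ with a $\mathcal C^2$ immersion into $\mathbb L^3(M,\tau)$ whose induced metric is positive definite; it is complete if this induced Riemannian metric is complete. (a) If $H\in\mathcal C^\infty(\Omega)$ satisfies $\inf_\Omega|H|>\tfrac12\sqrt{-c}$, then for every $\tau\in\mathcal C^\infty(\Omega)$ the space $\mathbb E^3(M,\tau)$ admits no entire graph with mean curvature function $H$. (b) If $\tau\in\mathcal C^\infty(\Omega)$ satisfies $\inf_\Omega|\tau|>\tfrac12\sqrt{-c}$, then $\mathbb L^3(M,\tau)$ admits neither complete spacelike surfaces nor entire spacelike graphs. -/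

import Mathlib

open scoped ContDiff Manifold Matrix ENNReal

noncomputable section

namespace GBCV

/-! ### Semi-Riemannian geometry in one coordinate chart -/

/-- Coordinate space `ℝⁿ`. -/
abbrev Coord (n : ℕ) : Type := Fin n → ℝ

/-- A field of symmetric bilinear forms on (an open subset of) `ℝⁿ`, given by its matrix
`(g_{ij})` in the coordinate frame. -/
abbrev MetricField (n : ℕ) : Type := Coord n → Matrix (Fin n) (Fin n) ℝ

/-- The partial derivative `∂f/∂xᵢ` at `p`. -/
def pd {n : ℕ} (i : Fin n) (f : Coord n → ℝ) (p : Coord n) : ℝ :=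
  fderiv ℝ f p (Pi.single i 1)

/-- The value `g_p(v, w)`. -/
def metricInner {n : ℕ} (g : MetricField n) (p v w : Coord n) : ℝ := v ⬝ᵥ (g p *ᵥ w)

/-- The Christoffel symbol `Γᵏᵢⱼ` of the Levi-Civita connection of `g`. -/
def christoffel {n : ℕ} (g : MetricField n) (k i j : Fin n) (p : Coord n) : ℝ :=
  (1 / 2) * ∑ l, (g p)⁻¹ k l *
    (pd i (fun q => g q j l) p + pd j (fun q => g q i l) p - pd l (fun q => g q i j) p)

/-- The component `Rˡ` of `R(∂ᵢ, ∂ⱼ)∂ₖ = ∇ᵢ∇ⱼ∂ₖ - ∇ⱼ∇ᵢ∂ₖ`. -/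
def riemann {n : ℕ} (g : MetricField n) (l k i j : Fin n) (p : Coord n) : ℝ :=
  pd i (christoffel g l j k) p - pd j (christoffel g l i k) p
    + ∑ m, (christoffel g l i m p * christoffel g m j k p
      - christoffel g l j m p * christoffel g m i k p)

/-- The Gaussian curvature `g(R(∂₀, ∂₁)∂₁, ∂₀) / det g` of a Riemannian metric in dimension 2. -/
def gaussCurvature (g : MetricField 2) (p : Coord 2) : ℝ :=
  (∑ l, g p 0 l * riemann g l 1 0 1 p) / (g p).det

/-- The length with respect to `g` of a curve `γ` restricted to `[0, 1]`. -/
def curveLength {n : ℕ} (g : MetricField n) (γ : ℝ → Coord n) : ℝ≥0∞ :=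
  ∫⁻ t in Set.Icc (0 : ℝ) 1, ENNReal.ofReal (√(metricInner g (γ t) (deriv γ t) (deriv γ t)))

/-- A space is complete with respect to a distance `d` that induces its topology: every
`d`-Cauchy sequence converges. -/
def CompleteFor {X : Type*} [TopologicalSpace X] (d : X → X → ℝ≥0∞) : Prop :=
  ∀ s : ℕ → X,
    (∀ ε : ℝ≥0∞, 0 < ε → ∃ N : ℕ, ∀ m ≥ N, ∀ n ≥ N, d (s m) (s n) < ε) →
      ∃ q : X, Filter.Tendsto s Filter.atTop (nhds q)

/-! ### Parametrized surfaces in a three-dimensional chart -/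

/-- The coordinate vector field `X_a = ∂X/∂x_a`. -/
def tangentVec (X : Coord 2 → Coord 3) (a : Fin 2) (p : Coord 2) : Coord 3 :=
  fun k => pd a (fun q => X q k) p

/-- The first fundamental form `g(X_a, X_b)`. -/
def firstForm (g : MetricField 3) (X : Coord 2 → Coord 3) (p : Coord 2) :
    Matrix (Fin 2) (Fin 2) ℝ :=
  Matrix.of fun a b => metricInner g (X p) (tangentVec X a p) (tangentVec X b p)

/-- The covariant derivative `∇_{X_a} X_b` along the parametrization `X`. -/
def covDeriv (g : MetricField 3) (X : Coord 2 → Coord 3) (a b : Fin 2) (p : Coord 2) : Coord 3 :=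
  fun k => pd a (fun q => tangentVec X b q k) p
    + ∑ i, ∑ j, christoffel g k i j (X p) * tangentVec X a p i * tangentVec X b p j

/-- The second fundamental form `g(∇_{X_a} X_b, N)` with respect to the normal vector `N`. -/
def secondForm (g : MetricField 3) (X : Coord 2 → Coord 3) (N : Coord 3) (p : Coord 2) :
    Matrix (Fin 2) (Fin 2) ℝ :=
  Matrix.of fun a b => metricInner g (X p) (covDeriv g X a b p) N

/-- The mean curvature (half the trace of the shape operator) with respect to the unit normal
`N` at `X p`. -/
def meanCurvature (g : MetricField 3) (X : Coord 2 → Coord 3) (N : Coord 3) (p : Coord 2) : ℝ :=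
  (1 / 2) * ((firstForm g X p)⁻¹ * secondForm g X N p).trace

/-! ### The base surface -/

/-- The conformal metric `δ⁻² (dx² + dy²)`. -/
def baseMetric (δ : Coord 2 → ℝ) : MetricField 2 :=
  fun p => (1 / δ p ^ 2) • (1 : Matrix (Fin 2) (Fin 2) ℝ)

/-- The Riemannian distance of `(Ω, δ⁻² (dx² + dy²))`: the infimum of the lengths of the `C¹`
curves in `Ω` from `p` to `q`. -/
def baseDist (Ω : Set (Coord 2)) (δ : Coord 2 → ℝ) (p q : Ω) : ℝ≥0∞ :=
  ⨅ (γ : ℝ → Coord 2) (_ : ContDiffOn ℝ 1 γ (Set.Icc 0 1))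
    (_ : ∀ t ∈ Set.Icc (0 : ℝ) 1, γ t ∈ Ω) (_ : γ 0 = p) (_ : γ 1 = q),
    curveLength (baseMetric δ) γ

/-- `(Ω, δ⁻² (dx² + dy²))` is a complete Riemannian surface. -/
def BaseComplete (Ω : Set (Coord 2)) (δ : Coord 2 → ℝ) : Prop :=
  CompleteFor (baseDist Ω δ)

/-! ### The spaces `𝔼³(M, τ)` and `𝕃³(M, τ)` -/

/-- The Calabi potential `C_{δ,τ}`. -/
def calabi (δ τ : Coord 2 → ℝ) (p : Coord 2) : ℝ :=
  2 * ∫ t in (0 : ℝ)..1, t * (τ (t • p) / δ (t • p) ^ 2)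

/-- The projection `π(x, y, z) = (x, y)`. -/
def proj (q : Coord 3) : Coord 2 := ![q 0, q 1]

/-- The tensor `dx² + dy²` on `ℝ³`. -/
def horizontal : Matrix (Fin 3) (Fin 3) ℝ := Matrix.diagonal ![1, 1, 0]

/-- The components of the one-form `dz + C (y dx - x dy)` at `q`. -/
def connectionForm (C : ℝ) (q : Coord 3) : Coord 3 := ![C * q 1, -(C * q 0), 1]

/-- The metric `δ⁻² (dx² + dy²) + (dz + C_{δ,τ} (y dx - x dy))²` of `𝔼³(M, τ)`. -/
def metricE (δ τ : Coord 2 → ℝ) : MetricField 3 := fun q =>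
  (1 / δ (proj q) ^ 2) • horizontal
    + Matrix.vecMulVec (connectionForm (calabi δ τ (proj q)) q)
        (connectionForm (calabi δ τ (proj q)) q)

/-- The metric `δ⁻² (dx² + dy²) - (dz - C_{δ,τ} (y dx - x dy))²` of `𝕃³(M, τ)`. -/
def metricL (δ τ : Coord 2 → ℝ) : MetricField 3 := fun q =>
  (1 / δ (proj q) ^ 2) • horizontal
    - Matrix.vecMulVec (connectionForm (-calabi δ τ (proj q)) q)
        (connectionForm (-calabi δ τ (proj q)) q)

/-! ### Graphs and spacelike surfaces -/

/-- The parametrization `(x, y) ↦ (x, y, u(x, y))` of the graph of `u`. -/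
def graphMap (u : Coord 2 → ℝ) (p : Coord 2) : Coord 3 := ![p 0, p 1, u p]

/-- `N` is the unit normal of the graph of `u` at the point over `p`, pointing upwards, that is,
with positive product with the Killing field `∂_z`. -/
def IsUpwardUnitNormal (g : MetricField 3) (u : Coord 2 → ℝ) (p : Coord 2) (N : Coord 3) : Prop :=
  (∀ a, metricInner g (graphMap u p) N (tangentVec (graphMap u) a p) = 0) ∧
  metricInner g (graphMap u p) N N = 1 ∧
  0 < metricInner g (graphMap u p) N (Pi.single 2 1)

/-- The graph of `u` is an entire (that is, defined over all of `Ω`) `C²` graph in `𝔼³(M, τ)`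
with mean curvature function `H`. -/
structure IsEntireGraphE (Ω : Set (Coord 2)) (δ τ H u : Coord 2 → ℝ) : Prop where
  contDiffOn : ContDiffOn ℝ 2 u Ω
  mean_curvature : ∀ p ∈ Ω, ∃ N : Coord 3, IsUpwardUnitNormal (metricE δ τ) u p N ∧
    meanCurvature (metricE δ τ) (graphMap u) N p = H p

/-- The graph of `u` is an entire `C²` spacelike graph in `𝕃³(M, τ)`: the induced metric is
positive definite. -/
structure IsEntireSpacelikeGraph (Ω : Set (Coord 2)) (δ τ u : Coord 2 → ℝ) : Prop where
  contDiffOn : ContDiffOn ℝ 2 u Ω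
  spacelike : ∀ p ∈ Ω, (firstForm (metricL δ τ) (graphMap u) p).PosDef

section Surface

variable {S : Type*} [TopologicalSpace S] [ChartedSpace (EuclideanSpace ℝ (Fin 2)) S]

/-- `φ` is a `C²` spacelike immersion of the surface `S` in `𝕃³(M, τ)`: the induced metric is
positive definite. -/
structure IsSpacelikeImmersion (Ω : Set (Coord 2)) (δ τ : Coord 2 → ℝ) (φ : S → Coord 3) :
    Prop where
  contMDiff : ContMDiff (𝓡 2) 𝓘(ℝ, Coord 3) 2 φ
  mem : ∀ s, proj (φ s) ∈ Ω
  spacelike : ∀ (s : S) (v : TangentSpace (𝓡 2) s), v ≠ 0 →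
    0 < metricInner (metricL δ τ) (φ s) (mfderiv (𝓡 2) 𝓘(ℝ, Coord 3) φ s v)
      (mfderiv (𝓡 2) 𝓘(ℝ, Coord 3) φ s v)

/-- The Riemannian distance of the metric induced on `S` by the immersion `φ`: the infimum of
the lengths of the `C¹` curves in `S` from `s` to `s'`, the length of a curve `γ` being that of
`φ ∘ γ` in the ambient metric `g`. -/
def inducedDist (g : MetricField 3) (φ : S → Coord 3) (s s' : S) : ℝ≥0∞ :=
  ⨅ (γ : ℝ → S) (_ : ContMDiffOn 𝓘(ℝ, ℝ) (𝓡 2) 1 γ (Set.Icc 0 1))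
    (_ : γ 0 = s) (_ : γ 1 = s'), curveLength g (φ ∘ γ)

/-- `φ` is a complete spacelike surface in `𝕃³(M, τ)`. -/
structure IsCompleteSpacelike (Ω : Set (Coord 2)) (δ τ : Coord 2 → ℝ) (φ : S → Coord 3) :
    Prop where
  immersion : IsSpacelikeImmersion Ω δ τ φ
  complete : CompleteFor (inducedDist (metricL δ τ) φ)

end Surface

end GBCV

end

open scoped ContDiff Manifold Matrix ENNReal ComplexConjugate Topology
open Set Metric MeasureTheory

namespace GBCV

/-! Both parts reduce to one obstruction. A field `X` on `M` of length at most one is encoded by its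
Euclidean flux `Y = X / δ²`, so that `|Y| ≤ 1/δ` and the Euclidean divergence of `Y` is `δ⁻²` times
the divergence of `X` on `M`. If `K ≥ c` and `2h > √(-c)`, no such field has divergence at least
`2h` on `M` (`not_exists_field`).

For an entire graph in `𝔼³`, `X` is the generalized gradient divided by `W`, the inverse of the
angle function, and its divergence is `2H` (`meanCurvature_sasaki`). For an entire spacelike graph
in `𝕃³`, the generalized gradient has length less than one exactly because the graph is spacelike.
Rotating it by a right angle cancels the second derivatives of `u` in the divergence and leaves only
the contribution of the Calabi potential, which is `2τ` (`calabi_identity`). No equation on `u` is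
needed. Since `H` or `τ` is continuous and nonvanishing on a connected set, it has a sign, which may
be taken positive after replacing `Y` by `-Y`.

A complete spacelike surface is reduced to a graph. Its projection to `M` is a local diffeomorphism
that does not decrease lengths, so completeness of the surface lets segments be lifted. Lifting the
rays from the origin gives a section over the star-shaped `Ω`, and its image is an entire spacelike
graph.

The obstruction compares two spectral bounds. Integrating `f² div Y` by parts gives Cheeger's
inequality `h² ∫ f² dA ≤ ∫ |∇f|²` (`cheeger_inequality`). Conversely, a complete surface with `K ≥
-a²` should have bottom of the spectrum at most `a²/4`. In dimension two this follows from conformal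
invariance of the Dirichlet integral. If `Ω` is the whole plane, logarithmic cutoffs make the
Dirichlet integral arbitrarily small (`not_planar_field`). Otherwise `Ω` embeds holomorphically in
the unit disc with an image as large as desired (`exists_isDiscEmbedding_ball_subset`), and the
Schwarz-Yau lemma bounds the pulled-back hyperbolic area element by `a²` times that of `M`. Radial
functions `(1 - |w|²)^s` with `s` above `1/2`, transplanted from the disc, then force `h/a ≤ s`
(`radial_estimate`). Choosing `1/2 < s < h/a` is a contradiction.

Completeness of `M` enters only in the Schwarz-Yau lemma, through cutoff functions of small
gradient. These are mollified truncations of the distance to the origin, whose balls are relatively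
compact by Hopf-Rinow. -/

/-! ### Holomorphic embeddings of a star-shaped domain in the unit disc -/

/-- `g` is an injective holomorphic map of `U` into the unit disc. -/
structure IsDiscEmbedding (U : Set ℂ) (g : ℂ → ℂ) : Prop where
  differentiableOn : DifferentiableOn ℂ g U
  injOn : InjOn g U
  deriv_ne_zero : ∀ z ∈ U, deriv g z ≠ 0
  norm_lt_one : ∀ z ∈ U, ‖g z‖ < 1

/-- The involutive automorphism of the unit disc that exchanges `0` and `c`. -/
noncomputable def discInvolution (c w : ℂ) : ℂ := (c - w) / (1 - conj c * w)

theorem one_sub_conj_mul_ne_zero {c w : ℂ} (hc : ‖c‖ < 1) (hw : ‖w‖ < 1) :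
    1 - conj c * w ≠ 0 := by
  intro h
  have h1 : conj c * w = 1 := (sub_eq_zero.mp h).symm
  have h2 : ‖c‖ * ‖w‖ = 1 := by
    rw [← RCLike.norm_conj c, ← norm_mul, h1, norm_one]
  nlinarith [norm_nonneg c, norm_nonneg w]

theorem discInvolution_involutive {c w : ℂ} (hc : ‖c‖ < 1) (hw : ‖w‖ < 1) :
    discInvolution c (discInvolution c w) = w := by
  have h1 := one_sub_conj_mul_ne_zero hc hw
  have h2 := one_sub_conj_mul_ne_zero hc hc
  have h3 : (1 - conj c * w) - conj c * (c - w) ≠ 0 := by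
    rwa [show (1 - conj c * w) - conj c * (c - w) = 1 - conj c * c by ring]
  unfold discInvolution
  have h4 : 1 - conj c * ((c - w) / (1 - conj c * w)) ≠ 0 := by
    rw [show 1 - conj c * ((c - w) / (1 - conj c * w)) =
      ((1 - conj c * w) - conj c * (c - w)) / (1 - conj c * w) by field_simp]
    exact div_ne_zero h3 h1
  rw [div_eq_iff h4, sub_div' h1, mul_div_assoc', sub_div' h1, mul_div_assoc']
  congr 1
  ring

/-- This is positivity of `(1 - |c|²)(1 - |w|²) = |1 - c̄w|² - |c - w|²`. -/
theorem norm_discInvolution_lt_one {c w : ℂ} (hc : ‖c‖ < 1) (hw : ‖w‖ < 1) :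
    ‖discInvolution c w‖ < 1 := by
  have h1 := one_sub_conj_mul_ne_zero hc hw
  unfold discInvolution
  rw [norm_div, div_lt_one (norm_pos_iff.mpr h1)]
  rw [← sq_lt_sq₀ (norm_nonneg _) (norm_nonneg _)]
  have e1 : ‖c‖ ^ 2 < 1 := by nlinarith [norm_nonneg c]
  have e2 : ‖w‖ ^ 2 < 1 := by nlinarith [norm_nonneg w]
  rw [← Complex.normSq_eq_norm_sq] at *
  rw [← Complex.normSq_eq_norm_sq] at *
  simp only [Complex.normSq_apply, Complex.sub_re, Complex.sub_im, Complex.one_re, Complex.one_im,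
    Complex.mul_re, Complex.mul_im, Complex.conj_re, Complex.conj_im] at *
  nlinarith [mul_pos (sub_pos.mpr e1) (sub_pos.mpr e2)]

theorem hasDerivAt_discInvolution {c w : ℂ} (hc : ‖c‖ < 1) (hw : ‖w‖ < 1) :
    HasDerivAt (discInvolution c) (-(1 - conj c * c) / (1 - conj c * w) ^ 2) w := by
  have h1 := one_sub_conj_mul_ne_zero hc hw
  unfold discInvolution
  have := ((hasDerivAt_id w).const_sub c).fun_div
    (((hasDerivAt_id w).const_mul (conj c)).const_sub 1) h1
  refine this.congr_deriv ?_
  simp only [id]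
  congr 1
  ring

theorem IsDiscEmbedding.hasDerivAt_discInvolution_comp {U : Set ℂ} (hU : IsOpen U) {g : ℂ → ℂ}
    (hg : IsDiscEmbedding U g) {c : ℂ} (hc : ‖c‖ < 1) {z : ℂ} (hz : z ∈ U) :
    HasDerivAt (fun z => discInvolution c (g z))
      (-(1 - conj c * c) / (1 - conj c * g z) ^ 2 * deriv g z) z :=
  (hasDerivAt_discInvolution hc (hg.norm_lt_one z hz)).comp z
    ((hg.differentiableOn.differentiableAt (hU.mem_nhds hz)).hasDerivAt)

theorem IsDiscEmbedding.discInvolution_comp {U : Set ℂ} (hU : IsOpen U) {g : ℂ → ℂ}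
    (hg : IsDiscEmbedding U g) {c : ℂ} (hc : ‖c‖ < 1) :
    IsDiscEmbedding U (fun z => discInvolution c (g z)) where
  differentiableOn z hz :=
    (hg.hasDerivAt_discInvolution_comp hU hc hz).differentiableAt.differentiableWithinAt
  injOn z hz z' hz' h := by
    apply hg.injOn hz hz'
    rw [← discInvolution_involutive hc (hg.norm_lt_one z hz),
      ← discInvolution_involutive hc (hg.norm_lt_one z' hz')]
    exact congrArg _ h
  deriv_ne_zero z hz := by
    rw [(hg.hasDerivAt_discInvolution_comp hU hc hz).deriv]
    exact mul_ne_zero (div_ne_zero (neg_ne_zero.mpr (one_sub_conj_mul_ne_zero hc hc))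
      (pow_ne_zero _ (one_sub_conj_mul_ne_zero hc (hg.norm_lt_one z hz)))) (hg.deriv_ne_zero z hz)
  norm_lt_one z hz := norm_discInvolution_lt_one hc (hg.norm_lt_one z hz)

theorem isSimplyConnected_of_starConvex {U : Set ℂ} (h0 : (0 : ℂ) ∈ U) (hs : StarConvex ℝ 0 U) :
    IsSimplyConnected U := by
  have := hs.contractibleSpace ⟨0, h0⟩
  exact (inferInstance : SimplyConnectedSpace U)

/-- A continuous square root is automatically holomorphic where it does not vanish: the slope of `m`
is the slope of `s` times `s y + s z`, and the latter tends to `2 s z ≠ 0`. -/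
theorem hasDerivAt_of_sq_eq {U : Set ℂ} (hU : IsOpen U) {m s : ℂ → ℂ} (hs : ContinuousOn s U)
    (hsm : ∀ z, s z ^ 2 = m z) {z m' : ℂ} (hz : z ∈ U) (hm : HasDerivAt m m' z) (h0 : m z ≠ 0) :
    HasDerivAt s (m' / (2 * s z)) z := by
  have hsz : s z ≠ 0 := fun h => h0 (by rw [← hsm, h]; simp)
  have hsc : ContinuousAt s z := hs.continuousAt (hU.mem_nhds hz)
  rw [hasDerivAt_iff_tendsto_slope] at hm ⊢
  have hsum : Filter.Tendsto (fun y => s y + s z) (nhdsWithin z {z}ᶜ) (nhds (2 * s z)) := by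
    rw [two_mul]
    exact (hsc.tendsto.add_const _).mono_left nhdsWithin_le_nhds
  have h2 : 2 * s z ≠ 0 := mul_ne_zero two_ne_zero hsz
  refine (hm.div hsum h2).congr' ?_
  filter_upwards [hsum.eventually_ne h2] with y hy
  simp only [slope_def_field, Pi.div_apply, ← hsm]
  by_cases hyz : y = z
  · simp [hyz]
  have : y - z ≠ 0 := sub_ne_zero.mpr hyz
  field_simp
  ring

/-- A nonvanishing function on a simply connected domain has a continuous square root. Injectivity
and the bound by one pass to the root because `g` is recovered from it by squaring. -/
theorem IsDiscEmbedding.exists_sqrt {U : Set ℂ} (hU : IsOpen U) (h0 : (0 : ℂ) ∈ U)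
    (hs : StarConvex ℝ 0 U) {g : ℂ → ℂ} (hg : IsDiscEmbedding U g) (hne : ∀ z ∈ U, g z ≠ 0) :
    ∃ s : ℂ → ℂ, IsDiscEmbedding U s ∧ (∀ z, s z ^ 2 = g z) ∧
      ∀ z ∈ U, deriv s z = deriv g z / (2 * s z) := by
  obtain ⟨s, hsc, hsm⟩ := Complex.exists_continuousOn_pow_eq (isSimplyConnected_of_starConvex h0 hs)
    hU hg.differentiableOn.continuousOn (by rintro ⟨z, hz, h⟩; exact hne z hz h)
    (two_ne_zero (α := ℕ))
  have hd : ∀ z ∈ U, HasDerivAt s (deriv g z / (2 * s z)) z := fun z hz =>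
    hasDerivAt_of_sq_eq hU hsc hsm hz
      (hg.differentiableOn.differentiableAt (hU.mem_nhds hz)).hasDerivAt (hne z hz)
  have hs0 : ∀ z ∈ U, s z ≠ 0 := fun z hz h => hne z hz (by rw [← hsm, h]; simp)
  refine ⟨s, ⟨fun z hz => (hd z hz).differentiableAt.differentiableWithinAt, ?_, ?_, ?_⟩, hsm,
    fun z hz => (hd z hz).deriv⟩
  · intro z hz z' hz' h
    apply hg.injOn hz hz'
    rw [← hsm, ← hsm, h]
  · intro z hz
    rw [(hd z hz).deriv]
    exact div_ne_zero (hg.deriv_ne_zero z hz) (mul_ne_zero two_ne_zero (hs0 z hz))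
  · intro z hz
    have := hg.norm_lt_one z hz
    rw [← hsm, norm_pow] at this
    nlinarith [norm_nonneg (s z)]

/-- If an embedding in the disc that fixes the origin omits the value `c`, then the square root
construction gives an embedding with a larger derivative at the origin. -/
theorem IsDiscEmbedding.exists_larger_deriv {U : Set ℂ} (hU : IsOpen U) (h0 : (0 : ℂ) ∈ U)
    (hs : StarConvex ℝ 0 U) {g : ℂ → ℂ} (hg : IsDiscEmbedding U g) (hg0 : g 0 = 0) {c : ℂ}
    (hc : ‖c‖ < 1) (hcg : c ∉ g '' U) :
    ∃ g₁ : ℂ → ℂ, IsDiscEmbedding U g₁ ∧ g₁ 0 = 0 ∧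
      ‖deriv g₁ 0‖ = ‖deriv g 0‖ * ((1 + ‖c‖) / (2 * √‖c‖)) := by
  have hm := hg.discInvolution_comp hU hc
  obtain ⟨s, hsE, hsm, hsd⟩ := hm.exists_sqrt hU h0 hs (by
    intro z hz h
    apply hcg
    refine ⟨z, hz, ?_⟩
    unfold discInvolution at h
    rw [div_eq_zero_iff, or_iff_left (one_sub_conj_mul_ne_zero hc (hg.norm_lt_one z hz)),
      sub_eq_zero] at h
    exact h.symm)
  have hc0 : c ≠ 0 := fun h => hcg ⟨0, h0, by rw [hg0, h]⟩
  have hb := hsE.norm_lt_one 0 h0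
  have hbc : s 0 ^ 2 = c := by rw [hsm 0, hg0]; simp [discInvolution]
  have hbn : ‖s 0‖ = √‖c‖ := by rw [← hbc, norm_pow, Real.sqrt_sq (norm_nonneg _)]
  have hcs : ‖c‖ = √‖c‖ ^ 2 := (Real.sq_sqrt (norm_nonneg _)).symm
  refine ⟨fun z => discInvolution (s 0) (s z), hsE.discInvolution_comp hU hb,
    by simp [discInvolution], ?_⟩
  rw [(hsE.hasDerivAt_discInvolution_comp hU hb h0).deriv, hsd 0 h0,
    (hg.hasDerivAt_discInvolution_comp hU hc h0).deriv, hg0]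
  have key : ∀ d : ℂ, ‖d‖ < 1 → ‖1 - conj d * d‖ = 1 - ‖d‖ ^ 2 := by
    intro d hd
    rw [mul_comm, Complex.mul_conj', ← Complex.ofReal_pow, ← Complex.ofReal_one,
      ← Complex.ofReal_sub, Complex.norm_real, Real.norm_of_nonneg]
    nlinarith [norm_nonneg d]
  simp only [norm_mul, norm_div, norm_neg, norm_pow, key _ hb, key _ hc, mul_zero, sub_zero,
    one_pow, div_one, hbn, Complex.norm_ofNat]
  have h1 : 0 < √‖c‖ := Real.sqrt_pos.mpr (norm_pos_iff.mpr hc0)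
  have h2 : √‖c‖ < 1 := hbn ▸ hb
  have h3 : 1 - √‖c‖ ^ 2 ≠ 0 := by nlinarith
  rw [← hcs] at h3 ⊢
  field_simp
  ring

/-- The Schwarz lemma on a disc inside `U`. It makes the supremum in the extremal problem below
finite. -/
theorem IsDiscEmbedding.norm_deriv_zero_le {U : Set ℂ} {r : ℝ} (hr : 0 < r)
    (hrU : ball 0 r ⊆ U) {g : ℂ → ℂ} (hg : IsDiscEmbedding U g) (hg0 : g 0 = 0) :
    ‖deriv g 0‖ ≤ 1 / r := by
  refine Complex.norm_deriv_le_div_of_mapsTo_ball (hg.differentiableOn.mono hrU) ?_ hr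
  intro z hz
  simpa [hg0] using (hg.norm_lt_one z (hrU hz)).le

/-- For an omitted point `p`, star-shapedness keeps `1 - z/p` in the slit plane. Its principal
square root is injective with values in the right half-plane, which a Cayley transform carries into
the disc, sending `1` to `0`. -/
theorem exists_isDiscEmbedding {U : Set ℂ} (h0 : (0 : ℂ) ∈ U)
    (hs : StarConvex ℝ 0 U) (hne : U ≠ univ) :
    ∃ g : ℂ → ℂ, IsDiscEmbedding U g ∧ g 0 = 0 := by
  obtain ⟨p, hp⟩ := (ne_univ_iff_exists_notMem U).mp hne
  have hp0 : p ≠ 0 := fun h => hp (h ▸ h0)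
  have hslit : ∀ z ∈ U, 1 - z / p ∈ Complex.slitPlane := by
    intro z hz
    rw [Complex.mem_slitPlane_iff_not_le_zero]
    intro hle
    apply hp
    rw [Complex.le_def] at hle
    simp only [Complex.sub_re, Complex.one_re, Complex.zero_re, Complex.sub_im, Complex.one_im,
      zero_sub, Complex.zero_im, neg_eq_zero] at hle
    have hx : z / p = ((z / p).re : ℂ) := by
      apply Complex.ext <;> simp [hle.2]
    set x := (z / p).re
    have hx1 : 1 ≤ x := by linarith [hle.1]
    -- If `1 - z/p ≤ 0`, then `p` lies on the segment from `0` to `z ∈ U`, hence in `U`, which is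
    -- excluded.
    have hz' : p = (x⁻¹ : ℝ) • z := by
      rw [div_eq_iff hp0] at hx
      rw [hx, Complex.real_smul, ← mul_assoc, ← Complex.ofReal_mul, inv_mul_cancel₀ (by positivity)]
      simp
    rw [hz']
    exact hs.smul_mem hz (by positivity) (inv_le_one_of_one_le₀ hx1)
  set q : ℂ → ℂ := fun z => Complex.exp (Complex.log (1 - z / p) / 2) with hq
  have hq2 : ∀ z ∈ U, q z ^ 2 = 1 - z / p := by
    intro z hz
    rw [hq, ← Complex.exp_nat_mul]
    push_cast
    rw [mul_div_cancel₀ _ two_ne_zero, Complex.exp_log (Complex.slitPlane_ne_zero (hslit z hz))]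
  have hqd : ∀ z ∈ U, HasDerivAt q (q z * (-(1 / p) / (1 - z / p) / 2)) z := by
    intro z hz
    have h1 : HasDerivAt (fun z : ℂ => 1 - z / p) (-(1 / p)) z :=
      ((hasDerivAt_id z).div_const p).const_sub 1
    exact ((h1.clog (hslit z hz)).div_const 2).cexp
  have hqre : ∀ z ∈ U, 0 < (q z).re := by
    intro z hz
    simp only [hq, Complex.exp_re]
    apply mul_pos (Real.exp_pos _)
    apply Real.cos_pos_of_mem_Ioo
    have h1 := Complex.neg_pi_lt_arg (1 - z / p)
    have h2 : Complex.arg (1 - z / p) < Real.pi :=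
      lt_of_le_of_ne (Complex.arg_le_pi _) (Complex.slitPlane_arg_ne_pi (hslit z hz))
    have h3 : (Complex.log (1 - z / p) / 2).im = Complex.arg (1 - z / p) / 2 := by
      rw [← Complex.log_im]; simp
    rw [h3]
    constructor <;> linarith
  have hq1 : ∀ z ∈ U, 1 + q z ≠ 0 := by
    intro z hz h
    have := congrArg Complex.re h
    simp only [Complex.add_re, Complex.one_re, Complex.zero_re] at this
    linarith [hqre z hz]
  have hd : ∀ z ∈ U, HasDerivAt (fun z => (1 - q z) / (1 + q z))
      (-2 * (q z * (-(1 / p) / (1 - z / p) / 2)) / (1 + q z) ^ 2) z := by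
    intro z hz
    refine (((hqd z hz).const_sub 1).fun_div ((hqd z hz).const_add 1) (hq1 z hz)).congr_deriv ?_
    congr 1
    ring
  refine ⟨fun z => (1 - q z) / (1 + q z), ⟨fun z hz =>
    (hd z hz).differentiableAt.differentiableWithinAt, ?_, ?_, ?_⟩, by simp [hq]⟩
  · intro z hz z' hz' h
    have h' : (1 - q z) / (1 + q z) = (1 - q z') / (1 + q z') := h
    rw [div_eq_div_iff (hq1 z hz) (hq1 z' hz')] at h'
    have h1 : q z = q z' := by linear_combination (-1 / 2 : ℂ) * h'
    have h2 := hq2 z hz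
    rw [h1, hq2 z' hz'] at h2
    field_simp at h2
    linear_combination h2
  · intro z hz
    rw [(hd z hz).deriv]
    have h1 : 1 - z / p ≠ 0 := Complex.slitPlane_ne_zero (hslit z hz)
    have h2 : q z ≠ 0 := Complex.exp_ne_zero _
    have h3 := hq1 z hz
    simp [h1, h2, h3, hp0]
  · intro z hz
    rw [norm_div, div_lt_one (norm_pos_iff.mpr (hq1 z hz)), ← sq_lt_sq₀ (norm_nonneg _)
      (norm_nonneg _), ← Complex.normSq_eq_norm_sq, ← Complex.normSq_eq_norm_sq]
    simp only [Complex.normSq_apply, Complex.sub_re, Complex.sub_im, Complex.add_re, Complex.add_im,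
      Complex.one_re, Complex.one_im]
    nlinarith [hqre z hz]

/-- A quantitative form of the Riemann mapping theorem for star-shaped domains: such a domain
embeds in the unit disc so that the image contains any given smaller disc. -/
theorem exists_isDiscEmbedding_ball_subset {U : Set ℂ} (hU : IsOpen U) (h0 : (0 : ℂ) ∈ U)
    (hs : StarConvex ℝ 0 U) (hne : U ≠ univ) {ρ : ℝ} (hρ1 : ρ < 1) :
    ∃ g : ℂ → ℂ, IsDiscEmbedding U g ∧ ball 0 ρ ⊆ g '' U := by
  obtain ⟨r, hr, hrU⟩ := Metric.isOpen_iff.mp hU 0 h0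
  by_cases hρ : 0 < ρ
  swap
  · obtain ⟨g, hg, -⟩ := exists_isDiscEmbedding h0 hs hne
    exact ⟨g, hg, by rw [ball_eq_empty.mpr (not_lt.mp hρ)]; exact empty_subset _⟩
  set A : Set ℝ := {x | ∃ g : ℂ → ℂ, IsDiscEmbedding U g ∧ g 0 = 0 ∧ ‖deriv g 0‖ = x}
  have hA : BddAbove A := ⟨1 / r, by
    rintro x ⟨g, hg, hg0, rfl⟩
    exact hg.norm_deriv_zero_le hr hrU hg0⟩
  obtain ⟨g₀, hg₀, hg₀0⟩ := exists_isDiscEmbedding h0 hs hne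
  have hpos : 0 < sSup A :=
    (norm_pos_iff.mpr (hg₀.deriv_ne_zero 0 h0)).trans_le (le_csSup hA ⟨g₀, hg₀, hg₀0, rfl⟩)
  -- This is the factor gained by the square root construction for an omitted value of modulus `ρ`.
  -- The factor decreases with the modulus, so any omitted value in the disc of radius `ρ` gains at
  -- least `m > 1`.
  set m := (1 + ρ) / (2 * √ρ)
  have hsρ : 0 < √ρ := Real.sqrt_pos.mpr hρ
  have hρs : √ρ ^ 2 = ρ := Real.sq_sqrt hρ.le
  have hm : 1 < m := by
    rw [lt_div_iff₀ (by positivity)]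
    have : √ρ < 1 := by nlinarith
    nlinarith [mul_pos (sub_pos.mpr this) (sub_pos.mpr this)]
  -- A near-maximizer within the factor `m` of the supremum suffices, so no normal families argument
  -- or exact extremal map is needed.
  obtain ⟨x, ⟨g, hg, hg0, rfl⟩, hx⟩ := exists_lt_of_lt_csSup (s := A) ⟨_, g₀, hg₀, hg₀0, rfl⟩
    (div_lt_self hpos hm)
  refine ⟨g, hg, fun c hc => ?_⟩
  by_contra hcg
  rw [mem_ball_zero_iff] at hc
  have hc0 : c ≠ 0 := fun h => hcg ⟨0, h0, by rw [hg0, h]⟩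
  obtain ⟨g₁, hg₁, hg₁0, hd⟩ := hg.exists_larger_deriv hU h0 hs hg0 (hc.trans hρ1) hcg
  have h1 : ‖deriv g 0‖ * ((1 + ‖c‖) / (2 * √‖c‖)) ≤ sSup A :=
    hd ▸ le_csSup hA ⟨g₁, hg₁, hg₁0, rfl⟩
  have hcpos : 0 < √‖c‖ := Real.sqrt_pos.mpr (norm_pos_iff.mpr hc0)
  have hcs : √‖c‖ ^ 2 = ‖c‖ := Real.sq_sqrt (norm_nonneg _)
  have hle : √‖c‖ ≤ √ρ := Real.sqrt_le_sqrt hc.le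
  have h2 : m ≤ (1 + ‖c‖) / (2 * √‖c‖) := by
    rw [div_le_div_iff₀ (by positivity) (by positivity)]
    have h3 : √ρ < 1 := by nlinarith
    have h4 : √ρ * √‖c‖ ≤ 1 := by nlinarith
    nlinarith [mul_nonneg (sub_nonneg.mpr hle) (sub_nonneg.mpr h4)]
  rw [div_lt_iff₀ (by linarith)] at hx
  have := mul_le_mul_of_nonneg_left h2 (norm_nonneg (deriv g 0))
  linarith

/-! ### The divergence theorem and Cheeger's inequality -/

/-- The divergence of a planar vector field. -/
noncomputable def planeDiv (Y : ℂ → ℂ) (z : ℂ) : ℝ :=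
  (fderiv ℝ Y z 1).re + (fderiv ℝ Y z Complex.I).im

theorem contDiff_of_tsupport_subset {E F : Type*} [NormedAddCommGroup E] [NormedSpace ℝ E]
    [NormedAddCommGroup F] [NormedSpace ℝ F] {n : ℕ∞ω} {U : Set E} (hU : IsOpen U) {f : E → F}
    (hf : ContDiffOn ℝ n f U) (hfU : tsupport f ⊆ U) : ContDiff ℝ n f := by
  rw [contDiff_iff_contDiffAt]
  intro x
  by_cases hx : x ∈ tsupport f
  · exact hf.contDiffAt (hU.mem_nhds (hfU hx))
  · exact contDiffAt_const.congr_of_eventuallyEq (notMem_tsupport_iff_eventuallyEq.mp hx)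

theorem continuous_mul_of_tsupport_subset {E : Type*} [TopologicalSpace E] {U : Set E}
    (hU : IsOpen U) {T F : E → ℝ} (hT : Continuous T) (hTU : tsupport T ⊆ U)
    (hF : ContinuousOn F U) : Continuous fun z => T z * F z :=
  (hT.continuousOn.mul hF).continuous_of_tsupport_subset hU
    ((tsupport_mul_subset_left (f := T) (g := F)).trans hTU)

theorem integrable_mul_of_tsupport_subset {U : Set ℂ} (hU : IsOpen U) {T F : ℂ → ℝ}
    (hT : Continuous T) (hc : HasCompactSupport T) (hTU : tsupport T ⊆ U)
    (hF : ContinuousOn F U) : Integrable fun z => T z * F z :=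
  (continuous_mul_of_tsupport_subset hU hT hTU hF).integrable_of_hasCompactSupport hc.mul_right

theorem re_fderiv {Y : ℂ → ℂ} {z : ℂ} (hY : DifferentiableAt ℝ Y z) (v : ℂ) :
    fderiv ℝ (fun z => (Y z).re) z v = (fderiv ℝ Y z v).re := by
  have := (Complex.reCLM.hasFDerivAt.comp z hY.hasFDerivAt).fderiv
  rw [show (fun z => (Y z).re) = Complex.reCLM ∘ Y from rfl, this]
  rfl

theorem im_fderiv {Y : ℂ → ℂ} {z : ℂ} (hY : DifferentiableAt ℝ Y z) (v : ℂ) :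
    fderiv ℝ (fun z => (Y z).im) z v = (fderiv ℝ Y z v).im := by
  have := (Complex.imCLM.hasFDerivAt.comp z hY.hasFDerivAt).fderiv
  rw [show (fun z => (Y z).im) = Complex.imCLM ∘ Y from rfl, this]
  rfl

theorem continuousOn_planeDiv {U : Set ℂ} (hU : IsOpen U) {Y : ℂ → ℂ} (hY : ContDiffOn ℝ 1 Y U) :
    ContinuousOn (planeDiv Y) U := by
  have h := hY.continuousOn_fderiv_of_isOpen hU le_rfl
  exact (Complex.continuous_re.comp_continuousOn (h.clm_apply continuousOn_const)).add
    (Complex.continuous_im.comp_continuousOn (h.clm_apply continuousOn_const))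

/-- The divergence theorem for a compactly supported multiple of a vector field. -/
theorem integral_mul_planeDiv {U : Set ℂ} (hU : IsOpen U) {Y : ℂ → ℂ} (hY : ContDiffOn ℝ 1 Y U)
    {T : ℂ → ℝ} (hT : ContDiff ℝ 1 T) (hc : HasCompactSupport T) (hTU : tsupport T ⊆ U) :
    ∫ z, T z * planeDiv Y z = - ∫ z, fderiv ℝ T z (Y z) := by
  have hYd : ∀ z ∈ U, DifferentiableAt ℝ Y z := fun z hz =>
    (hY.differentiableOn one_ne_zero).differentiableAt (hU.mem_nhds hz)
  have hfd := hY.continuousOn_fderiv_of_isOpen hU le_rfl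
  have hT' : ∀ v : ℂ, Continuous fun z => fderiv ℝ T z v := fun v =>
    (hT.continuous_fderiv one_ne_zero).clm_apply continuous_const
  have hT'c : ∀ v : ℂ, HasCompactSupport fun z => fderiv ℝ T z v := fun v =>
    (hc.fderiv (𝕜 := ℝ)).comp_left (g := fun L : ℂ →L[ℝ] ℝ => L v) (by simp)
  have hT'U : ∀ v : ℂ, tsupport (fun z => fderiv ℝ T z v) ⊆ U := fun v =>
    (closure_mono (fun z hz => by
      simp only [Function.mem_support] at hz ⊢
      intro h0; exact hz (by rw [h0]; rfl))).trans ((tsupport_fderiv_subset ℝ).trans hTU)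
  have parts : ∀ (p : ℂ → ℝ) (v : ℂ), ContDiffOn ℝ 1 p U →
      Integrable (fun z => T z * fderiv ℝ p z v) ∧ Integrable (fun z => fderiv ℝ T z v * p z) ∧
      ∫ z, T z * fderiv ℝ p z v = - ∫ z, fderiv ℝ T z v * p z := by
    intro p v hp
    have hpd := hp.continuousOn_fderiv_of_isOpen hU le_rfl
    have i1 := integrable_mul_of_tsupport_subset hU hT.continuous hc hTU
      (hpd.clm_apply (continuousOn_const (c := v)))
    have i2 := integrable_mul_of_tsupport_subset hU (hT' v) (hT'c v) (hT'U v) hp.continuousOn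
    refine ⟨i1, i2, integral_mul_fderiv_eq_neg_fderiv_mul_of_integrable i2 i1
      (integrable_mul_of_tsupport_subset hU hT.continuous hc hTU hp.continuousOn)
      (fun x _ => hT.differentiable one_ne_zero x) (fun x hx =>
        (hp.differentiableOn one_ne_zero).differentiableAt (hU.mem_nhds (hTU hx)))⟩
  obtain ⟨a1, a2, a3⟩ := parts (fun z => (Y z).re) 1 (Complex.reCLM.contDiff.comp_contDiffOn hY)
  obtain ⟨b1, b2, b3⟩ := parts (fun z => (Y z).im) Complex.I
    (Complex.imCLM.contDiff.comp_contDiffOn hY)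
  have e1 : ∀ z, T z * planeDiv Y z = T z * fderiv ℝ (fun z => (Y z).re) z 1 +
      T z * fderiv ℝ (fun z => (Y z).im) z Complex.I := by
    intro z
    by_cases hz : z ∈ tsupport T
    · rw [re_fderiv (hYd z (hTU hz)), im_fderiv (hYd z (hTU hz)), planeDiv, mul_add]
    · simp [image_eq_zero_of_notMem_tsupport hz]
  have e2 : ∀ z, fderiv ℝ T z (Y z) = fderiv ℝ T z 1 * (Y z).re +
      fderiv ℝ T z Complex.I * (Y z).im := by
    intro z
    have : Y z = (Y z).re • (1 : ℂ) + (Y z).im • Complex.I := by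
      simp [Complex.re_add_im]
    conv_lhs => rw [this]
    rw [map_add, map_smul, map_smul, smul_eq_mul, smul_eq_mul]
    ring
  simp_rw [e1, e2]
  rw [integral_add a1 b1, integral_add a2 b2, a3, b3]
  ring

theorem integrable_fderiv_apply {U : Set ℂ} (hU : IsOpen U) {Y : ℂ → ℂ} (hY : ContinuousOn Y U)
    {φ : ℂ → ℝ} (hφ : ContDiff ℝ 1 φ) (hc : HasCompactSupport φ) (hφU : tsupport φ ⊆ U) :
    Integrable fun z => fderiv ℝ φ z (Y z) := by
  have hcont : ContinuousOn (fun z => fderiv ℝ φ z (Y z)) U :=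
    (hφ.continuous_fderiv one_ne_zero).continuousOn.clm_apply hY
  have hsub : tsupport (fun z => fderiv ℝ φ z (Y z)) ⊆ tsupport (fderiv ℝ φ) :=
    closure_mono fun z hz => by
      simp only [Function.mem_support] at hz ⊢
      intro h0; exact hz (by rw [h0]; rfl)
  refine (hcont.continuous_of_tsupport_subset hU
    (hsub.trans ((tsupport_fderiv_subset ℝ).trans hφU))).integrable_of_hasCompactSupport ?_
  exact (hc.fderiv (𝕜 := ℝ)).mono' (subset_closure.trans hsub)

/-- A vector field of norm at most one and divergence at least `2h` for the conformal metric
`δ⁻² |dz|²` yields Cheeger's inequality for the Dirichlet integral. -/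
theorem cheeger_inequality {U : Set ℂ} (hU : IsOpen U) {Y : ℂ → ℂ} (hY : ContDiffOn ℝ 1 Y U)
    {δ : ℂ → ℝ} (hδ : ContinuousOn δ U) (hpos : ∀ z ∈ U, 0 < δ z) {h : ℝ} (hh : 0 < h)
    (hYn : ∀ z ∈ U, ‖Y z‖ ≤ 1 / δ z) (hdiv : ∀ z ∈ U, 2 * h / δ z ^ 2 ≤ planeDiv Y z)
    {φ : ℂ → ℝ} (hφ : ContDiff ℝ 1 φ) (hc : HasCompactSupport φ) (hφU : tsupport φ ⊆ U)
    (hφ0 : ∀ z, 0 ≤ φ z) {Q : ℂ → ℝ} (hQ0 : ∀ z, 0 ≤ Q z) (hQ : Integrable Q)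
    (hQφ : ∀ z ∈ U, ‖fderiv ℝ φ z‖ ^ 2 ≤ φ z * Q z) :
    4 * h ^ 2 * ∫ z, φ z * (1 / δ z ^ 2) ≤ ∫ z, Q z := by
  have hδ2 : ContinuousOn (fun z => 1 / δ z ^ 2) U :=
    continuousOn_const.div (hδ.pow 2) fun z hz => pow_ne_zero _ (hpos z hz).ne'
  have i1 := integrable_mul_of_tsupport_subset hU hφ.continuous hc hφU hδ2
  have i2 := integrable_mul_of_tsupport_subset hU hφ.continuous hc hφU (continuousOn_planeDiv hU hY)
  have hzero : ∀ z, z ∉ U → φ z = 0 ∧ fderiv ℝ φ z = 0 := fun z hz =>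
    ⟨image_eq_zero_of_notMem_tsupport fun h => hz (hφU h),
      image_eq_zero_of_notMem_tsupport fun h => hz (hφU (tsupport_fderiv_subset ℝ h))⟩
  have i3 := integrable_fderiv_apply hU hY.continuousOn hφ hc hφU
  have s1 : 2 * h * ∫ z, φ z * (1 / δ z ^ 2) ≤ ∫ z, φ z * planeDiv Y z := by
    rw [← integral_const_mul]
    refine integral_mono (i1.const_mul _) i2 fun z => ?_
    by_cases hz : z ∈ U
    · have := mul_le_mul_of_nonneg_left (hdiv z hz) (hφ0 z)
      refine le_trans (le_of_eq ?_) this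
      ring
    · simp [(hzero z hz).1]
  -- Pointwise `|∇φ|/δ ≤ √(φ/δ²) √Q`. The weights in the arithmetic-geometric mean inequality are
  -- chosen so that half of the left side of `s1` is absorbed. For `φ = f²` the natural choice is `Q
  -- = 4|∇f|²`.
  have s2 : - ∫ z, fderiv ℝ φ z (Y z) ≤
      h * (∫ z, φ z * (1 / δ z ^ 2)) + 1 / (4 * h) * ∫ z, Q z := by
    rw [← integral_neg, ← integral_const_mul, ← integral_const_mul,
      ← integral_add (i1.const_mul _) (hQ.const_mul _)]
    refine integral_mono i3.neg ((i1.const_mul _).add (hQ.const_mul _)) fun z => ?_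
    by_cases hz : z ∈ U
    swap
    · have := hQ0 z
      simp only [(hzero z hz).1, (hzero z hz).2]
      simp only [zero_mul, mul_zero, zero_add]
      simp
      positivity
    have hd := hpos z hz
    have b1 : -(fderiv ℝ φ z (Y z)) ≤ ‖fderiv ℝ φ z‖ * (1 / δ z) := by
      calc -(fderiv ℝ φ z (Y z)) ≤ ‖fderiv ℝ φ z (Y z)‖ := neg_le_abs _
        _ ≤ ‖fderiv ℝ φ z‖ * ‖Y z‖ := ContinuousLinearMap.le_opNorm _ _
        _ ≤ _ := mul_le_mul_of_nonneg_left (hYn z hz) (norm_nonneg _)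
    refine b1.trans ?_
    set x := ‖fderiv ℝ φ z‖
    have hx : 0 ≤ x := norm_nonneg _
    have b2 : x ^ 2 ≤ φ z * Q z := hQφ z hz
    set e := 1 / δ z with he
    have he0 : 0 < e := by positivity
    have he2 : 1 / δ z ^ 2 = e ^ 2 := by rw [he, div_pow, one_pow]
    rw [he2]
    have hA : 0 ≤ h * (φ z * e ^ 2) := by have := hφ0 z; positivity
    have hB : 0 ≤ 1 / (4 * h) * Q z := by have := hQ0 z; positivity
    have hAB : (x * e) ^ 2 ≤ 4 * (h * (φ z * e ^ 2)) * (1 / (4 * h) * Q z) := by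
      rw [show 4 * (h * (φ z * e ^ 2)) * (1 / (4 * h) * Q z) = (φ z * Q z) * e ^ 2 by
        field_simp, mul_pow]
      exact mul_le_mul_of_nonneg_right b2 (by positivity)
    refine abs_le_of_sq_le_sq' (a := x * e) ?_ (by positivity) |>.2
    nlinarith [sq_nonneg (h * (φ z * e ^ 2) - 1 / (4 * h) * Q z)]
  rw [integral_mul_planeDiv hU hY hφ hc hφU] at s1
  have s3 := s1.trans s2
  have s4 : h * ∫ z, φ z * (1 / δ z ^ 2) ≤ 1 / (4 * h) * ∫ z, Q z := by linarith
  have s5 := mul_le_mul_of_nonneg_left s4 (show 0 ≤ 4 * h by positivity)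
  rw [← mul_assoc, ← mul_assoc, mul_one_div_cancel (by positivity), one_mul] at s5
  refine le_trans (le_of_eq ?_) s5
  ring

/-! ### Holomorphic change of variables and radial integrals -/

theorem abs_det_real_smul_one (c : ℂ) :
    |(c • (1 : ℂ →L[ℝ] ℂ)).det| = ‖c‖ ^ 2 := by
  have : (c • (1 : ℂ →L[ℝ] ℂ)).det = Algebra.norm ℝ c := by
    rw [Algebra.norm_apply]
    congr 1
  rw [this, Algebra.norm_complex_apply, Complex.normSq_eq_norm_sq, abs_of_nonneg (by positivity)]

theorem hasFDerivWithinAt_of_deriv {U : Set ℂ} (hU : IsOpen U) {g : ℂ → ℂ}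
    (hg : DifferentiableOn ℂ g U) : ∀ z ∈ U,
    HasFDerivWithinAt g (deriv g z • (1 : ℂ →L[ℝ] ℂ)) U z := fun _ hz =>
  (hg.differentiableAt (hU.mem_nhds hz)).hasDerivAt.complexToReal_fderiv.hasFDerivWithinAt

theorem integral_image_holomorphic {U : Set ℂ} (hU : IsOpen U) {g : ℂ → ℂ}
    (hg : DifferentiableOn ℂ g U) (hi : InjOn g U) (F : ℂ → ℝ) :
    ∫ w in g '' U, F w = ∫ z in U, ‖deriv g z‖ ^ 2 * F (g z) := by
  rw [integral_image_eq_integral_abs_det_fderiv_smul volume hU.measurableSet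
    (hasFDerivWithinAt_of_deriv hU hg) hi]
  simp_rw [abs_det_real_smul_one, smul_eq_mul]

theorem integrableOn_image_holomorphic {U : Set ℂ} (hU : IsOpen U) {g : ℂ → ℂ}
    (hg : DifferentiableOn ℂ g U) (hi : InjOn g U) (F : ℂ → ℝ) :
    IntegrableOn F (g '' U) ↔ IntegrableOn (fun z => ‖deriv g z‖ ^ 2 * F (g z)) U := by
  rw [integrableOn_image_iff_integrableOn_abs_det_fderiv_smul volume hU.measurableSet
    (hasFDerivWithinAt_of_deriv hU hg) hi]
  simp_rw [abs_det_real_smul_one, smul_eq_mul]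

/-- Integration of a radial function over a disc. -/
theorem integral_ball_radial {F : ℝ → ℝ} {ρ : ℝ} (hρ : 0 ≤ ρ)
    (hF : ContinuousOn F (Icc 0 (ρ ^ 2))) :
    ∫ w in ball (0 : ℂ) ρ, F (‖w‖ ^ 2) = Real.pi * ∫ x in (0 : ℝ)..ρ ^ 2, F x := by
  have h1 : ∫ w in ball (0 : ℂ) ρ, F (‖w‖ ^ 2) =
      ∫ w : ℂ, (Iio ρ).indicator (fun r => F (r ^ 2)) ‖w‖ := by
    rw [← integral_indicator measurableSet_ball]
    congr 1
    ext w
    by_cases hw : ‖w‖ < ρ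
    · rw [indicator_of_mem (by simpa using hw), indicator_of_mem (by simpa using hw)]
    · rw [indicator_of_notMem (by simpa using hw), indicator_of_notMem (by simpa using hw)]
  have hball : volume.real (ball (0 : ℂ) 1) = Real.pi := by
    simp [Measure.real, Complex.volume_ball]
  rw [h1, integral_fun_norm_addHaar volume, Complex.finrank_real_complex, hball]
  have h2 : ∫ y in Ioi (0 : ℝ), y ^ (2 - 1) • (Iio ρ).indicator (fun r => F (r ^ 2)) y =
      ∫ y in (0 : ℝ)..ρ, y * F (y ^ 2) := by
    rw [intervalIntegral.integral_of_le hρ,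
      integral_Ioc_eq_integral_Ioo, ← integral_indicator measurableSet_Ioi,
      ← integral_indicator measurableSet_Ioo]
    congr 1
    ext y
    simp only [indicator_apply, mem_Ioi, mem_Iio, mem_Ioo, pow_one, smul_eq_mul,
      show 2 - 1 = 1 from rfl]
    by_cases h0 : 0 < y <;> by_cases h1 : y < ρ <;> simp [h0, h1]
  have h3 := intervalIntegral.integral_comp_mul_deriv'' (a := 0) (b := ρ) (f := fun y => y ^ 2)
    (f' := fun y => 2 * y) (g := F) (by fun_prop)
    (fun x _ => by simpa using (hasDerivAt_pow 2 x).hasDerivWithinAt) (by fun_prop)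
    (hF.mono (by
      rintro _ ⟨y, hy, rfl⟩
      rw [uIcc_of_le hρ] at hy
      exact ⟨by positivity, pow_le_pow_left₀ hy.1 hy.2 2⟩))
  have h4 : ∫ x in (0 : ℝ)..ρ ^ 2, F x = 2 * ∫ y in (0 : ℝ)..ρ, y * F (y ^ 2) := by
    rw [← intervalIntegral.integral_const_mul]
    simp only [ne_eq, OfNat.ofNat_ne_zero, not_false_eq_true, zero_pow] at h3
    rw [← h3]
    congr 1
    ext y
    simp only [Function.comp]
    ring
  rw [h2, h4]
  simp only [nsmul_eq_mul, smul_eq_mul]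
  push_cast
  ring

/-! ### Liouville's equation for the pulled-back hyperbolic metric -/

/-- The real linear functional `v ↦ Re (w̄ v)`, the Euclidean inner product with `w`. -/
noncomputable def planeInner (w : ℂ) : ℂ →L[ℝ] ℝ := innerSL ℝ w

theorem planeInner_apply (w v : ℂ) : planeInner w v = (conj w * v).re := by
  rw [planeInner, innerSL_apply_apply, Complex.inner, mul_comm]

theorem norm_planeInner (w : ℂ) : ‖planeInner w‖ = ‖w‖ := innerSL_apply_norm ℝ w

theorem planeInner_self (w : ℂ) : planeInner w w = ‖w‖ ^ 2 := by
  simp [planeInner]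

/-- The logarithm of the density of the pullback under `g` of the hyperbolic metric. -/
noncomputable def hypLog (g : ℂ → ℂ) (z : ℂ) : ℝ :=
  (1 / 2) * Real.log (‖deriv g z‖ ^ 2) - Real.log (1 - ‖g z‖ ^ 2) + Real.log 2

/-- The Euclidean gradient of `hypLog g`. -/
noncomputable def hypGrad (g : ℂ → ℂ) (z : ℂ) : ℂ :=
  conj (deriv (deriv g) z / deriv g z) + 2 * conj (deriv g z) * g z * ((1 - ‖g z‖ ^ 2)⁻¹ : ℝ)

theorem IsDiscEmbedding.one_sub_pos {U : Set ℂ} {g : ℂ → ℂ} (hg : IsDiscEmbedding U g) {z : ℂ}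
    (hz : z ∈ U) : 0 < 1 - ‖g z‖ ^ 2 := by
  nlinarith [hg.norm_lt_one z hz, norm_nonneg (g z)]

theorem IsDiscEmbedding.exp_hypLog {U : Set ℂ} {g : ℂ → ℂ} (hg : IsDiscEmbedding U g) {z : ℂ}
    (hz : z ∈ U) :
    Real.exp (2 * hypLog g z) = 4 * ‖deriv g z‖ ^ 2 / (1 - ‖g z‖ ^ 2) ^ 2 := by
  have h1 := hg.one_sub_pos hz
  have h2 : 0 < ‖deriv g z‖ := norm_pos_iff.mpr (hg.deriv_ne_zero z hz)
  rw [hypLog, show 2 * ((1 / 2) * Real.log (‖deriv g z‖ ^ 2) - Real.log (1 - ‖g z‖ ^ 2) +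
      Real.log 2) = Real.log (‖deriv g z‖ ^ 2) - Real.log ((1 - ‖g z‖ ^ 2) ^ 2) +
      Real.log (2 ^ 2) by
      simp only [Real.log_pow]; push_cast; ring,
    ← Real.log_div (by positivity) (by positivity), ← Real.log_mul (by positivity) (by positivity),
    Real.exp_log (by positivity)]
  ring

theorem IsDiscEmbedding.hasFDerivAt_hypLog {U : Set ℂ} (hU : IsOpen U) {g : ℂ → ℂ}
    (hg : IsDiscEmbedding U g) {z : ℂ} (hz : z ∈ U) :
    HasFDerivAt (hypLog g) (planeInner (hypGrad g z)) z := by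
  have h1 := hg.one_sub_pos hz
  have h2 := hg.deriv_ne_zero z hz
  have d1 : HasFDerivAt g (deriv g z • (1 : ℂ →L[ℝ] ℂ)) z :=
    (hg.differentiableOn.differentiableAt (hU.mem_nhds hz)).hasDerivAt.complexToReal_fderiv
  have d2 : HasFDerivAt (deriv g) (deriv (deriv g) z • (1 : ℂ →L[ℝ] ℂ)) z :=
    ((hg.differentiableOn.deriv hU).differentiableAt
      (hU.mem_nhds hz)).hasDerivAt.complexToReal_fderiv
  have e1 := (d2.norm_sq.log (by positivity)).const_mul (1 / 2)
  have e2 := (d1.norm_sq.const_sub 1).log h1.ne'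
  refine ((e1.sub e2).add_const (Real.log 2)).congr_fderiv ?_
  ext v
  rw [planeInner_apply]
  simp only [hypGrad, FunLike.coe_smul, FunLike.coe_sub,
    ContinuousLinearMap.coe_comp, Pi.smul_apply, Pi.sub_apply, Function.comp_apply,
    neg_apply, innerSL_apply_apply, Complex.inner, smul_eq_mul, nsmul_eq_mul,
    map_add, map_mul, Complex.conj_conj, Complex.conj_ofReal, map_ofNat, one_apply_eq_self]
  have k1 : deriv (deriv g) z / deriv g z =
      ((‖deriv g z‖ ^ 2)⁻¹ : ℝ) * (conj (deriv g z) * deriv (deriv g) z) := by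
    have : ((‖deriv g z‖ ^ 2 : ℝ) : ℂ) = deriv g z * conj (deriv g z) := by
      rw [Complex.mul_conj']; push_cast; rfl
    rw [Complex.ofReal_inv, this]
    have h3 : conj (deriv g z) ≠ 0 := (map_ne_zero _).mpr h2
    field_simp
  rw [k1]
  rw [show (((‖deriv g z‖ ^ 2)⁻¹ : ℝ) * (conj (deriv g z) * deriv (deriv g) z) +
    2 * deriv g z * conj (g z) * ((1 - ‖g z‖ ^ 2)⁻¹ : ℝ)) * v =
    ((‖deriv g z‖ ^ 2)⁻¹ : ℝ) * (conj (deriv g z) * (deriv (deriv g) z * v)) +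
    ((2 * (1 - ‖g z‖ ^ 2)⁻¹ : ℝ) : ℂ) * (conj (g z) * (deriv g z * v)) by push_cast; ring]
  rw [Complex.add_re, Complex.re_ofReal_mul, Complex.re_ofReal_mul]
  push_cast
  ring_nf
  simp
  ring_nf

theorem IsDiscEmbedding.contDiffOn_hypGrad {U : Set ℂ} (hU : IsOpen U) {g : ℂ → ℂ}
    (hg : IsDiscEmbedding U g) : ContDiffOn ℝ 1 (hypGrad g) U := by
  have c0 : ContDiffOn ℝ 1 g U := (hg.differentiableOn.contDiffOn hU).restrict_scalars ℝ
  have c1 : ContDiffOn ℝ 1 (deriv g) U :=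
    ((hg.differentiableOn.deriv hU).contDiffOn hU).restrict_scalars ℝ
  have c2 : ContDiffOn ℝ 1 (deriv (deriv g)) U :=
    (((hg.differentiableOn.deriv hU).deriv hU).contDiffOn hU).restrict_scalars ℝ
  have hconj : ContDiff ℝ 1 (fun z : ℂ => conj z) := Complex.conjCLE.contDiff
  refine (hconj.comp_contDiffOn (c2.mul (c1.inv hg.deriv_ne_zero))).add
    (((contDiffOn_const.mul (hconj.comp_contDiffOn c1)).mul c0).mul ?_)
  refine Complex.ofRealCLM.contDiff.comp_contDiffOn ((contDiffOn_const.sub (c0.norm_sq ℝ)).inv ?_)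
  exact fun z hz => (hg.one_sub_pos hz).ne'

theorem planeDiv_eq_of_hasFDerivAt {Y : ℂ → ℂ} {z : ℂ} {Y' : ℂ →L[ℝ] ℂ} (h : HasFDerivAt Y Y' z) :
    planeDiv Y z = (Y' 1).re + (Y' Complex.I).im := by
  rw [planeDiv, h.fderiv]

/-- Liouville's equation `Δu = e^{2u}`, that is, curvature `-1`. The summand `conj (g''/g')` of the
gradient is the conjugate of a holomorphic function, hence divergence-free; the other summand
produces the exponential. -/
theorem IsDiscEmbedding.planeDiv_hypGrad {U : Set ℂ} (hU : IsOpen U) {g : ℂ → ℂ}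
    (hg : IsDiscEmbedding U g) {z : ℂ} (hz : z ∈ U) :
    planeDiv (hypGrad g) z = Real.exp (2 * hypLog g z) := by
  have h1 := hg.one_sub_pos hz
  have h2 := hg.deriv_ne_zero z hz
  have d1 : HasFDerivAt g (deriv g z • (1 : ℂ →L[ℝ] ℂ)) z :=
    (hg.differentiableOn.differentiableAt (hU.mem_nhds hz)).hasDerivAt.complexToReal_fderiv
  have d2 : HasFDerivAt (deriv g) (deriv (deriv g) z • (1 : ℂ →L[ℝ] ℂ)) z :=
    ((hg.differentiableOn.deriv hU).differentiableAt
      (hU.mem_nhds hz)).hasDerivAt.complexToReal_fderiv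
  have hq : DifferentiableAt ℂ (fun z => deriv (deriv g) z / deriv g z) z :=
    (((hg.differentiableOn.deriv hU).deriv hU).differentiableAt (hU.mem_nhds hz)).div
      ((hg.differentiableOn.deriv hU).differentiableAt (hU.mem_nhds hz)) h2
  have d3 := Complex.conjCLE.hasFDerivAt.comp z hq.hasDerivAt.complexToReal_fderiv
  set k := deriv (fun z => deriv (deriv g) z / deriv g z) z
  have d4 := Complex.conjCLE.hasFDerivAt.comp z d2
  have d5 := Complex.ofRealCLM.hasFDerivAt.comp z
    ((hasDerivAt_inv h1.ne').comp_hasFDerivAt z (d1.norm_sq.const_sub 1))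
  have d6 := d3.add (((d4.const_mul 2).mul d1).mul d5)
  rw [planeDiv_eq_of_hasFDerivAt (Y := hypGrad g) d6, hg.exp_hypLog hz]
  simp only [Pi.mul_apply, Function.comp_apply, add_apply, smul_apply,
    ContinuousLinearMap.comp_apply, ContinuousLinearEquiv.coe_coe, Complex.conjCLE_apply,
    one_apply_eq_self, Complex.ofRealCLM_apply, neg_apply,
    innerSL_apply_apply, Complex.inner, smul_eq_mul, nsmul_eq_mul]
  clear d6 d5 d4 d3 hq d2 d1
  rw [← Complex.normSq_eq_norm_sq (deriv g z), Complex.normSq_apply]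
  have hn : 1 - ‖g z‖ ^ 2 = 1 - ((g z).re * (g z).re + (g z).im * (g z).im) := by
    rw [← Complex.normSq_eq_norm_sq, Complex.normSq_apply]
  generalize deriv (deriv g) z = p at *
  generalize deriv g z = q at *
  generalize k = k at *
  generalize 1 - ‖g z‖ ^ 2 = d at *
  generalize g z = w at *
  simp only [Complex.add_re,
    Complex.add_im, Complex.mul_re, Complex.mul_im, Complex.conj_re, Complex.conj_im,
    Complex.ofReal_re, Complex.ofReal_im, Complex.one_re, Complex.one_im, Complex.I_re,
    Complex.I_im, Complex.re_ofNat, Complex.im_ofNat]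
  field_simp
  simp
  rw [hn]
  ring

/-! ### Cutoff functions and the Schwarz-Yau lemma -/

/-- The conformal metric `δ⁻² |dz|²` on `U` has compactly supported cutoff functions with
arbitrarily small gradient. -/
def HasCutoffs (U : Set ℂ) (δ : ℂ → ℝ) : Prop :=
  ∀ K ⊆ U, IsCompact K → ∀ ε : ℝ, 0 < ε → ∃ ζ : ℂ → ℝ, ContDiff ℝ 1 ζ ∧ HasCompactSupport ζ ∧
    tsupport ζ ⊆ U ∧ (∀ z ∈ K, ζ z = 1) ∧ ∀ z ∈ U, ‖fderiv ℝ ζ z‖ ≤ ε / δ z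

theorem hasDerivAt_max_zero_sq (t : ℝ) :
    HasDerivAt (fun t : ℝ => max t 0 ^ 2) (2 * max t 0) t := by
  rcases lt_trichotomy t 0 with h | h | h
  · rw [max_eq_right h.le, mul_zero]
    refine (hasDerivAt_const t (0 : ℝ)).congr_of_eventuallyEq ?_
    filter_upwards [Iio_mem_nhds h] with s hs
    simp [max_eq_right (le_of_lt (by simpa using hs))]
  · subst h
    rw [max_self, mul_zero, hasDerivAt_iff_isLittleO]
    simp only [max_self, smul_zero, sub_zero]
    refine Asymptotics.IsBigO.trans_isLittleO (g := fun s : ℝ => s ^ 2) ?_ ?_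
    · refine Asymptotics.IsBigO.of_bound 1 (Filter.Eventually.of_forall fun s => ?_)
      simp only [ne_eq, OfNat.ofNat_ne_zero, not_false_eq_true, zero_pow, sub_zero, norm_pow,
        Real.norm_eq_abs, one_mul]
      refine pow_le_pow_left₀ (abs_nonneg _) ?_ 2
      rw [abs_of_nonneg (le_max_right _ _)]
      exact max_le (le_abs_self s) (abs_nonneg s)
    · exact Asymptotics.isLittleO_pow_id one_lt_two
  · rw [max_eq_left h.le]
    have : HasDerivAt (fun t : ℝ => t ^ 2) (2 * t) t := by simpa using hasDerivAt_pow 2 t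
    refine this.congr_of_eventuallyEq ?_
    filter_upwards [Ioi_mem_nhds h] with s hs
    simp [max_eq_left (le_of_lt (by simpa using hs))]

/-- The positive part is only Lipschitz, but its square is `C¹`. This is why squared positive parts
are used as test functions throughout. -/
theorem contDiff_max_zero_sq : ContDiff ℝ 1 (fun t : ℝ => max t 0 ^ 2) := by
  rw [contDiff_one_iff_deriv]
  refine ⟨fun t => (hasDerivAt_max_zero_sq t).differentiableAt, ?_⟩
  rw [funext fun t => (hasDerivAt_max_zero_sq t).deriv]
  fun_prop

/-- The cubic term of the exponential series already suffices. The estimate lets the finite integral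
of `exp 2w` control the cubic error term in the Caccioppoli inequality. -/
theorem half_cube_le_exp {t : ℝ} (ht : 0 ≤ t) : t ^ 3 / 2 ≤ Real.exp (2 * t) := by
  have h1 := Real.sum_le_exp_of_nonneg (show 0 ≤ 2 * t by positivity) 4
  simp only [Finset.sum_range_succ, Finset.sum_range_zero, Nat.factorial] at h1
  push_cast at h1
  have : 0 ≤ t ^ 2 := by positivity
  have : 0 ≤ t ^ 3 := by positivity
  nlinarith

theorem contDiffOn_one_of_hasFDerivAt {U : Set ℂ} (hU : IsOpen U) {w : ℂ → ℝ} {V : ℂ → ℂ}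
    (hwd : ∀ z ∈ U, HasFDerivAt w (planeInner (V z)) z) (hV : ContinuousOn V U) :
    ContDiffOn ℝ 1 w U := by
  rw [show (1 : ℕ∞ω) = 0 + 1 by simp, contDiffOn_succ_iff_fderiv_of_isOpen hU]
  refine ⟨fun z hz => (hwd z hz).differentiableAt.differentiableWithinAt, by simp, ?_⟩
  rw [contDiffOn_zero]
  refine ContinuousOn.congr (f := fun z => planeInner (V z)) ?_ fun z hz => (hwd z hz).fderiv
  exact (innerSL ℝ).continuous.comp_continuousOn hV

/-- A Caccioppoli inequality for the positive part of `w`, tested against a cutoff function. -/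
theorem integral_cutoff_sq_mul_le {U : Set ℂ} (hU : IsOpen U) {w : ℂ → ℝ} {V : ℂ → ℂ}
    (hwd : ∀ z ∈ U, HasFDerivAt w (planeInner (V z)) z) (hV : ContDiffOn ℝ 1 V U)
    {δ : ℂ → ℝ} (hpos : ∀ z ∈ U, 0 < δ z) {q P : ℂ → ℝ} (hq : ContinuousOn q U)
    (hqV : ∀ z ∈ U, q z ≤ planeDiv V z) (hP : IntegrableOn P U)
    (hPw : ∀ z ∈ U, Real.exp (2 * w z) / δ z ^ 2 ≤ P z)
    {ζ : ℂ → ℝ} {ε : ℝ} (hζ : ContDiff ℝ 1 ζ) (hζc : HasCompactSupport ζ)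
    (hζU : tsupport ζ ⊆ U) (hζd : ∀ z ∈ U, ‖fderiv ℝ ζ z‖ ≤ ε / δ z) :
    ∫ z, ζ z ^ 2 * (max (w z) 0 ^ 2 * q z) ≤ ε ^ 2 * ∫ z in U, P z := by
  have hw1 := contDiffOn_one_of_hasFDerivAt hU hwd hV.continuousOn
  set T : ℂ → ℝ := fun z => ζ z ^ 2 * max (w z) 0 ^ 2 with hT
  have hζ2 : tsupport (fun z => ζ z ^ 2) ⊆ tsupport ζ := closure_mono fun z hz => by
    simp only [Function.mem_support] at hz ⊢
    intro h0; exact hz (by rw [h0]; simp)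
  have hTs : tsupport T ⊆ tsupport ζ :=
    (tsupport_mul_subset_left (f := fun z => ζ z ^ 2)).trans hζ2
  have hTU : tsupport T ⊆ U := hTs.trans hζU
  have hTc : HasCompactSupport T := hζc.mono' (subset_closure.trans hTs)
  have hT1 : ContDiff ℝ 1 T := contDiff_of_tsupport_subset hU
    ((hζ.pow 2).contDiffOn.mul (contDiff_max_zero_sq.comp_contDiffOn hw1)) hTU
  have hTd : ∀ z ∈ U, fderiv ℝ T z (V z) =
      2 * ζ z * max (w z) 0 ^ 2 * fderiv ℝ ζ z (V z) + 2 * ζ z ^ 2 * max (w z) 0 * ‖V z‖ ^ 2 := by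
    intro z hz
    have d1 := (hζ.differentiable one_ne_zero z).hasFDerivAt.pow 2
    have d2 := (hasDerivAt_max_zero_sq (w z)).comp_hasFDerivAt z (hwd z hz)
    have d3 := (d1.mul d2).fderiv
    have : fderiv ℝ T z = _ := d3
    rw [this]
    simp only [Function.comp_apply, add_apply, smul_apply, smul_eq_mul, planeInner_self,
      nsmul_eq_mul]
    push_cast
    ring
  have hpt : ∀ z ∈ U, -(fderiv ℝ T z (V z)) ≤ ε ^ 2 * P z := by
    intro z hz
    have hd := hpos z hz
    rw [hTd z hz]
    set m := max (w z) 0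
    have hm : 0 ≤ m := le_max_right _ _
    have b1 : |fderiv ℝ ζ z (V z)| ≤ ε / δ z * ‖V z‖ :=
      (ContinuousLinearMap.le_opNorm _ _).trans
        (mul_le_mul_of_nonneg_right (hζd z hz) (norm_nonneg _))
    have b2 : -(ζ z * fderiv ℝ ζ z (V z)) ≤ |ζ z| * (ε / δ z * ‖V z‖) :=
      (neg_le_abs _).trans (by rw [abs_mul]; exact mul_le_mul_of_nonneg_left b1 (abs_nonneg _))
    have b3 : -(2 * ζ z * m ^ 2 * fderiv ℝ ζ z (V z) + 2 * ζ z ^ 2 * m * ‖V z‖ ^ 2) ≤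
        m ^ 3 / 2 * (ε / δ z) ^ 2 := by
      have c1 := mul_le_mul_of_nonneg_left b2 (show 0 ≤ 2 * m ^ 2 by positivity)
      -- Completing the square absorbs the cross term into the good term `2ζ²m‖V‖²`, leaving an
      -- error free of `V`.
      have c2 : 0 ≤ 2 * m * (|ζ z| * ‖V z‖ - m * (ε / δ z) / 2) ^ 2 := by positivity
      have c3 : 2 * m * (|ζ z| * ‖V z‖ - m * (ε / δ z) / 2) ^ 2 = 2 * ζ z ^ 2 * m * ‖V z‖ ^ 2 -
          2 * m ^ 2 * (|ζ z| * (ε / δ z * ‖V z‖)) + m ^ 3 / 2 * (ε / δ z) ^ 2 := by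
        rw [← sq_abs (ζ z)]; ring
      linarith
    have b4 : m ^ 3 / 2 * (ε / δ z) ^ 2 ≤ Real.exp (2 * w z) * (ε / δ z) ^ 2 := by
      refine mul_le_mul_of_nonneg_right ?_ (by positivity)
      rcases le_total (w z) 0 with h | h
      · rw [show m = 0 from max_eq_right h]
        have := Real.exp_pos (2 * w z)
        simpa using this.le
      · rw [show m = w z from max_eq_left h]
        exact half_cube_le_exp h
    refine (b3.trans b4).trans (le_trans (le_of_eq ?_)
      (mul_le_mul_of_nonneg_left (hPw z hz) (sq_nonneg ε)))
    ring
  have hT0 : ∀ z, z ∉ U → T z = 0 ∧ fderiv ℝ T z = 0 := fun z hz =>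
    ⟨image_eq_zero_of_notMem_tsupport fun h => hz (hTU h),
      image_eq_zero_of_notMem_tsupport fun h => hz (hTU (tsupport_fderiv_subset ℝ h))⟩
  calc ∫ z, ζ z ^ 2 * (max (w z) 0 ^ 2 * q z)
      = ∫ z, T z * q z := by
        congr 1; ext z; rw [hT]; ring
    _ ≤ ∫ z, T z * planeDiv V z := by
        refine integral_mono (integrable_mul_of_tsupport_subset hU hT1.continuous hTc hTU hq)
          (integrable_mul_of_tsupport_subset hU hT1.continuous hTc hTU
            (continuousOn_planeDiv hU hV)) fun z => ?_
        by_cases hz : z ∈ U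
        · exact mul_le_mul_of_nonneg_left (hqV z hz) (by positivity)
        · simp [(hT0 z hz).1]
    _ = ∫ z, -(fderiv ℝ T z (V z)) := by
        rw [integral_mul_planeDiv hU hV hT1 hTc hTU, integral_neg]
    _ = ∫ z in U, -(fderiv ℝ T z (V z)) := by
        rw [setIntegral_eq_integral_of_forall_compl_eq_zero]
        intro z hz
        simp [(hT0 z hz).2]
    _ ≤ ∫ z in U, ε ^ 2 * P z :=
        setIntegral_mono_on
          (integrable_fderiv_apply hU hV.continuousOn hT1 hTc hTU).neg.integrableOn
          (hP.const_mul _) hU.measurableSet hpt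
    _ = ε ^ 2 * ∫ z in U, P z := integral_const_mul _ _

/-- A function `w` with `Δw ≥ 2bw` for a conformal metric with cutoff functions, such that `exp 2w`
is integrable, is nonpositive. -/
theorem nonpos_of_hasCutoffs {U : Set ℂ} (hU : IsOpen U) {w : ℂ → ℝ} {V : ℂ → ℂ}
    (hwd : ∀ z ∈ U, HasFDerivAt w (planeInner (V z)) z) (hV : ContDiffOn ℝ 1 V U)
    {δ : ℂ → ℝ} (hδ : ContinuousOn δ U) (hpos : ∀ z ∈ U, 0 < δ z) (hcut : HasCutoffs U δ)
    {b : ℝ} (hb : 0 < b) (hdivV : ∀ z ∈ U, b / δ z ^ 2 * (2 * w z) ≤ planeDiv V z)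
    {P : ℂ → ℝ} (hP : IntegrableOn P U) (hP0 : ∀ z ∈ U, 0 ≤ P z)
    (hPw : ∀ z ∈ U, Real.exp (2 * w z) / δ z ^ 2 ≤ P z) :
    ∀ z ∈ U, w z ≤ 0 := by
  intro z₀ hz₀
  by_contra hcon
  have hw0 : 0 < w z₀ := not_le.mp hcon
  have hwc : ContinuousOn w U := fun z hz => (hwd z hz).continuousAt.continuousWithinAt
  set q : ℂ → ℝ := fun z => b / δ z ^ 2 * (2 * w z) with hqdef
  have hqc : ContinuousOn q U :=
    (continuousOn_const.div (hδ.pow 2) fun z hz => pow_ne_zero _ (hpos z hz).ne').mul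
      (continuousOn_const.mul hwc)
  set G : ℂ → ℝ := fun z => max (w z) 0 ^ 2 * q z with hG
  have hGc : ContinuousOn G U := ((hwc.sup continuousOn_const).pow 2).mul hqc
  have hG0 : ∀ z ∈ U, 0 ≤ G z := by
    intro z hz
    have := hpos z hz
    rcases le_total (w z) 0 with h | h
    · simp [hG, max_eq_right h]
    · simp only [hG, hqdef]; positivity
  have hGz : 0 < G z₀ := by
    have := hpos z₀ hz₀
    simp only [hG, hqdef, max_eq_left hw0.le]; positivity
  obtain ⟨s, hs, hsU⟩ : ∃ s > 0, closedBall z₀ s ⊆ {z | z ∈ U ∧ G z₀ / 2 < G z} := by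
    have h1 : {z | z ∈ U ∧ G z₀ / 2 < G z} ∈ nhds z₀ :=
      Filter.inter_mem (hU.mem_nhds hz₀)
        ((hGc.continuousAt (hU.mem_nhds hz₀)).eventually (lt_mem_nhds (by linarith)))
    exact Metric.nhds_basis_closedBall.mem_iff.mp h1
  have hBU : closedBall z₀ s ⊆ U := fun z hz => (hsU hz).1
  set μ := volume.real (closedBall z₀ s) with hμ
  have hμ0 : 0 < μ := by
    rw [hμ, Measure.real, ENNReal.toReal_pos_iff]
    exact ⟨Metric.measure_closedBall_pos volume z₀ hs, measure_closedBall_lt_top⟩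
  set I := ∫ z in U, P z
  have hI0 : 0 ≤ I := setIntegral_nonneg hU.measurableSet hP0
  -- Chosen so that `ε² I` is less than the mass `G z₀ / 2 * μ` that the left side of the
  -- Caccioppoli inequality must have if `w z₀ > 0`; the `+ 1` allows `I = 0`.
  set ε := √(G z₀ / 2 * μ / (2 * (I + 1))) with hε
  have hε0 : 0 < ε := Real.sqrt_pos.mpr (by positivity)
  obtain ⟨ζ, hζ, hζc, hζU, hζ1, hζd⟩ := hcut _ hBU (isCompact_closedBall z₀ s) ε hε0
  have hk := integral_cutoff_sq_mul_le hU hwd hV hpos hqc hdivV hP hPw hζ hζc hζU hζd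
  have hlow : G z₀ / 2 * μ ≤ ∫ z, ζ z ^ 2 * G z := by
    have hζ2 : tsupport (fun z => ζ z ^ 2) ⊆ tsupport ζ := closure_mono fun z hz => by
      simp only [Function.mem_support] at hz ⊢
      intro h0; exact hz (by rw [h0]; simp)
    have hint : Integrable fun z => ζ z ^ 2 * G z :=
      integrable_mul_of_tsupport_subset hU (hζ.continuous.pow 2)
        (hζc.mono' (subset_closure.trans hζ2)) (hζ2.trans hζU) hGc
    have hnn : ∀ z, 0 ≤ ζ z ^ 2 * G z := by
      intro z
      by_cases hz : z ∈ U
      · exact mul_nonneg (sq_nonneg _) (hG0 z hz)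
      · rw [image_eq_zero_of_notMem_tsupport fun h => hz (hζU h)]; simp
    calc G z₀ / 2 * μ = ∫ _z in closedBall z₀ s, G z₀ / 2 := by
          rw [setIntegral_const, smul_eq_mul, mul_comm]
      _ ≤ ∫ z in closedBall z₀ s, ζ z ^ 2 * G z := by
          refine setIntegral_mono_on (integrableOn_const measure_closedBall_lt_top.ne)
            hint.integrableOn measurableSet_closedBall fun z hz => ?_
          rw [hζ1 z hz, one_pow, one_mul]
          exact (hsU hz).2.le
      _ ≤ _ := setIntegral_le_integral hint (Filter.Eventually.of_forall hnn)
  have hfin : ε ^ 2 * I < G z₀ / 2 * μ := by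
    rw [hε, Real.sq_sqrt (by positivity)]
    have h2 : I / (2 * (I + 1)) < 1 := by rw [div_lt_one (by positivity)]; linarith
    have h3 : 0 < G z₀ / 2 * μ := by positivity
    calc G z₀ / 2 * μ / (2 * (I + 1)) * I = G z₀ / 2 * μ * (I / (2 * (I + 1))) := by ring
      _ < G z₀ / 2 * μ * 1 := mul_lt_mul_of_pos_left h2 h3
      _ = _ := mul_one _
  exact absurd (hlow.trans hk) (not_le.mpr hfin)

/-- The Schwarz-Yau lemma: a holomorphic map from a surface whose conformal metric has curvature at
least `-a²` and cutoff functions to the hyperbolic disc dilates lengths by a factor at most `a`. -/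
theorem IsDiscEmbedding.schwarz_yau {U : Set ℂ} (hU : IsOpen U) {g : ℂ → ℂ}
    (hg : IsDiscEmbedding U g) {r : ℝ} (hr : r < 1) (hgr : ∀ z ∈ U, ‖g z‖ ≤ r)
    {δ : ℂ → ℝ} (hδ : ContinuousOn δ U) (hpos : ∀ z ∈ U, 0 < δ z) (hcut : HasCutoffs U δ)
    {D : ℂ → ℂ} (hD : ContDiffOn ℝ 1 D U)
    (hδD : ∀ z ∈ U, HasFDerivAt (fun z => Real.log (δ z)) (planeInner (D z)) z)
    {a : ℝ} (ha : 0 < a) (hcurv : ∀ z ∈ U, -a ^ 2 / δ z ^ 2 ≤ planeDiv D z) :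
    ∀ z ∈ U, 4 * ‖deriv g z‖ ^ 2 / (1 - ‖g z‖ ^ 2) ^ 2 ≤ a ^ 2 / δ z ^ 2 := by
  -- Half the logarithm of the ratio between the pulled-back hyperbolic area and `a²` times the area
  -- of `M`. The lemma says that `w ≤ 0`.
  set w : ℂ → ℝ := fun z => hypLog g z + Real.log (δ z) - Real.log a with hw
  set V : ℂ → ℂ := fun z => hypGrad g z + D z with hV
  have hwd : ∀ z ∈ U, HasFDerivAt w (planeInner (V z)) z := by
    intro z hz
    refine (((hg.hasFDerivAt_hypLog hU hz).add (hδD z hz)).sub_const _).congr_fderiv ?_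
    simp [planeInner, hV]
  have hVc : ContDiffOn ℝ 1 V U := (hg.contDiffOn_hypGrad hU).add hD
  have hexp : ∀ z ∈ U, Real.exp (2 * w z) =
      4 * ‖deriv g z‖ ^ 2 / (1 - ‖g z‖ ^ 2) ^ 2 * δ z ^ 2 / a ^ 2 := by
    intro z hz
    rw [hw, show 2 * (hypLog g z + Real.log (δ z) - Real.log a) =
      2 * hypLog g z + 2 * Real.log (δ z) - 2 * Real.log a by ring, Real.exp_sub, Real.exp_add,
      hg.exp_hypLog hz, ← Real.log_rpow (hpos z hz), ← Real.log_rpow ha,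
      Real.exp_log (Real.rpow_pos_of_pos (hpos z hz) _), Real.exp_log (Real.rpow_pos_of_pos ha _)]
    norm_num
  have hdivV : ∀ z ∈ U, a ^ 2 / δ z ^ 2 * (2 * w z) ≤ planeDiv V z := by
    intro z hz
    have hd := hpos z hz
    have e1 : planeDiv V z = planeDiv (hypGrad g) z + planeDiv D z := by
      have d1 := ((hg.contDiffOn_hypGrad hU).differentiableOn one_ne_zero).differentiableAt
        (hU.mem_nhds hz)
      have d2 := (hD.differentiableOn one_ne_zero).differentiableAt (hU.mem_nhds hz)
      rw [planeDiv_eq_of_hasFDerivAt (Y := V) (d1.hasFDerivAt.add d2.hasFDerivAt), planeDiv,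
        planeDiv]
      simp only [add_apply, Complex.add_re, Complex.add_im]
      ring
    have e2 : Real.exp (2 * hypLog g z) = a ^ 2 / δ z ^ 2 * Real.exp (2 * w z) := by
      rw [hexp z hz, hg.exp_hypLog hz]
      field_simp
    rw [e1, hg.planeDiv_hypGrad hU hz, e2]
    have h1 := hcurv z hz
    -- Liouville's equation and the curvature bound give `Δw ≥ (a²/δ²)(e^{2w} - 1)`, and convexity
    -- of the exponential replaces `e^{2w} - 1` by `2w`.
    have h2 := Real.add_one_le_exp (2 * w z)
    have h3 : 0 ≤ a ^ 2 / δ z ^ 2 := by positivity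
    have h4 := mul_le_mul_of_nonneg_left h2 h3
    rw [neg_div] at h1
    linarith
  -- By injectivity this integral is the hyperbolic area of the image, which is finite because the
  -- image stays in the disc of radius `r < 1`.
  have hI : IntegrableOn (fun z => 4 * ‖deriv g z‖ ^ 2 / (1 - ‖g z‖ ^ 2) ^ 2) U := by
    have := (integrableOn_image_holomorphic hU hg.differentiableOn hg.injOn
      (fun y => 4 / (1 - ‖y‖ ^ 2) ^ 2)).mp ?_
    · refine this.congr_fun (fun z _ => ?_) hU.measurableSet
      ring
    · have hsub : g '' U ⊆ closedBall 0 r := by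
        rintro _ ⟨z, hz, rfl⟩
        simpa using hgr z hz
      refine IntegrableOn.mono_set ?_ hsub
      refine ContinuousOn.integrableOn_compact (isCompact_closedBall 0 r) ?_
      refine continuousOn_const.div (by fun_prop) fun y hy => ?_
      rw [mem_closedBall_zero_iff] at hy
      have : 0 < 1 - ‖y‖ ^ 2 := by nlinarith [norm_nonneg y]
      positivity
  have hle := nonpos_of_hasCutoffs hU hwd hVc hδ hpos hcut (pow_pos ha 2) hdivV
    (hI.div_const (a ^ 2)) (fun z _ => by positivity) (fun z hz => by
      have := hpos z hz
      rw [hexp z hz]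
      refine le_of_eq ?_
      field_simp)
  intro z hz
  have hd := hpos z hz
  have h1 : Real.exp (2 * w z) ≤ 1 := Real.exp_le_one_iff.mpr (by linarith [hle z hz])
  rw [hexp z hz, div_le_one (by positivity)] at h1
  rwa [le_div_iff₀ (by positivity)]

/-! ### Transplanted radial test functions and the spectral contradiction -/

theorem isOpenEmbedding_restrict {U : Set ℂ} (hU : IsOpen U) {g : ℂ → ℂ}
    (hg : DifferentiableOn ℂ g U) (hi : InjOn g U) (hd : ∀ z ∈ U, deriv g z ≠ 0) :
    Topology.IsOpenEmbedding (fun z : U => g z) := by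
  refine Topology.IsOpenEmbedding.of_continuous_injective_isOpenMap
    (hg.continuousOn.comp_continuous continuous_subtype_val fun z => z.2)
    (fun z z' h => Subtype.ext (hi z.2 z'.2 h)) ?_
  rw [isOpenMap_iff_nhds_le]
  intro z
  have h1 : HasStrictDerivAt g (deriv g z) z :=
    ((hg.analyticAt (hU.mem_nhds z.2)).contDiffAt (n := 1)).hasStrictDerivAt one_ne_zero
  have h2 := h1.map_nhds_eq (hd z z.2)
  rw [show (fun z : U => g z) = g ∘ Subtype.val from rfl, ← Filter.map_map,
    map_nhds_subtype_coe_eq_nhds z.2 (hU.mem_nhds z.2), h2]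

/-- An injective holomorphic map is an embedding onto an open set, so compact subsets of the image
pull back to compact sets. This gives transplanted radial functions compact support in `U`. -/
theorem isCompact_inter_preimage {U : Set ℂ} (hU : IsOpen U) {g : ℂ → ℂ}
    (hg : DifferentiableOn ℂ g U) (hi : InjOn g U) (hd : ∀ z ∈ U, deriv g z ≠ 0) {K : Set ℂ}
    (hK : IsCompact K) (hKg : K ⊆ g '' U) : IsCompact (U ∩ g ⁻¹' K) := by
  have h := isOpenEmbedding_restrict hU hg hi hd
  have h1 : IsCompact ((fun z : U => g z) ⁻¹' K) := by
    rw [h.isInducing.isCompact_preimage_iff]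
    · exact hK
    · intro y hy
      obtain ⟨z, hz, rfl⟩ := hKg hy
      exact ⟨⟨z, hz⟩, rfl⟩
  have h2 : U ∩ g ⁻¹' K = Subtype.val '' ((fun z : U => g z) ⁻¹' K) := by
    ext z
    simp [and_comm]
  rw [h2]
  exact h1.image continuous_subtype_val

/-- The function `(k(|g|²)₊)²` on `U`, extended by zero. -/
noncomputable def radialTest (U : Set ℂ) (g : ℂ → ℂ) (k : ℝ → ℝ) : ℂ → ℝ :=
  U.indicator fun z => max (k (‖g z‖ ^ 2)) 0 ^ 2

theorem radialTest_nonneg (U : Set ℂ) (g : ℂ → ℂ) (k : ℝ → ℝ) (z : ℂ) :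
    0 ≤ radialTest U g k z :=
  indicator_nonneg (fun _ _ => by positivity) z

theorem norm_smul_planeInner_comp (c : ℝ) (w d : ℂ) :
    ‖c • (2 • planeInner w ∘SL (d • (1 : ℂ →L[ℝ] ℂ)))‖ ≤ |c| * (2 * (‖w‖ * ‖d‖)) := by
  rw [norm_smul, Real.norm_eq_abs]
  refine mul_le_mul_of_nonneg_left ?_ (abs_nonneg c)
  rw [← Nat.cast_smul_eq_nsmul ℝ, norm_smul]
  refine mul_le_mul (by simp) ?_ (norm_nonneg _) (by norm_num)
  refine (ContinuousLinearMap.opNorm_comp_le _ _).trans ?_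
  rw [norm_planeInner, norm_smul]
  refine mul_le_mul_of_nonneg_left ?_ (norm_nonneg w)
  refine mul_le_of_le_one_right (norm_nonneg d) ?_
  exact ContinuousLinearMap.norm_id_le

/-- Cheeger's inequality for radial test functions transplanted by a conformal embedding. -/
theorem cheeger_radial {U : Set ℂ} (hU : IsOpen U) {Y : ℂ → ℂ} (hY : ContDiffOn ℝ 1 Y U)
    {δ : ℂ → ℝ} (hδ : ContinuousOn δ U) (hpos : ∀ z ∈ U, 0 < δ z) {h : ℝ} (hh : 0 < h)
    (hYn : ∀ z ∈ U, ‖Y z‖ ≤ 1 / δ z) (hdiv : ∀ z ∈ U, 2 * h / δ z ^ 2 ≤ planeDiv Y z)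
    {g : ℂ → ℂ} (hg : DifferentiableOn ℂ g U) (hi : InjOn g U) (hd : ∀ z ∈ U, deriv g z ≠ 0)
    {J : Set ℝ} (hJ : IsOpen J) (hgJ : ∀ z ∈ U, ‖g z‖ ^ 2 ∈ J) {k k' : ℝ → ℝ}
    (hk : ∀ x ∈ J, HasDerivAt k (k' x) x) (hk' : ContinuousOn k' J) {ρ : ℝ} (hρ : 0 ≤ ρ)
    (hρJ : Icc 0 (ρ ^ 2) ⊆ J) (hkρ : ∀ x ∈ J, ρ ^ 2 ≤ x → k x ≤ 0)
    (hρg : closedBall 0 ρ ⊆ g '' U) :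
    Integrable (fun z => radialTest U g k z * (1 / δ z ^ 2)) ∧
    4 * h ^ 2 * ∫ z, radialTest U g k z * (1 / δ z ^ 2) ≤
      16 * Real.pi * ∫ x in (0 : ℝ)..ρ ^ 2, x * k' x ^ 2 := by
  set φ := radialTest U g k with hφ
  have hK := isCompact_inter_preimage hU hg hi hd (isCompact_closedBall 0 ρ) hρg
  have hsupp : Function.support φ ⊆ U ∩ g ⁻¹' closedBall 0 ρ := by
    intro z hz
    have hzU : z ∈ U := by
      by_contra h0
      exact hz (indicator_of_notMem h0 _)
    refine ⟨hzU, ?_⟩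
    rw [mem_preimage, mem_closedBall_zero_iff]
    by_contra hlt
    push Not at hlt
    apply hz
    rw [hφ, radialTest, indicator_of_mem hzU, max_eq_right]
    · simp
    · exact hkρ _ (hgJ z hzU) (pow_le_pow_left₀ hρ hlt.le 2)
  have htsupp : tsupport φ ⊆ U ∩ g ⁻¹' closedBall 0 ρ := closure_minimal hsupp hK.isClosed
  have hφU : tsupport φ ⊆ U := htsupp.trans inter_subset_left
  have hφc : HasCompactSupport φ := hK.of_isClosed_subset isClosed_closure htsupp
  have hfd : ∀ z ∈ U, HasFDerivAt φ ((2 * max (k (‖g z‖ ^ 2)) 0 * k' (‖g z‖ ^ 2)) •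
      (2 • planeInner (g z) ∘SL (deriv g z • (1 : ℂ →L[ℝ] ℂ)))) z := by
    intro z hz
    have d1 : HasFDerivAt g (deriv g z • (1 : ℂ →L[ℝ] ℂ)) z :=
      (hg.differentiableAt (hU.mem_nhds hz)).hasDerivAt.complexToReal_fderiv
    have d2 := ((hasDerivAt_max_zero_sq (k (‖g z‖ ^ 2))).comp (‖g z‖ ^ 2)
      (hk _ (hgJ z hz))).comp_hasFDerivAt z d1.norm_sq
    refine d2.congr_of_eventuallyEq ?_
    filter_upwards [hU.mem_nhds hz] with y hy
    simp [hφ, radialTest, hy]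
  have hφ1 : ContDiff ℝ 1 φ := by
    refine contDiff_of_tsupport_subset hU ?_ hφU
    have hk1 : ContDiffOn ℝ 1 k J := by
      rw [show (1 : ℕ∞ω) = 0 + 1 by simp, contDiffOn_succ_iff_deriv_of_isOpen hJ]
      refine ⟨fun x hx => (hk x hx).differentiableAt.differentiableWithinAt, by simp, ?_⟩
      rw [contDiffOn_zero]
      exact hk'.congr fun x hx => (hk x hx).deriv
    have hg1 : ContDiffOn ℝ 1 g U := (hg.contDiffOn hU).restrict_scalars ℝ
    have := contDiff_max_zero_sq.comp_contDiffOn (hk1.comp (hg1.norm_sq ℝ) hgJ)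
    refine this.congr fun z hz => ?_
    simp [hφ, radialTest, hz]
  -- With `f = k(|g|²)`, the product `‖deriv g‖² F(g)` is `4|∇f|²` where `‖g‖ < ρ`. Its integral is
  -- therefore computed in the disc, which is the conformal invariance of the Dirichlet integral.
  set F : ℂ → ℝ := (ball 0 ρ).indicator fun y => 16 * (‖y‖ ^ 2 * k' (‖y‖ ^ 2) ^ 2) with hF
  have hF0 : ∀ y, 0 ≤ F y := fun y => indicator_nonneg (fun _ _ => by positivity) y
  set Q : ℂ → ℝ := U.indicator fun z => ‖deriv g z‖ ^ 2 * F (g z) with hQ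
  have hbU : ball 0 ρ ⊆ g '' U := ball_subset_closedBall.trans hρg
  have hFi : IntegrableOn F (g '' U) := by
    refine Integrable.integrableOn ?_
    rw [hF, integrable_indicator_iff measurableSet_ball]
    refine IntegrableOn.mono_set ?_ ball_subset_closedBall
    refine ContinuousOn.integrableOn_compact (isCompact_closedBall 0 ρ) ?_
    have : ContinuousOn (fun y : ℂ => k' (‖y‖ ^ 2)) (closedBall 0 ρ) := by
      refine hk'.comp (by fun_prop) fun y hy => hρJ ⟨by positivity, ?_⟩
      exact pow_le_pow_left₀ (norm_nonneg _) (by simpa using hy) 2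
    exact continuousOn_const.mul ((continuous_norm.pow 2).continuousOn.mul (this.pow 2))
  have hQi : Integrable Q := by
    rw [hQ, integrable_indicator_iff hU.measurableSet]
    exact (integrableOn_image_holomorphic hU hg hi F).mp hFi
  have hQint : ∫ z, Q z = 16 * Real.pi * ∫ x in (0 : ℝ)..ρ ^ 2, x * k' x ^ 2 := by
    rw [hQ, integral_indicator hU.measurableSet, ← integral_image_holomorphic hU hg hi F, hF,
      setIntegral_indicator measurableSet_ball, inter_eq_self_of_subset_right hbU]
    rw [integral_ball_radial (F := fun x => 16 * (x * k' x ^ 2)) hρ, 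
      intervalIntegral.integral_const_mul]
    · ring
    · exact continuousOn_const.mul (continuousOn_id.mul ((hk'.mono hρJ).pow 2))
  have hδ2 : ContinuousOn (fun z => 1 / δ z ^ 2) U :=
    continuousOn_const.div (hδ.pow 2) fun z hz => pow_ne_zero _ (hpos z hz).ne'
  refine ⟨integrable_mul_of_tsupport_subset hU hφ1.continuous hφc hφU hδ2, ?_⟩
  rw [← hQint]
  refine cheeger_inequality hU hY hδ hpos hh hYn hdiv hφ1 hφc hφU (radialTest_nonneg U g k)
    (fun z => indicator_nonneg (fun z _ => mul_nonneg (by positivity) (hF0 _)) z) hQi ?_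
  intro z hz
  rw [(hfd z hz).fderiv]
  have b1 :=
      norm_smul_planeInner_comp (2 * max (k (‖g z‖ ^ 2)) 0 * k' (‖g z‖ ^ 2)) (g z) (deriv g z)
  refine (pow_le_pow_left₀ (norm_nonneg _) b1 2).trans ?_
  have hφz : φ z = max (k (‖g z‖ ^ 2)) 0 ^ 2 := by simp [hφ, radialTest, hz]
  have hQz : Q z = ‖deriv g z‖ ^ 2 * F (g z) := by simp [hQ, hz]
  rw [hφz, hQz]
  by_cases hr : ‖g z‖ < ρ
  · have hFz : F (g z) = 16 * (‖g z‖ ^ 2 * k' (‖g z‖ ^ 2) ^ 2) := by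
      rw [hF, indicator_of_mem (by simpa using hr)]
    rw [hFz, mul_pow, sq_abs]
    exact le_of_eq (by ring)
  · have : max (k (‖g z‖ ^ 2)) 0 = 0 :=
      max_eq_right (hkρ _ (hgJ z hz) (pow_le_pow_left₀ hρ (not_lt.mp hr) 2))
    rw [this]
    simp

/-- The plane is parabolic: radial logarithmic cutoffs have Dirichlet integral of order `ε` while
staying at least `1/2` on the unit disc, against Cheeger's inequality. Neither curvature nor
completeness plays a role in this case. -/
theorem not_planar_field {Y : ℂ → ℂ} (hY : ContDiff ℝ 1 Y)
    {δ : ℂ → ℝ} (hδ : Continuous δ) (hpos : ∀ z, 0 < δ z) {h : ℝ} (hh : 0 < h)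
    (hYn : ∀ z, ‖Y z‖ ≤ 1 / δ z) (hdiv : ∀ z, 2 * h / δ z ^ 2 ≤ planeDiv Y z) : False := by
  have main : ∀ ε : ℝ, 0 < ε → ε ≤ 1 / 2 →
      h ^ 2 * ∫ z in closedBall (0 : ℂ) 1, 1 / δ z ^ 2 ≤ 16 * Real.pi * ε := by
    intro ε hε hε2
    -- The value of `x = |z|²` at which the cutoff `1 - ε log (1 + x)` reaches zero.
    set X := Real.exp (1 / ε) - 1 with hX
    have hX0 : 0 < X := by
      have := Real.add_one_le_exp (1 / ε)
      have : 0 < 1 / ε := by positivity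
      linarith
    have hsq : √X ^ 2 = X := Real.sq_sqrt hX0.le
    obtain ⟨i1, i2⟩ := cheeger_radial (U := univ) isOpen_univ hY.contDiffOn hδ.continuousOn
      (fun z _ => hpos z) hh (fun z _ => hYn z) (fun z _ => hdiv z) (g := fun z => z)
      differentiableOn_id (injOn_id _) (by simp) (J := Ioi (-1)) isOpen_Ioi
      (fun z _ => by rw [mem_Ioi]; have := sq_nonneg ‖z‖; linarith)
      (k := fun x => 1 - ε * Real.log (1 + x)) (k' := fun x => -(ε * (1 / (1 + x))))
      (fun x hx => by
        rw [mem_Ioi] at hx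
        exact ((((hasDerivAt_id x).const_add 1).log (by simp; linarith)).const_mul ε).const_sub 1)
      (by
        refine (continuousOn_const.mul (continuousOn_const.div (by fun_prop) fun x hx => ?_)).neg
        rw [mem_Ioi] at hx
        linarith)
      (ρ := √X) (Real.sqrt_nonneg _) (fun x hx => by rw [mem_Ioi]; linarith [hx.1])
      (fun x hx hxX => by
        rw [hsq] at hxX
        have h1 : 1 / ε ≤ Real.log (1 + x) := by
          rw [Real.le_log_iff_exp_le (by linarith)]; linarith
        rw [div_le_iff₀ hε] at h1
        linarith) (by simp)
    rw [hsq] at i2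
    have hup : ∫ x in (0 : ℝ)..X, x * (-(ε * (1 / (1 + x)))) ^ 2 ≤ ε := by
      calc ∫ x in (0 : ℝ)..X, x * (-(ε * (1 / (1 + x)))) ^ 2
          ≤ ∫ x in (0 : ℝ)..X, ε ^ 2 * (1 / (1 + x)) := by
            refine intervalIntegral.integral_mono_on hX0.le ?_ ?_ fun x hx => ?_
            · refine ContinuousOn.intervalIntegrable ?_
              rw [uIcc_of_le hX0.le]
              refine continuousOn_id.mul ((continuousOn_const.mul
                (continuousOn_const.div (by fun_prop) fun x hx => ?_)).neg.pow 2)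
              linarith [hx.1]
            · refine ContinuousOn.intervalIntegrable ?_
              rw [uIcc_of_le hX0.le]
              refine continuousOn_const.mul
                (continuousOn_const.div (by fun_prop) fun x hx => ?_)
              linarith [hx.1]
            · have hx0 : 0 < 1 + x := by linarith [hx.1]
              rw [neg_sq, mul_pow, ← mul_assoc, mul_comm x, mul_assoc]
              refine mul_le_mul_of_nonneg_left ?_ (by positivity)
              have h2 : x * (1 / (1 + x)) ≤ 1 := by
                rw [mul_one_div, div_le_one hx0]; linarith
              calc x * (1 / (1 + x)) ^ 2 = x * (1 / (1 + x)) * (1 / (1 + x)) := by ring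
                _ ≤ 1 * (1 / (1 + x)) := mul_le_mul_of_nonneg_right h2 (by positivity)
                _ = _ := one_mul _
        _ = ε := by
            rw [intervalIntegral.integral_const_mul]
            have : ∫ x in (0 : ℝ)..X, 1 / (1 + x) = 1 / ε := by
              rw [intervalIntegral.integral_comp_add_left (fun x => 1 / x) 1, integral_one_div]
              · rw [hX]; simp
              · rw [uIcc_of_le (by linarith)]
                intro h0
                linarith [h0.1]
            rw [this]
            field_simp
    have hlow : 1 / 4 * ∫ z in closedBall (0 : ℂ) 1, 1 / δ z ^ 2 ≤
        ∫ z, radialTest univ (fun z => z) (fun x => 1 - ε * Real.log (1 + x)) z *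
          (1 / δ z ^ 2) := by
      rw [← integral_const_mul]
      have hc : Continuous fun z => 1 / δ z ^ 2 :=
        continuous_const.div (hδ.pow 2) fun z => pow_ne_zero _ (hpos z).ne'
      refine (setIntegral_mono_on
        ((hc.continuousOn.integrableOn_compact (isCompact_closedBall 0 1)).const_mul _)
        i1.integrableOn measurableSet_closedBall fun z hz => ?_).trans
        (setIntegral_le_integral i1 (Filter.Eventually.of_forall fun z =>
          mul_nonneg (radialTest_nonneg _ _ _ z) (by positivity)))
      refine mul_le_mul_of_nonneg_right ?_ (by positivity)
      rw [radialTest, indicator_of_mem (mem_univ z)]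
      have hz1 : ‖z‖ ≤ 1 := by simpa using hz
      have h1 : Real.log (1 + ‖z‖ ^ 2) ≤ 1 := by
        have := Real.log_le_sub_one_of_pos (show 0 < 1 + ‖z‖ ^ 2 by positivity)
        nlinarith [norm_nonneg z]
      have h2 : 1 / 2 ≤ 1 - ε * Real.log (1 + ‖z‖ ^ 2) := by nlinarith
      have h3 := h2.trans (le_max_left (1 - ε * Real.log (1 + ‖z‖ ^ 2)) 0)
      nlinarith
    have h1 := mul_le_mul_of_nonneg_left hlow (show 0 ≤ 4 * h ^ 2 by positivity)
    have h2 := mul_le_mul_of_nonneg_left hup (show 0 ≤ 16 * Real.pi by positivity)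
    linarith
  set m := ∫ z in closedBall (0 : ℂ) 1, 1 / δ z ^ 2 with hm
  have hm0 : 0 < m := by
    have hc : Continuous fun z => 1 / δ z ^ 2 :=
      continuous_const.div (hδ.pow 2) fun z => pow_ne_zero _ (hpos z).ne'
    rw [hm, setIntegral_pos_iff_support_of_nonneg_ae]
    · have : Function.support (fun z => 1 / δ z ^ 2) = univ := by
        ext z
        have := hpos z
        simp [this.ne']
      rw [this, univ_inter]
      exact Metric.measure_closedBall_pos volume 0 one_pos
    · exact Filter.Eventually.of_forall fun z => by simp only [Pi.zero_apply]; positivity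
    · exact hc.continuousOn.integrableOn_compact (isCompact_closedBall 0 1)
  have hpi := Real.pi_pos
  have h1 := main (min (1 / 2) (h ^ 2 * m / (32 * Real.pi))) (by positivity) (min_le_left _ _)
  have h2 := mul_le_mul_of_nonneg_left (min_le_right (1 / 2) (h ^ 2 * m / (32 * Real.pi)))
    (show 0 ≤ 16 * Real.pi by positivity)
  have h3 : 16 * Real.pi * (h ^ 2 * m / (32 * Real.pi)) = h ^ 2 * m / 2 := by
    field_simp; ring
  have : 0 < h ^ 2 * m := by positivity
  linarith

theorem integral_one_sub_rpow {b p : ℝ} (hb : 0 < b) (hb1 : b < 1) (hp : p ≠ -1) :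
    ∫ x in (0 : ℝ)..1 - b, (1 - x) ^ p = (1 - b ^ (p + 1)) / (p + 1) := by
  rw [intervalIntegral.integral_comp_sub_left (fun x => x ^ p) 1, sub_sub_cancel, sub_zero,
    integral_rpow (Or.inr ⟨hp, ?_⟩), Real.one_rpow]
  rw [uIcc_of_le hb1.le]
  exact fun h => absurd h.1 (not_le.mpr hb)

/-- The Cheeger inequality for the test function `(1 - |g|²)^s - b^s` in terms of `b`. -/
theorem radial_estimate {U : Set ℂ} (hU : IsOpen U) (h0 : (0 : ℂ) ∈ U)
    (hs : StarConvex ℝ 0 U) (hne : U ≠ univ) {Y : ℂ → ℂ} (hY : ContDiffOn ℝ 1 Y U)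
    {δ : ℂ → ℝ} (hδ : ContinuousOn δ U) (hpos : ∀ z ∈ U, 0 < δ z) (hcut : HasCutoffs U δ)
    {D : ℂ → ℂ} (hD : ContDiffOn ℝ 1 D U)
    (hδD : ∀ z ∈ U, HasFDerivAt (fun z => Real.log (δ z)) (planeInner (D z)) z)
    {a : ℝ} (ha : 0 < a) (hcurv : ∀ z ∈ U, -a ^ 2 / δ z ^ 2 ≤ planeDiv D z)
    {h : ℝ} (hh : 0 < h)
    (hYn : ∀ z ∈ U, ‖Y z‖ ≤ 1 / δ z) (hdiv : ∀ z ∈ U, 2 * h / δ z ^ 2 ≤ planeDiv Y z)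
    {s : ℝ} (hs1 : 1 / 2 < s) (hs2 : s < 1) {b : ℝ} (hb : 0 < b) (hb1 : b < 1) :
    h ^ 2 / a ^ 2 * ((1 - b ^ (2 * s - 1)) / (2 * s - 1) - 2 * b ^ (2 * s - 1) / (1 - s)) ≤
      s ^ 2 / (2 * s - 1) := by
  set ρ := √(1 - b) with hρ
  have hρ0 : 0 ≤ ρ := Real.sqrt_nonneg _
  have hρ2 : ρ ^ 2 = 1 - b := Real.sq_sqrt (by linarith)
  have hρ1 : ρ < 1 := by nlinarith
  -- The image of `g₀` contains the disc of radius `r`, so that of `g = r g₀` contains the disc of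
  -- radius `r² = (1 + ρ)/2 > ρ`. At the same time it stays in the closed disc of radius `r < 1`, as
  -- the Schwarz-Yau lemma requires.
  set r := √((1 + ρ) / 2) with hr
  have hr2 : r ^ 2 = (1 + ρ) / 2 := Real.sq_sqrt (by linarith)
  have hr0 : 0 < r := Real.sqrt_pos.mpr (by linarith)
  have hr1 : r < 1 := by nlinarith
  obtain ⟨g₀, hg₀, hball⟩ := exists_isDiscEmbedding_ball_subset hU h0 hs hne hr1
  have hrc : (r : ℂ) ≠ 0 := by exact_mod_cast hr0.ne'
  set g : ℂ → ℂ := fun z => r * g₀ z with hgdef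
  have hgd : ∀ z ∈ U, HasDerivAt g (r * deriv g₀ z) z := fun z hz =>
    (hg₀.differentiableOn.differentiableAt (hU.mem_nhds hz)).hasDerivAt.const_mul _
  have hgn : ∀ z, ‖g z‖ = r * ‖g₀ z‖ := fun z => by
    rw [hgdef, norm_mul, Complex.norm_real, Real.norm_of_nonneg hr0.le]
  have hgr : ∀ z ∈ U, ‖g z‖ ≤ r := fun z hz => by
    rw [hgn]; nlinarith [hg₀.norm_lt_one z hz]
  have hg : IsDiscEmbedding U g := by
    refine ⟨fun z hz => (hgd z hz).differentiableAt.differentiableWithinAt, ?_, ?_,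
      fun z hz => (hgr z hz).trans_lt hr1⟩
    · intro z hz z' hz' hzz
      exact hg₀.injOn hz hz' (mul_left_cancel₀ hrc hzz)
    · intro z hz
      rw [(hgd z hz).deriv]
      exact mul_ne_zero hrc (hg₀.deriv_ne_zero z hz)
  have hρg : closedBall 0 ρ ⊆ g '' U := by
    intro y hy
    rw [mem_closedBall_zero_iff] at hy
    have hy' : y / r ∈ ball (0 : ℂ) r := by
      rw [mem_ball_zero_iff, norm_div, Complex.norm_real, Real.norm_of_nonneg hr0.le,
        div_lt_iff₀ hr0]
      nlinarith
    obtain ⟨z, hz, hzy⟩ := hball hy'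
    refine ⟨z, hz, ?_⟩
    rw [hgdef]
    simp only
    rw [hzy, mul_div_cancel₀ _ hrc]
  have hsy := hg.schwarz_yau hU hr1 hgr hδ hpos hcut hD hδD ha hcurv
  -- In the hyperbolic disc `(1 - |w|²)^s` decays like `e^{-sd}` in the distance `d` to the centre,
  -- while area grows like `e^d`. Thus `s > 1/2` is exactly square integrability. Subtracting `b ^
  -- s` makes the function vanish at `|w|² = 1 - b = ρ²`.
  set k : ℝ → ℝ := fun x => (1 - x) ^ s - b ^ s with hk
  set k' : ℝ → ℝ := fun x => -(s * (1 - x) ^ (s - 1)) with hk'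
  have hcontp : ∀ p : ℝ, ContinuousOn (fun x : ℝ => (1 - x) ^ p) (Iio 1) := fun p =>
    ContinuousOn.rpow_const (by fun_prop) fun x hx => Or.inl (by
      rw [mem_Iio] at hx; linarith)
  have hIcc : Icc 0 (ρ ^ 2) ⊆ Iio 1 := fun x hx => by
    rw [mem_Iio]; rw [hρ2] at hx; linarith [hx.2]
  obtain ⟨i1, i2⟩ := cheeger_radial hU hY hδ hpos hh hYn hdiv hg.differentiableOn hg.injOn
    hg.deriv_ne_zero (J := Iio 1) isOpen_Iio (fun z hz => by
      rw [mem_Iio]; linarith [hg.one_sub_pos hz]) (k := k) (k' := k')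
    (fun x hx => by
      rw [mem_Iio] at hx
      have h1 := (((hasDerivAt_id x).const_sub 1).rpow_const (p := s)
        (Or.inl (by simp; linarith))).sub_const (b ^ s)
      refine h1.congr_deriv ?_
      simp only [id, hk']
      ring)
    ((continuousOn_const.mul (hcontp _)).neg) hρ0 hIcc
    (fun x hx hρx => by
      rw [mem_Iio] at hx
      rw [hρ2] at hρx
      have := Real.rpow_le_rpow (by linarith) (show 1 - x ≤ b by linarith) (by linarith : 0 ≤ s)
      simp only [hk]
      linarith) hρg
  have hIcc' : uIcc 0 (1 - b) ⊆ Iio 1 := by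
    rw [uIcc_of_le (by linarith), ← hρ2]; exact hIcc
  have hint : ∀ p : ℝ, IntervalIntegrable (fun x : ℝ => (1 - x) ^ p) volume 0 (1 - b) := fun p =>
    ((hcontp p).mono hIcc').intervalIntegrable
  have hp1 : ∫ x in (0 : ℝ)..1 - b, (1 - x) ^ (2 * s - 2) =
      (1 - b ^ (2 * s - 1)) / (2 * s - 1) := by
    rw [integral_one_sub_rpow hb hb1 (by linarith)]; ring_nf
  have hbt : 0 < b ^ (2 * s - 1) := Real.rpow_pos_of_pos hb _
  have hup : ∫ x in (0 : ℝ)..ρ ^ 2, x * k' x ^ 2 ≤ s ^ 2 / (2 * s - 1) := by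
    rw [hρ2]
    calc ∫ x in (0 : ℝ)..1 - b, x * k' x ^ 2
        ≤ ∫ x in (0 : ℝ)..1 - b, s ^ 2 * (1 - x) ^ (2 * s - 2) := by
          refine intervalIntegral.integral_mono_on (by linarith) ?_ ((hint _).const_mul _)
            fun x hx => ?_
          · exact (continuousOn_id.mul (((continuousOn_const.mul
              ((hcontp (s - 1)).mono hIcc')).neg).pow 2)).intervalIntegrable
          · have hx1 : 0 < 1 - x := by linarith [hx.2]
            have e1 : k' x ^ 2 = s ^ 2 * (1 - x) ^ (2 * s - 2) := by
              rw [hk', neg_sq, mul_pow, ← Real.rpow_natCast ((1 - x) ^ (s - 1)),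
                ← Real.rpow_mul hx1.le]
              congr 2
              push_cast; ring
            rw [e1]
            have : 0 ≤ s ^ 2 * (1 - x) ^ (2 * s - 2) := by positivity
            nlinarith [hx.2]
      _ = s ^ 2 * ((1 - b ^ (2 * s - 1)) / (2 * s - 1)) := by
          rw [intervalIntegral.integral_const_mul, hp1]
      _ ≤ s ^ 2 / (2 * s - 1) := by
          rw [← mul_div_assoc]
          refine div_le_div_of_nonneg_right ?_ (by linarith)
          nlinarith [sq_nonneg s]
  -- The square of `k` is bounded below by dropping `b ^ (2 * s)`; what remains integrates
  -- explicitly.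
  have hlow1 : (1 - b ^ (2 * s - 1)) / (2 * s - 1) - 2 * b ^ (2 * s - 1) / (1 - s) ≤
      ∫ x in (0 : ℝ)..ρ ^ 2, k x ^ 2 / (1 - x) ^ 2 := by
    rw [hρ2]
    have e0 : ∫ x in (0 : ℝ)..1 - b, ((1 - x) ^ (2 * s - 2) - 2 * b ^ s * (1 - x) ^ (s - 2)) =
        (1 - b ^ (2 * s - 1)) / (2 * s - 1) - 2 * b ^ s * ((1 - b ^ (s - 1)) / (s - 1)) := by
      rw [intervalIntegral.integral_sub (hint _) ((hint _).const_mul _),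
        intervalIntegral.integral_const_mul, hp1, integral_one_sub_rpow hb hb1 (by linarith)]
      ring_nf
    have e1 : 2 * b ^ s * ((1 - b ^ (s - 1)) / (s - 1)) ≤ 2 * b ^ (2 * s - 1) / (1 - s) := by
      have : b ^ (2 * s - 1) = b ^ s * b ^ (s - 1) := by rw [← Real.rpow_add hb]; ring_nf
      rw [this, show (1 - b ^ (s - 1)) / (s - 1) = (b ^ (s - 1) - 1) / (1 - s) by
        rw [← neg_div_neg_eq]; ring_nf, ← mul_div_assoc]
      refine div_le_div_of_nonneg_right ?_ (by linarith)
      have : 0 < b ^ s := Real.rpow_pos_of_pos hb _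
      nlinarith
    refine le_trans (by linarith) (e0.symm.le.trans ?_)
    refine intervalIntegral.integral_mono_on (by linarith)
      ((hint _).sub ((hint _).const_mul _)) ?_ fun x hx => ?_
    · refine ContinuousOn.intervalIntegrable ?_
      refine ((((hcontp s).mono hIcc').sub continuousOn_const).pow 2).div (by fun_prop) ?_
      intro x hx
      have := hIcc' hx
      rw [mem_Iio] at this
      have : 1 - x ≠ 0 := by linarith
      positivity
    · have hx1 : 0 < 1 - x := by linarith [hx.2]
      have f1 : (1 - x) ^ (2 * s - 2) = ((1 - x) ^ s) ^ 2 / (1 - x) ^ 2 := by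
        rw [Real.rpow_sub hx1, mul_comm 2 s, Real.rpow_mul hx1.le]
        norm_num
      have f2 : (1 - x) ^ (s - 2) = (1 - x) ^ s / (1 - x) ^ 2 := by
        rw [Real.rpow_sub hx1]
        norm_num
      rw [f1, f2, hk, mul_div_assoc', ← sub_div]
      refine div_le_div_of_nonneg_right ?_ (by positivity)
      nlinarith [sq_nonneg (b ^ s)]
  set F : ℂ → ℝ := (ball 0 ρ).indicator fun y => k (‖y‖ ^ 2) ^ 2 / (1 - ‖y‖ ^ 2) ^ 2 with hF
  have hFc : ContinuousOn (fun x => k x ^ 2 / (1 - x) ^ 2) (Icc 0 (ρ ^ 2)) := by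
    refine ((((hcontp s).mono hIcc).sub continuousOn_const).pow 2).div (by fun_prop) ?_
    intro x hx
    have := hIcc hx
    rw [mem_Iio] at this
    have : 1 - x ≠ 0 := by linarith
    positivity
  have hbU : ball 0 ρ ⊆ g '' U := ball_subset_closedBall.trans hρg
  have hFi : IntegrableOn F (g '' U) := by
    refine Integrable.integrableOn ?_
    rw [hF, integrable_indicator_iff measurableSet_ball]
    refine IntegrableOn.mono_set ?_ ball_subset_closedBall
    refine ContinuousOn.integrableOn_compact (isCompact_closedBall 0 ρ) ?_
    refine hFc.comp (f := fun y : ℂ => ‖y‖ ^ 2) (by fun_prop) fun y hy => ⟨by positivity, ?_⟩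
    exact pow_le_pow_left₀ (norm_nonneg _) (by simpa using hy) 2
  have hlow2 : 4 / a ^ 2 * (Real.pi * ∫ x in (0 : ℝ)..ρ ^ 2, k x ^ 2 / (1 - x) ^ 2) ≤
      ∫ z, radialTest U g k z * (1 / δ z ^ 2) := by
    have hFint : ∫ y in g '' U, F y = Real.pi * ∫ x in (0 : ℝ)..ρ ^ 2, k x ^ 2 / (1 - x) ^ 2 := by
      rw [hF, setIntegral_indicator measurableSet_ball, inter_eq_self_of_subset_right hbU,
        integral_ball_radial (F := fun x => k x ^ 2 / (1 - x) ^ 2) hρ0 hFc]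
    rw [← hFint, integral_image_holomorphic hU hg.differentiableOn hg.injOn,
      ← integral_const_mul]
    refine (setIntegral_mono_on (((integrableOn_image_holomorphic hU hg.differentiableOn
      hg.injOn F).mp hFi).const_mul _) i1.integrableOn hU.measurableSet fun z hz => ?_).trans
      (setIntegral_le_integral i1 (Filter.Eventually.of_forall fun z =>
        mul_nonneg (radialTest_nonneg _ _ _ z) (by positivity)))
    have hφz : radialTest U g k z = max (k (‖g z‖ ^ 2)) 0 ^ 2 := by simp [radialTest, hz]
    by_cases hzρ : ‖g z‖ < ρ
    · have hFz : F (g z) = k (‖g z‖ ^ 2) ^ 2 / (1 - ‖g z‖ ^ 2) ^ 2 := by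
        rw [hF, indicator_of_mem (by simpa using hzρ)]
      have hk0 : 0 ≤ k (‖g z‖ ^ 2) := by
        have : b ≤ 1 - ‖g z‖ ^ 2 := by nlinarith [norm_nonneg (g z)]
        have := Real.rpow_le_rpow hb.le this (by linarith : 0 ≤ s)
        simp only [hk]
        linarith
      rw [hφz, hFz, max_eq_left hk0]
      have hd := hpos z hz
      have h1 := mul_le_mul_of_nonneg_left (hsy z hz)
        (show 0 ≤ k (‖g z‖ ^ 2) ^ 2 / a ^ 2 by positivity)
      refine le_trans (le_of_eq ?_) (h1.trans (le_of_eq ?_))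
      · ring
      · field_simp
    · have hFz : F (g z) = 0 := by
        rw [hF, indicator_of_notMem (by simpa using hzρ)]
      rw [hFz, mul_zero, mul_zero]
      exact mul_nonneg (radialTest_nonneg _ _ _ z) (by positivity)
  have hpi := Real.pi_pos
  have j1 := mul_le_mul_of_nonneg_left hlow2 (show 0 ≤ 4 * h ^ 2 by positivity)
  have j2 := mul_le_mul_of_nonneg_left hup (show 0 ≤ 16 * Real.pi by positivity)
  have j3 := mul_le_mul_of_nonneg_left hlow1 (show 0 ≤ 16 * Real.pi * (h ^ 2 / a ^ 2) by positivity)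
  have j4 : 16 * Real.pi * (h ^ 2 / a ^ 2 * ((1 - b ^ (2 * s - 1)) / (2 * s - 1) -
      2 * b ^ (2 * s - 1) / (1 - s))) ≤ 16 * Real.pi * (s ^ 2 / (2 * s - 1)) := by
    refine le_trans (le_of_eq (by ring)) (j3.trans (le_trans (le_of_eq (by ring))
      (j1.trans (i2.trans j2))))
  exact le_of_mul_le_mul_left j4 (by positivity)

/-- On a star-shaped planar domain with a conformal metric of curvature at least `-a²` that has
cutoff functions, no vector field of norm at most one has divergence at least `2h > a`. -/
theorem not_field_of_curvature_bound {U : Set ℂ} (hU : IsOpen U) (h0 : (0 : ℂ) ∈ U)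
    (hs : StarConvex ℝ 0 U) {Y : ℂ → ℂ} (hY : ContDiffOn ℝ 1 Y U)
    {δ : ℂ → ℝ} (hδ : ContinuousOn δ U) (hpos : ∀ z ∈ U, 0 < δ z) (hcut : HasCutoffs U δ)
    {D : ℂ → ℂ} (hD : ContDiffOn ℝ 1 D U)
    (hδD : ∀ z ∈ U, HasFDerivAt (fun z => Real.log (δ z)) (planeInner (D z)) z)
    {a : ℝ} (ha : 0 < a) (hcurv : ∀ z ∈ U, -a ^ 2 / δ z ^ 2 ≤ planeDiv D z)
    {h : ℝ} (hh : a < 2 * h)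
    (hYn : ∀ z ∈ U, ‖Y z‖ ≤ 1 / δ z) (hdiv : ∀ z ∈ U, 2 * h / δ z ^ 2 ≤ planeDiv Y z) :
    False := by
  have hh0 : 0 < h := by linarith
  by_cases hne : U = univ
  · subst hne
    exact not_planar_field (contDiffOn_univ.mp hY) (continuousOn_univ.mp hδ)
      (fun z => hpos z (mem_univ z)) hh0 (fun z => hYn z (mem_univ z))
      fun z => hdiv z (mem_univ z)
  have hκ : 1 / 2 < h / a := by rw [lt_div_iff₀ ha]; linarith
  -- The gap between `1/2` and `h/a` leaves room for an exponent `s < h/a`. As `b → 0` the radial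
  -- estimate tends to `(h/a)² ≤ s²`, since the powers `b ^ (2 * s - 1)` have positive exponent.
  obtain ⟨s, hs1, hs2⟩ := exists_between (lt_min hκ (by norm_num : (1 / 2 : ℝ) < 1))
  have hsκ := hs2.trans_le (min_le_left _ _)
  have hs1' := hs2.trans_le (min_le_right _ _)
  have hlim : Filter.Tendsto (fun b : ℝ => h ^ 2 / a ^ 2 * ((1 - b ^ (2 * s - 1)) / (2 * s - 1) -
      2 * b ^ (2 * s - 1) / (1 - s))) (nhdsWithin 0 (Ioi 0))
      (nhds (h ^ 2 / a ^ 2 * ((1 - 0) / (2 * s - 1) - 2 * 0 / (1 - s)))) := by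
    have h1 : Filter.Tendsto (fun b : ℝ => b ^ (2 * s - 1)) (nhdsWithin 0 (Ioi 0)) (nhds 0) := by
      have := (Real.continuous_rpow_const (show 0 ≤ 2 * s - 1 by linarith)).tendsto 0
      rw [Real.zero_rpow (by linarith)] at this
      exact this.mono_left nhdsWithin_le_nhds
    exact ((((h1.const_sub 1).div_const _).sub ((h1.const_mul 2).div_const _)).const_mul _)
  have hle := le_of_tendsto hlim (b := s ^ 2 / (2 * s - 1)) (by
    filter_upwards [Ioo_mem_nhdsGT (show (0 : ℝ) < 1 by norm_num)] with b hb
    exact radial_estimate hU h0 hs hne hY hδ hpos hcut hD hδD ha hcurv hh0 hYn hdiv hs1 hs1'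
      hb.1 hb.2)
  rw [mul_zero, zero_div, sub_zero, sub_zero, mul_one_div,
    div_le_div_iff_of_pos_right (by linarith), ← div_pow] at hle
  have := abs_le_of_sq_le_sq' hle (by linarith)
  linarith [this.2]

/-! ### Cutoff functions from a Lipschitz exhaustion -/

theorem exists_uniform_half_le {U : Set ℂ} (hU : IsOpen U) {δ : ℂ → ℝ} (hδ : ContinuousOn δ U)
    (hpos : ∀ z ∈ U, 0 < δ z) {K : Set ℂ} (hK : IsCompact K) (hKU : K ⊆ U) :
    ∃ r > 0, ∀ z ∈ K, ∀ y ∈ ball z r, y ∈ U ∧ δ z / 2 ≤ δ y := by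
  obtain ⟨r₁, hr₁, hr₁U⟩ := hK.exists_cthickening_subset_open hU hKU
  have hK1 : IsCompact (cthickening r₁ K) := hK.cthickening
  have huc := hK1.uniformContinuousOn_of_continuous (hδ.mono hr₁U)
  rcases K.eq_empty_or_nonempty with rfl | hne
  · exact ⟨1, one_pos, by simp⟩
  obtain ⟨z₁, hz₁, hmin⟩ := hK.exists_isMinOn hne (hδ.mono hKU)
  have hm := hpos z₁ (hKU hz₁)
  obtain ⟨r₂, hr₂, h2⟩ := Metric.uniformContinuousOn_iff.mp huc (δ z₁ / 2) (by positivity)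
  refine ⟨min r₁ r₂, lt_min hr₁ hr₂, fun z hz y hy => ?_⟩
  rw [mem_ball] at hy
  have hy1 : y ∈ cthickening r₁ K :=
    mem_cthickening_of_dist_le y z r₁ K hz (hy.le.trans (min_le_left _ _))
  refine ⟨hr₁U hy1, ?_⟩
  have h3 := h2 y hy1 z (self_subset_cthickening K hz) (hy.trans_le (min_le_right _ _))
  rw [Real.dist_eq, abs_lt] at h3
  have h4 : δ z₁ ≤ δ z := hmin hz
  linarith [h3.1]

theorem clamp_sub_le (x y : ℝ) : |max 0 (min 1 x) - max 0 (min 1 y)| ≤ |x - y| := by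
  grind

open scoped Convolution in
/-- An exhaustion function that is Lipschitz for the conformal metric gives cutoff functions. -/
theorem hasCutoffs_of_exhaustion {U : Set ℂ} (hU : IsOpen U) {δ : ℂ → ℝ} (hδ : ContinuousOn δ U)
    (hpos : ∀ z ∈ U, 0 < δ z) {ρ : ℂ → ℝ}
    (hρ : ∀ V ⊆ U, Convex ℝ V → ∀ m : ℝ, 0 < m → (∀ z ∈ V, m ≤ δ z) →
      ∀ y ∈ V, ∀ z ∈ V, |ρ y - ρ z| ≤ ‖y - z‖ / m)
    (hprop : ∀ R : ℝ, ∃ K ⊆ U, IsCompact K ∧ ∀ z ∈ U, ρ z ≤ R → z ∈ K) :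
    HasCutoffs U δ := by
  intro K hKU hK ε hε
  have hρc : ContinuousOn ρ U := by
    intro z hz
    obtain ⟨r, hr, h1⟩ := exists_uniform_half_le hU hδ hpos (isCompact_singleton (x := z))
      (singleton_subset_iff.mpr hz)
    have hd := hpos z hz
    refine ContinuousAt.continuousWithinAt ?_
    refine continuousAt_of_locally_lipschitz hr (1 / (δ z / 2)) fun y hy => ?_
    have := hρ (ball z r) (fun y hy => (h1 z rfl y hy).1) (convex_ball z r) (δ z / 2)
      (by positivity) (fun y hy => (h1 z rfl y hy).2) y hy z (mem_ball_self hr)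
    rw [Real.dist_eq, dist_eq_norm]
    exact this.trans (le_of_eq (by ring))
  obtain ⟨R, hR⟩ : ∃ R, ∀ z ∈ K, ρ z < R := by
    obtain ⟨M, hM⟩ := (hK.image_of_continuousOn (hρc.mono hKU)).bddAbove
    exact ⟨M + 1, fun z hz => by linarith [hM (mem_image_of_mem ρ hz)]⟩
  -- Near `z` only `δ ≥ δ z / 2` is known, so a truncation of slope `ε / 2` has Euclidean Lipschitz
  -- constant `ε / δ z` there: the two halves cancel.
  set e := ε / 2 with he
  have he0 : 0 < e := by positivity
  obtain ⟨K₂, hK₂U, hK₂, hK₂ρ⟩ := hprop (R + 1 / e)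
  -- A Lipschitz cutoff equal to `1` where `ρ < R` and to `0` where `ρ ≥ R + 1/e`. It is mollified
  -- below to become `C¹`.
  set ζ₀ : ℂ → ℝ := U.indicator fun z => max 0 (min 1 (1 - e * (ρ z - R))) with hζ₀
  have hζU : ∀ z ∈ U, ζ₀ z = max 0 (min 1 (1 - e * (ρ z - R))) := fun z hz =>
    indicator_of_mem hz _
  have hz0 : ∀ z, z ∉ K₂ → ζ₀ z = 0 := by
    intro z hz
    by_cases hzU : z ∈ U
    · rw [hζU z hzU]
      have h1 : R + 1 / e < ρ z := by
        by_contra h1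
        exact hz (hK₂ρ z hzU (not_lt.mp h1))
      have h2 : 1 ≤ e * (ρ z - R) := by
        have : e * (1 / e) ≤ e * (ρ z - R) := mul_le_mul_of_nonneg_left (by linarith) he0.le
        rwa [mul_one_div_cancel he0.ne'] at this
      exact max_eq_left ((min_le_right _ _).trans (by linarith))
    · exact indicator_of_notMem hzU _
  have hζ1 : ∀ z ∈ U, ρ z < R → ζ₀ z = 1 := by
    intro z hz hzR
    rw [hζU z hz, min_eq_left (by nlinarith), max_eq_right zero_le_one]
  have hts : tsupport ζ₀ ⊆ K₂ := closure_minimal (fun z hz => by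
    by_contra h; exact hz (hz0 z h)) hK₂.isClosed
  have hζc : Continuous ζ₀ := by
    refine ContinuousOn.continuous_of_tsupport_subset (s := U) ?_ hU (hts.trans hK₂U)
    refine ContinuousOn.congr ?_ hζU
    exact continuousOn_const.sup (continuousOn_const.inf
      (continuousOn_const.sub (continuousOn_const.mul (hρc.sub continuousOn_const))))
  obtain ⟨r₁, hr₁, hr₁U⟩ := hK₂.exists_cthickening_subset_open hU hK₂U
  set K₃ := cthickening r₁ K₂ with hK₃def
  have hK₃ : IsCompact K₃ := hK₂.cthickening
  obtain ⟨r₂, hr₂, h2⟩ := exists_uniform_half_le hU hδ hpos hK₃ hr₁U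
  have hO : IsOpen {z | z ∈ U ∧ ρ z < R} := hρc.isOpen_inter_preimage hU isOpen_Iio
  obtain ⟨r₃, hr₃, hr₃O⟩ := hK.exists_cthickening_subset_open hO fun z hz => ⟨hKU hz, hR z hz⟩
  -- The mollification radius is below `r₁` to keep the support in `K₃`, below `r₂ / 2` so that both
  -- shifted points stay where `δ` is comparable to `δ z`, and below `r₃` to leave the value `1` on
  -- `K` unchanged.
  obtain ⟨r, hr, hrm⟩ : ∃ r > 0, r < min r₁ (min (r₂ / 2) r₃) :=
    exists_between (lt_min hr₁ (lt_min (by positivity) hr₃))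
  have hrr₁ : r < r₁ := hrm.trans_le (min_le_left _ _)
  have hrr₂ : r < r₂ / 2 := hrm.trans_le ((min_le_right _ _).trans (min_le_left _ _))
  have hrr₃ : r < r₃ := hrm.trans_le ((min_le_right _ _).trans (min_le_right _ _))
  let φ : ContDiffBump (0 : ℂ) := ⟨r / 2, r, by positivity, by linarith⟩
  set ζ : ℂ → ℝ := φ.normed volume ⋆[ContinuousLinearMap.lsmul ℝ ℝ, volume] ζ₀ with hζ
  have hζ3 : ∀ z, z ∉ K₃ → ζ z = 0 := by
    intro z hz
    have hb : ∀ y ∈ ball z r, ζ₀ y = 0 := by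
      intro y hy
      refine hz0 y fun hy2 => hz ?_
      exact mem_cthickening_of_dist_le z y r₁ K₂ hy2 (by
        rw [dist_comm]; exact (mem_ball.mp hy).le.trans hrr₁.le)
    have := ContDiffBump.normed_convolution_eq_right (φ := φ) (μ := volume) (g := ζ₀) (x₀ := z)
      fun y hy => by rw [hb y hy, hb z (mem_ball_self hr)]
    rw [hζ, this, hb z (mem_ball_self hr)]
  have hts3 : tsupport ζ ⊆ K₃ := closure_minimal (fun z hz => by
    by_contra h; exact hz (hζ3 z h)) hK₃.isClosed
  refine ⟨ζ, ?_, hK₃.of_isClosed_subset isClosed_closure hts3, hts3.trans hr₁U, ?_, ?_⟩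
  · exact φ.hasCompactSupport_normed.contDiff_convolution_left (n := 1) _ φ.contDiff_normed
      hζc.locallyIntegrable
  · intro z hz
    have hb : ∀ y ∈ ball z r, ζ₀ y = 1 := by
      intro y hy
      have := hr₃O (mem_cthickening_of_dist_le y z r₃ K hz ((mem_ball.mp hy).le.trans hrr₃.le))
      exact hζ1 y this.1 this.2
    have := ContDiffBump.normed_convolution_eq_right (φ := φ) (μ := volume) (g := ζ₀) (x₀ := z)
      fun y hy => by rw [hb y hy, hb z (mem_ball_self hr)]
    rw [hζ, this, hb z (mem_ball_self hr)]
  · intro z hz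
    have hd := hpos z hz
    by_cases hz3 : z ∈ K₃
    swap
    · rw [image_eq_zero_of_notMem_tsupport fun h => hz3 (hts3 (tsupport_fderiv_subset ℝ h)),
        norm_zero]
      positivity
    refine norm_fderiv_le_of_lip' ℝ (by positivity) ?_
    filter_upwards [ball_mem_nhds z hr] with y hy
    have hval : ∀ x, ζ x = ∫ t, φ.normed volume t * ζ₀ (x - t) := fun x => by
      rw [hζ, convolution_def]; rfl
    have hint : ∀ x, Integrable fun t => φ.normed volume t * ζ₀ (x - t) := fun x =>
      (φ.continuous_normed.mul (hζc.comp (by fun_prop))).integrable_of_hasCompactSupport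
        φ.hasCompactSupport_normed.mul_right
    rw [hval y, hval z, ← integral_sub (hint y) (hint z)]
    have hφi : Integrable (φ.normed volume) :=
      φ.continuous_normed.integrable_of_hasCompactSupport φ.hasCompactSupport_normed
    calc ‖∫ t, (φ.normed volume t * ζ₀ (y - t) - φ.normed volume t * ζ₀ (z - t))‖
        ≤ ∫ t, φ.normed volume t * (ε / δ z * ‖y - z‖) := by
          refine norm_integral_le_of_norm_le (hφi.mul_const _)
            (Filter.Eventually.of_forall fun t => ?_)
          rw [← mul_sub, norm_mul, Real.norm_of_nonneg (φ.nonneg_normed t)]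
          by_cases ht : t ∈ ball (0 : ℂ) r
          swap
          · have : φ.normed volume t = 0 := by
              rw [← Function.notMem_support, φ.support_normed_eq]; exact ht
            simp [this]
          refine mul_le_mul_of_nonneg_left ?_ (φ.nonneg_normed t)
          rw [mem_ball_zero_iff] at ht
          rw [mem_ball, dist_eq_norm] at hy
          have hyB : y - t ∈ ball z r₂ := by
            rw [mem_ball, dist_eq_norm, show y - t - z = (y - z) - t by ring]
            exact (norm_sub_le _ _).trans_lt (by linarith)
          have hzB : z - t ∈ ball z r₂ := by
            rw [mem_ball, dist_eq_norm, show z - t - z = -t by ring, norm_neg]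
            linarith
          rw [hζU _ (h2 z hz3 _ hyB).1, hζU _ (h2 z hz3 _ hzB).1, Real.norm_eq_abs]
          refine (clamp_sub_le _ _).trans ?_
          rw [show 1 - e * (ρ (y - t) - R) - (1 - e * (ρ (z - t) - R)) =
            -(e * (ρ (y - t) - ρ (z - t))) by ring, abs_neg, abs_mul, abs_of_pos he0]
          have h5 := hρ (ball z r₂) (fun x hx => (h2 z hz3 x hx).1) (convex_ball z r₂) (δ z / 2)
            (by positivity) (fun x hx => (h2 z hz3 x hx).2) _ hyB _ hzB
          rw [show y - t - (z - t) = y - z by ring] at h5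
          refine (mul_le_mul_of_nonneg_left h5 he0.le).trans (le_of_eq ?_)
          rw [he]
          field_simp
      _ = ε / δ z * ‖y - z‖ := by rw [integral_mul_const, φ.integral_normed, one_mul]

/-! ### Hopf-Rinow for length distances -/

/-- The Hopf-Rinow theorem: in a complete length space that is locally compact, balls are relatively
compact. -/
theorem exists_isCompact_of_completeFor {X : Type*} [TopologicalSpace X] [LocallyCompactSpace X]
    {d : X → X → ℝ≥0∞} (hself : ∀ x, d x x = 0) (hsymm : ∀ x y, d x y = d y x)
    (htri : ∀ x y z, d x z ≤ d x y + d y z)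
    (hnhds : ∀ x, ∀ V ∈ 𝓝 x, ∃ r : ℝ≥0∞, 0 < r ∧ ∀ y, d x y < r → y ∈ V)
    (hball : ∀ x, ∀ r : ℝ≥0∞, 0 < r → {y | d x y < r} ∈ 𝓝 x)
    (hmid : ∀ x y, ∀ s t : ℝ≥0∞, 0 < s → 0 < t → d x y < s + t → ∃ z, d x z < s ∧ d z y < t)
    (hcomplete : CompleteFor d) (x : X) (R : ℝ≥0∞) (hR : R ≠ ⊤) :
    ∃ K : Set X, IsCompact K ∧ ∀ y, d x y < R → y ∈ K := by
  set P : X → ℝ≥0∞ → Prop := fun x R => ∃ K : Set X, IsCompact K ∧ ∀ y, d x y < R → y ∈ K with hP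
  -- A relatively compact ball can be enlarged by `q` if balls of radius `2q` about nearby points
  -- are relatively compact. Finitely many `q`-balls cover its closure, and a point within `r + q`
  -- of `x` is within `q` of a point of the `r`-ball, hence within `2q` of one of the centres.
  have step : ∀ x : X, ∀ r R q : ℝ≥0∞, 0 < r → 0 < q → r < R → P x r →
      (∀ x', d x x' < R → P x' (q + q)) → P x (r + q) := by
    rintro x r R q hr hq hrR ⟨K, hK, hKr⟩ hall
    set K₀ := K ∩ closure {y | d x y < r}
    have hK₀ : IsCompact K₀ := hK.inter_right isClosed_closure
    have hd : ∀ z ∈ K₀, d x z < R := by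
      intro z hz
      obtain ⟨e, he, heR⟩ : ∃ e : ℝ≥0∞, 0 < e ∧ r + e ≤ R :=
        ⟨R - r, tsub_pos_of_lt hrR, by rw [add_tsub_cancel_of_le hrR.le]⟩
      obtain ⟨z', hz', hz'r⟩ := mem_closure_iff_nhds.mp hz.2 _ (hball z e he)
      have h1 : d z' z < e := by rw [hsymm]; exact hz'
      exact (htri x z' z).trans_lt ((ENNReal.add_lt_add hz'r h1).trans_le heR)
    choose! C hC hCq using fun z (hz : z ∈ K₀) => hall z (hd z hz)
    obtain ⟨t, htK, htc⟩ := hK₀.elim_nhds_subcover (fun z => {y | d z y < q})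
      fun z _ => hball z q hq
    refine ⟨⋃ z ∈ t, C z, t.finite_toSet.isCompact_biUnion fun z hz => hC z (htK z hz),
      fun y hy => ?_⟩
    obtain ⟨z, hxz, hzy⟩ := hmid x y r q hr hq hy
    have hzK : z ∈ K₀ := ⟨hKr z hxz, subset_closure hxz⟩
    obtain ⟨z', hz't, hz'⟩ := mem_iUnion₂.mp (htc hzK)
    exact mem_iUnion₂.mpr ⟨z', hz't, hCq z' (htK z' hz't) y
      ((htri z' z y).trans_lt (ENNReal.add_lt_add hz' hzy))⟩
  have half : ∀ x : X, ∀ R : ℝ≥0∞, 0 < R → R ≠ ⊤ → ¬ P x R → ∃ x', d x x' < R ∧ ¬ P x' (R / 2) := by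
    intro x R hR0 hRt hnP
    by_contra hcon
    push Not at hcon
    apply hnP
    -- Two enlargements by `R / 4` carry the radius from `R / 2` to `R`. Each needs only balls of
    -- radius `q + q = R / 2`, which `hcon` supplies.
    set q := R / 2 / 2
    have hq2 : q + q = R / 2 := ENNReal.add_halves _
    have hR2 : R / 2 + R / 2 = R := ENNReal.add_halves _
    have hq0 : 0 < q := ENNReal.half_pos (ENNReal.half_pos hR0.ne').ne'
    have hh0 : 0 < R / 2 := ENNReal.half_pos hR0.ne'
    have hht : R / 2 ≠ ⊤ := (ENNReal.div_lt_top hRt (by norm_num)).ne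
    have hqt : q ≠ ⊤ := (ENNReal.div_lt_top hht (by norm_num)).ne
    have h1 : R / 2 < R := ENNReal.half_lt_self hR0.ne' hRt
    have hall : ∀ x', d x x' < R → P x' (q + q) := fun x' hx' => by rw [hq2]; exact hcon x' hx'
    have p1 : P x (R / 2) := hcon x (by rw [hself]; exact hR0)
    have p2 := step x (R / 2) R q hh0 hq0 h1 p1 hall
    have h2 : R / 2 + q < R := by
      conv_rhs => rw [← hR2, ← hq2]
      rw [hq2]
      exact ENNReal.add_lt_add_left hht (by rw [← hq2]; exact ENNReal.lt_add_right hqt hq0.ne')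
    have p3 := step x (R / 2 + q) R q (by positivity) hq0 h2 p2 hall
    rwa [add_assoc, hq2, hR2] at p3
  by_contra hnP
  have hR0 : 0 < R := by
    rw [pos_iff_ne_zero]
    rintro rfl
    exact hnP ⟨∅, isCompact_empty, by simp⟩
  have hpow : ∀ n : ℕ, 0 < R / 2 ^ n ∧ R / 2 ^ n ≠ ⊤ := fun n =>
    ⟨ENNReal.div_pos hR0.ne' (by finiteness), (ENNReal.div_lt_top hR (by positivity)).ne⟩
  have hdd : ∀ n : ℕ, R / 2 ^ (n + 1) = R / 2 ^ n / 2 := fun n => by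
    rw [pow_succ, div_eq_mul_inv, div_eq_mul_inv, div_eq_mul_inv,
      ENNReal.mul_inv (Or.inr (by simp)) (Or.inr (by simp)), mul_assoc]
  -- Iterating gives centres whose balls of radius `R / 2 ^ n` are not relatively compact, with
  -- consecutive distances below `R / 2 ^ n`: a Cauchy sequence.
  choose! f hf1 hf2 using half
  let s : ℕ → X := fun n => Nat.rec x (fun n y => f y (R / 2 ^ n)) n
  have hs0 : s 0 = x := rfl
  have hss : ∀ n, s (n + 1) = f (s n) (R / 2 ^ n) := fun n => rfl
  have hsP : ∀ n, ¬ P (s n) (R / 2 ^ n) := by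
    intro n
    induction n with
    | zero => rw [hs0, pow_zero, div_one]; exact hnP
    | succ n ih =>
      rw [hss, hdd]
      exact hf2 _ _ (hpow n).1 (hpow n).2 ih
  have hsd : ∀ n, d (s n) (s (n + 1)) < R / 2 ^ n := fun n => by
    rw [hss]; exact hf1 _ _ (hpow n).1 (hpow n).2 (hsP n)
  have hsum : ∀ n k, d (s n) (s (n + k)) ≤ 2 * (R / 2 ^ n) := by
    intro n k
    induction k generalizing n with
    | zero => simp [hself]
    | succ k ih =>
      calc d (s n) (s (n + (k + 1))) ≤ d (s n) (s (n + 1)) + d (s (n + 1)) (s (n + (k + 1))) :=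
            htri _ _ _
        _ ≤ R / 2 ^ n + 2 * (R / 2 ^ (n + 1)) := by
            refine add_le_add (hsd n).le ?_
            have := ih (n + 1)
            rwa [show n + 1 + k = n + (k + 1) by ring] at this
        _ = 2 * (R / 2 ^ n) := by
            rw [hdd, ENNReal.mul_div_cancel (by simp) (by simp), two_mul]
  have hlim : Filter.Tendsto (fun n : ℕ => 2 * (R / 2 ^ n)) Filter.atTop (𝓝 0) := by
    have h1 : Filter.Tendsto (fun n : ℕ => (2 * R) * (2⁻¹ : ℝ≥0∞) ^ n) Filter.atTop
        (𝓝 ((2 * R) * 0)) :=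
      ENNReal.Tendsto.const_mul (ENNReal.tendsto_pow_atTop_nhds_zero_of_lt_one (by simp))
        (Or.inr (by finiteness))
    rw [mul_zero] at h1
    refine h1.congr fun n => ?_
    rw [div_eq_mul_inv, ENNReal.inv_pow, mul_assoc]
  obtain ⟨q, hq⟩ := hcomplete s (by
    intro ε hε
    obtain ⟨N, hN⟩ := Filter.eventually_atTop.mp (hlim.eventually_lt_const hε)
    refine ⟨N, fun m hm n hn => ?_⟩
    rcases le_total m n with h | h
    · obtain ⟨k, rfl⟩ := Nat.exists_eq_add_of_le h
      exact (hsum m k).trans_lt (hN m hm)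
    · obtain ⟨k, rfl⟩ := Nat.exists_eq_add_of_le h
      rw [hsymm]
      exact (hsum n k).trans_lt (hN n hn))
  -- Near the limit `q` the shrinking balls eventually lie in one compact neighbourhood, contrary to
  -- their choice.
  obtain ⟨C, hC, hCq⟩ := exists_compact_mem_nhds q
  obtain ⟨r, hr, hrC⟩ := hnhds q C hCq
  have hr2 : 0 < r / 2 := ENNReal.half_pos hr.ne'
  have e1 := hq.eventually (hball q (r / 2) hr2)
  have e2 := hlim.eventually_lt_const hr2
  obtain ⟨n, hn1, hn2⟩ := (e1.and e2).exists
  refine hsP n ⟨C, hC, fun y hy => hrC y ?_⟩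
  calc d q y ≤ d q (s n) + d (s n) y := htri _ _ _
    _ < r / 2 + r / 2 := by
        refine ENNReal.add_lt_add hn1 (hy.trans_le (le_trans ?_ hn2.le))
        rw [two_mul]; exact le_self_add
    _ = r := ENNReal.add_halves r

/-! ### The length distance of a conformal metric -/

/-- The length element of a curve in the conformal metric `δ⁻² |dz|²`. -/
noncomputable def confSpeed (δ : ℂ → ℝ) (γ : ℝ → ℂ) (t : ℝ) : ℝ≥0∞ :=
  ENNReal.ofReal (‖deriv γ t‖ / δ (γ t))

/-- There is a `C¹` curve in `U` from `y` to `z`, constant off `[0, 1]`, of length less than `r`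
in the conformal metric `δ⁻² |dz|²`. -/
def JoinedWithin (U : Set ℂ) (δ : ℂ → ℝ) (y z : ℂ) (r : ℝ≥0∞) : Prop :=
  ∃ γ : ℝ → ℂ, ContDiff ℝ 1 γ ∧ (∀ t, γ t ∈ U) ∧ (∀ t ≤ 0, γ t = y) ∧ (∀ t, 1 ≤ t → γ t = z) ∧
    ∫⁻ t, confSpeed δ γ t < r

theorem range_smoothTransition : range Real.smoothTransition = Icc 0 1 := by
  refine subset_antisymm ?_ ?_
  · rintro _ ⟨t, rfl⟩
    exact ⟨Real.smoothTransition.nonneg t, Real.smoothTransition.le_one t⟩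
  · have := intermediate_value_Icc zero_le_one Real.smoothTransition.continuous.continuousOn
    rw [Real.smoothTransition.zero, Real.smoothTransition.one] at this
    exact this.trans (image_subset_range _ _)

/-- Reparametrizing by a smooth monotone step makes the curve constant off `[0, 1]` without changing
its length. Such curves can be concatenated and remain `C¹`, whereas arbitrary `C¹` curves would
acquire corners. -/
theorem joinedWithin_of_curve {U : Set ℂ} {δ : ℂ → ℝ} {γ : ℝ → ℂ} {a b : ℝ} (hab : a ≤ b)
    (hγ : ContDiffOn ℝ 1 γ (Icc a b)) (hU : ∀ t ∈ Icc a b, γ t ∈ U) {r : ℝ≥0∞}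
    (hr : ∫⁻ t in Icc a b, ENNReal.ofReal (‖derivWithin γ (Icc a b) t‖ / δ (γ t)) < r) :
    JoinedWithin U δ (γ a) (γ b) r := by
  set f : ℝ → ℝ := fun t => a + (b - a) * Real.smoothTransition t with hf
  have hfm : ∀ t, f t ∈ Icc a b := by
    intro t
    have h0 := Real.smoothTransition.nonneg t
    have h1 := Real.smoothTransition.le_one t
    constructor <;> simp only [hf] <;> nlinarith
  have hfc : ContDiff ℝ 1 f :=
    contDiff_const.add (contDiff_const.mul (Real.smoothTransition.contDiff (n := 1)))
  have hmono : Monotone f := fun s t hst => by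
    simp only [hf]
    have := Real.smoothTransition.monotone hst
    nlinarith
  have hf' : ∀ t, HasDerivAt f (deriv f t) t := fun t =>
    (hfc.differentiable (by simp) t).hasDerivAt
  have himg : f '' univ = Icc a b := by
    refine subset_antisymm (by rintro _ ⟨t, -, rfl⟩; exact hfm t) fun s hs => ?_
    rcases hab.eq_or_lt with rfl | hlt
    · exact ⟨0, mem_univ _, by simp only [hf]; have := hs.1; have := hs.2; simp; linarith⟩
    have hmem : (s - a) / (b - a) ∈ range Real.smoothTransition := by
      rw [range_smoothTransition]
      have : 0 < b - a := by linarith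
      exact ⟨div_nonneg (by linarith [hs.1]) this.le, by rw [div_le_one this]; linarith [hs.2]⟩
    obtain ⟨t, ht⟩ := hmem
    refine ⟨t, mem_univ _, ?_⟩
    simp only [hf, ht]
    have : b - a ≠ 0 := by linarith
    field_simp
    ring
  have hd : ∀ t, HasDerivAt (γ ∘ f) (deriv f t • derivWithin γ (Icc a b) (f t)) t := by
    intro t
    have h1 := ((hγ.differentiableOn (by simp)) (f t) (hfm t)).hasDerivWithinAt
    have := HasDerivWithinAt.scomp t h1 (hf' t).hasDerivWithinAt (fun s (_ : s ∈ univ) => hfm s)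
    simpa using this
  refine ⟨γ ∘ f, ?_, fun t => hU _ (hfm t), fun t ht => ?_, fun t ht => ?_, ?_⟩
  · rw [← contDiffOn_univ]
    exact hγ.comp hfc.contDiffOn fun t _ => hfm t
  · simp [hf, Real.smoothTransition.zero_of_nonpos ht]
  · simp [hf, Real.smoothTransition.one_of_one_le ht]
  · refine lt_of_eq_of_lt ?_ hr
    rw [← himg, lintegral_image_eq_lintegral_deriv_mul_of_monotoneOn MeasurableSet.univ
      (fun t _ => (hf' t).hasDerivWithinAt) (hmono.monotoneOn _), setLIntegral_univ]
    refine lintegral_congr fun t => ?_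
    rw [himg, confSpeed, (hd t).deriv, norm_smul, Real.norm_of_nonneg hmono.deriv_nonneg,
      ← ENNReal.ofReal_mul hmono.deriv_nonneg, mul_div_assoc]
    rfl

theorem JoinedWithin.symm {U : Set ℂ} {δ : ℂ → ℝ} {y z : ℂ} {r : ℝ≥0∞}
    (h : JoinedWithin U δ y z r) : JoinedWithin U δ z y r := by
  obtain ⟨γ, hγ, hU, h0, h1, hr⟩ := h
  refine ⟨fun t => γ (1 - t), hγ.comp (contDiff_const.sub contDiff_id), fun t => hU _,
    fun t ht => h1 _ (by linarith), fun t ht => h0 _ (by linarith), lt_of_eq_of_lt ?_ hr⟩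
  rw [← lintegral_sub_left_eq_self _ (1 : ℝ)]
  refine lintegral_congr fun t => ?_
  simp only [confSpeed]
  rw [deriv_comp_const_sub, norm_neg, sub_sub_cancel]

theorem deriv_eq_zero_of_eq_on_Iic {γ : ℝ → ℂ} (hγ : ContDiff ℝ 1 γ) {y : ℂ} {a : ℝ}
    (h : ∀ t ≤ a, γ t = y) {t : ℝ} (ht : t ≤ a) : deriv γ t = 0 := by
  have h1 := ((hγ.differentiable (by simp) t).hasDerivAt).hasDerivWithinAt (s := Iic a)
  have h2 : HasDerivWithinAt γ 0 (Iic a) t :=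
    (hasDerivWithinAt_const t (Iic a) y).congr h (h t ht)
  exact (uniqueDiffOn_Iic a t ht).eq_deriv _ h1 h2

theorem JoinedWithin.trans {U : Set ℂ} {δ : ℂ → ℝ} {x y z : ℂ} {r s : ℝ≥0∞}
    (h : JoinedWithin U δ x y r) (h' : JoinedWithin U δ y z s) :
    JoinedWithin U δ x z (r + s) := by
  obtain ⟨γ, hγ, hU, h0, h1, hr⟩ := h
  obtain ⟨η, hη, hU', h0', h1', hs⟩ := h'
  -- The concatenation is written as a sum rather than by cases: before time `1` the curve `η (t -
  -- 1)` rests at `y`, and after it `γ` does. Regularity at the junction is then immediate.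
  have hd : ∀ t, deriv (fun t => γ t + η (t - 1) - y) t = deriv γ t + deriv η (t - 1) := by
    intro t
    have e1 := (hγ.differentiable (by simp) t).hasDerivAt
    have e2 := ((hη.differentiable (by simp) (t - 1)).hasDerivAt).comp_sub_const t 1
    exact ((e1.add e2).sub_const y).deriv
  have hη0 : ∀ t ≤ 1, deriv η (t - 1) = 0 := fun t ht =>
    deriv_eq_zero_of_eq_on_Iic hη h0' (by linarith)
  have hγ0 : ∀ t, 1 ≤ t → deriv γ t = 0 := by
    intro t ht
    have := deriv_eq_zero_of_eq_on_Iic (γ := fun t => γ (-t)) (hγ.comp contDiff_neg) (a := -1)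
      (y := y) (fun u hu => h1 _ (by linarith)) (t := -t) (by linarith)
    rw [deriv_comp_neg] at this
    simpa using this
  have hv1 : ∀ t ≤ 1, γ t + η (t - 1) - y = γ t := fun t ht => by
    rw [h0' _ (by linarith)]; ring
  have hv2 : ∀ t, 1 ≤ t → γ t + η (t - 1) - y = η (t - 1) := fun t ht => by
    rw [h1 _ ht]; ring
  have hC : ContDiff ℝ 1 (fun t => γ t + η (t - 1) - y) :=
    (hγ.add (hη.comp (contDiff_id.sub contDiff_const))).sub contDiff_const
  have key : ∫⁻ t, confSpeed δ (fun t => γ t + η (t - 1) - y) t < r + s := by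
    refine lt_of_le_of_lt ?_ (ENNReal.add_lt_add hr hs)
    rw [← lintegral_sub_right_eq_self (confSpeed δ η) 1]
    rw [← lintegral_add_compl _ (measurableSet_Iic (a := (1 : ℝ)))]
    refine add_le_add ?_ ?_
    · refine le_trans (le_of_eq ?_) (setLIntegral_le_lintegral (Iic 1) _)
      refine setLIntegral_congr_fun measurableSet_Iic fun t ht => ?_
      simp only [confSpeed, hd]
      rw [hη0 t ht, hv1 t ht, add_zero]
    · refine le_trans (le_of_eq ?_) (setLIntegral_le_lintegral (Iic 1)ᶜ _)
      refine setLIntegral_congr_fun measurableSet_Iic.compl fun t ht => ?_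
      have ht : 1 ≤ t := (not_le.mp (show ¬ t ≤ 1 from ht)).le
      simp only [confSpeed, hd]
      rw [hγ0 t ht, hv2 t ht, zero_add]
  have := joinedWithin_of_curve (U := U) (δ := δ) (a := 0) (b := 2) (r := r + s) (by norm_num)
    hC.contDiffOn (fun t _ => ?_) ?_
  · rw [hv1 0 (by norm_num), hv2 2 (by norm_num), h0 0 le_rfl, h1' _ (by norm_num)] at this
    exact this
  · rcases le_total t 1 with ht | ht
    · rw [hv1 t ht]; exact hU t
    · rw [hv2 t ht]; exact hU' _
  · refine lt_of_le_of_lt ?_ key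
    refine le_trans (le_of_eq ?_) (setLIntegral_le_lintegral (Icc 0 2) _)
    refine setLIntegral_congr_fun measurableSet_Icc fun t ht => ?_
    rw [confSpeed, (hC.differentiable (by simp) t).derivWithin
      (uniqueDiffOn_Icc (by norm_num) t ht)]

theorem continuous_norm_deriv_div {U : Set ℂ} {δ : ℂ → ℝ} (hδ : ContinuousOn δ U)
    (hpos : ∀ z ∈ U, 0 < δ z) {γ : ℝ → ℂ} (hγ : ContDiff ℝ 1 γ) (hU : ∀ t, γ t ∈ U) :
    Continuous fun t => ‖deriv γ t‖ / δ (γ t) :=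
  (hγ.continuous_deriv le_rfl).norm.div (hδ.comp_continuous hγ.continuous hU)
    fun t => (hpos _ (hU t)).ne'

/-- Cut the curve at a suitable value of its arc length, which is continuous in the parameter. This
is the midpoint property that Hopf-Rinow requires. -/
theorem JoinedWithin.exists_between {U : Set ℂ} {δ : ℂ → ℝ} (hδ : ContinuousOn δ U)
    (hpos : ∀ z ∈ U, 0 < δ z) {x y : ℂ} {s t : ℝ≥0∞} (hs : 0 < s) (ht : 0 < t)
    (h : JoinedWithin U δ x y (s + t)) :
    ∃ z ∈ U, JoinedWithin U δ x z s ∧ JoinedWithin U δ z y t := by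
  obtain ⟨γ, hγ, hU, h0, h1, hr⟩ := h
  have hc := continuous_norm_deriv_div hδ hpos hγ hU
  have hnn : ∀ t, 0 ≤ ‖deriv γ t‖ / δ (γ t) := fun t =>
    div_nonneg (norm_nonneg _) (hpos _ (hU t)).le
  set σ := fun t => ‖deriv γ t‖ / δ (γ t) with hσ
  have hlen : ∀ a b, a ≤ b → ∫⁻ t in Icc a b, confSpeed δ γ t
      = ENNReal.ofReal (∫ t in a..b, σ t) := by
    intro a b hab
    rw [intervalIntegral.integral_of_le hab, ← integral_Icc_eq_integral_Ioc,
      ofReal_integral_eq_lintegral_ofReal (hc.continuousOn.integrableOn_Icc)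
        (ae_of_all _ hnn)]
    rfl
  have hsub : ∀ a b, a ≤ b → ∀ r, ENNReal.ofReal (∫ t in a..b, σ t) < r →
      JoinedWithin U δ (γ a) (γ b) r := by
    intro a b hab r hr
    rcases hab.eq_or_lt with rfl | hlt
    · refine joinedWithin_of_curve hab hγ.contDiffOn (fun t _ => hU t) ?_
      simp only [Icc_self, Measure.restrict_singleton, Real.volume_singleton, zero_smul,
        lintegral_zero_measure]
      exact bot_le.trans_lt hr
    refine joinedWithin_of_curve hab hγ.contDiffOn (fun t _ => hU t) ?_
    rw [← hlen a b hab] at hr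
    refine lt_of_eq_of_lt (setLIntegral_congr_fun measurableSet_Icc fun t ht => ?_) hr
    rw [confSpeed, (hγ.differentiable (by simp) t).derivWithin (uniqueDiffOn_Icc hlt t ht)]
  set F : ℝ → ℝ := fun τ => ∫ t in (0 : ℝ)..τ, σ t with hF
  have hFc : Continuous F := intervalIntegral.continuous_primitive (fun a b
      => hc.intervalIntegrable a b) 0
  have hL : ENNReal.ofReal (F 1) < s + t :=
    ((hlen 0 1 zero_le_one).symm.trans_le (setLIntegral_le_lintegral _ _)).trans_lt hr
  have hF1 : 0 ≤ F 1 := intervalIntegral.integral_nonneg zero_le_one fun t _ => hnn t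
  -- The length `v` to be spent before the cut. If one allowance exceeds the whole length, the cut
  -- is at an end, which also settles infinite allowances; otherwise the midpoint of the interval
  -- from `F 1 - t` to `s` works.
  obtain ⟨v, hv0, hv1, hvs, hvt⟩ : ∃ v, 0 ≤ v ∧ v ≤ F 1 ∧ ENNReal.ofReal v < s ∧
      ENNReal.ofReal (F 1 - v) < t := by
    rcases lt_or_ge (ENNReal.ofReal (F 1)) s with h | h
    · exact ⟨F 1, hF1, le_rfl, h, by simpa using ht⟩
    rcases lt_or_ge (ENNReal.ofReal (F 1)) t with h' | h'
    · exact ⟨0, le_rfl, hF1, by simpa using hs, by simpa using h'⟩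
    have hst := (h.trans_lt ENNReal.ofReal_lt_top).ne
    have htt := (h'.trans_lt ENNReal.ofReal_lt_top).ne
    lift s to NNReal using hst
    lift t to NNReal using htt
    rw [← ENNReal.ofReal_coe_nnreal, ENNReal.ofReal_le_ofReal_iff hF1] at h h'
    rw [← ENNReal.ofReal_coe_nnreal, ← ENNReal.ofReal_coe_nnreal (p := t),
      ← ENNReal.ofReal_add s.coe_nonneg t.coe_nonneg] at hL
    have hL := (ENNReal.ofReal_lt_ofReal_iff_of_nonneg hF1).mp hL
    refine ⟨(F 1 - t + s) / 2, ?_, ?_, ?_, ?_⟩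
    · linarith [s.coe_nonneg]
    · have : (0 : ℝ) ≤ t := t.coe_nonneg
      linarith
    · rw [← ENNReal.ofReal_coe_nnreal, ENNReal.ofReal_lt_ofReal_iff_of_nonneg] <;> linarith
        [s.coe_nonneg]
    · rw [← ENNReal.ofReal_coe_nnreal, ENNReal.ofReal_lt_ofReal_iff_of_nonneg] <;> linarith
        [t.coe_nonneg]
  have hF0 : F 0 = 0 := intervalIntegral.integral_same
  obtain ⟨τ, hτ, hτv⟩ := intermediate_value_Icc zero_le_one hFc.continuousOn
    (show v ∈ Icc (F 0) (F 1) by rw [hF0]; exact ⟨hv0, hv1⟩)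
  refine ⟨γ τ, hU τ, ?_, ?_⟩
  · rw [← h0 0 le_rfl]
    exact hsub 0 τ hτ.1 s (by rw [← hτv] at hvs; exact hvs)
  · rw [← h1 1 le_rfl]
    refine hsub τ 1 hτ.2 t ?_
    rwa [← intervalIntegral.integral_interval_sub_left (hc.intervalIntegrable 0 1)
      (hc.intervalIntegrable 0 τ), show (∫ t in (0 : ℝ)..τ, σ t) = v from hτv]

theorem joinedWithin_of_convex {U V : Set ℂ} (hVU : V ⊆ U) (hV : Convex ℝ V) {δ : ℂ → ℝ} {m : ℝ}
    (hm : 0 < m) (hδ : ∀ z ∈ V, m ≤ δ z) {y z : ℂ} (hy : y ∈ V) (hz : z ∈ V) {r : ℝ≥0∞}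
    (hr : ENNReal.ofReal (‖z - y‖ / m) < r) : JoinedWithin U δ y z r := by
  have hγ : ∀ t : ℝ, HasDerivAt (fun t : ℝ => y + t • (z - y)) (z - y) t := fun t => by
    simpa using ((hasDerivAt_id t).smul_const (z - y)).const_add y
  have hmem : ∀ t ∈ Icc (0 : ℝ) 1, y + t • (z - y) ∈ V := fun t ht =>
    hV.add_smul_sub_mem hy hz ht
  have hC : ContDiff ℝ 1 (fun t : ℝ => y + t • (z - y)) :=
    contDiff_const.add (contDiff_id.smul contDiff_const)
  have := joinedWithin_of_curve (U := U) (δ := δ) (r := r) zero_le_one hC.contDiffOn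
    (fun t ht => hVU (hmem t ht)) ?_
  · simpa using this
  refine lt_of_le_of_lt (setLIntegral_mono' (g := fun _ => ENNReal.ofReal (‖z - y‖ / m))
    measurableSet_Icc fun t ht => ?_) (by simpa using hr)
  rw [(hγ t).hasDerivWithinAt.derivWithin (uniqueDiffOn_Icc zero_lt_one t ht)]
  gcongr
  exact hδ _ (hmem t ht)

/-- A bump function at `x` supported near `x` has gradient at most a constant over `δ`. A curve
leaving the neighbourhood must bring it from `1` to `0`, so its length is at least the inverse of
that constant. -/
theorem exists_joinedWithin_subset {U : Set ℂ} (hU : IsOpen U) {δ : ℂ → ℝ}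
    (hδ : ContinuousOn δ U) (hpos : ∀ z ∈ U, 0 < δ z) {x : ℂ} (hx : x ∈ U) {V : Set ℂ}
    (hV : V ∈ 𝓝 x) : ∃ r : ℝ≥0∞, 0 < r ∧ ∀ y, JoinedWithin U δ x y r → y ∈ V := by
  obtain ⟨ρ, hρ, hρV⟩ := Metric.nhds_basis_closedBall.mem_iff.mp
    (Filter.inter_mem (hU.mem_nhds hx) hV)
  have hK : IsCompact (closedBall x ρ) := isCompact_closedBall x ρ
  obtain ⟨M, hM⟩ := (hK.image_of_continuousOn (hδ.mono fun z hz => (hρV hz).1)).bddAbove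
  let ζ : ContDiffBump x := ⟨ρ / 2, ρ, by positivity, by linarith⟩
  have hζ : ContDiff ℝ 1 ζ := ζ.contDiff
  obtain ⟨B, hB⟩ := (ζ.hasCompactSupport.fderiv (𝕜 := ℝ)).exists_bound_of_continuous
    (hζ.continuous_fderiv (by simp))
  have hM0 : 0 < M := (hpos x hx).trans_le (hM (mem_image_of_mem _ (mem_closedBall_self hρ.le)))
  have hB0 : 0 ≤ B := (norm_nonneg _).trans (hB x)
  have hbound : ∀ z ∈ U, ‖fderiv ℝ ζ z‖ ≤ (B + 1) * M / δ z := by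
    intro z hz
    have hdz := hpos z hz
    by_cases hzb : z ∈ closedBall x ρ
    · rw [le_div_iff₀ hdz]
      have h1 := hM (mem_image_of_mem _ hzb)
      have h2 := hB z
      gcongr
      linarith
    · have : z ∉ tsupport ζ := by rwa [ζ.tsupport_eq]
      have h0 : fderiv ℝ ζ z = 0 := by
        have h3 := support_fderiv_subset ℝ (f := ζ)
        by_contra hne
        exact this (h3 hne)
      rw [h0, norm_zero]
      positivity
  refine ⟨ENNReal.ofReal (1 / ((B + 1) * M)), by rw [ENNReal.ofReal_pos]; positivity, ?_⟩
  rintro y ⟨γ, hγ, hγU, h0, h1, hr⟩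
  by_contra hy
  have hc := continuous_norm_deriv_div hδ hpos hγ hγU
  have hd : ∀ t, HasDerivAt (ζ ∘ γ) (fderiv ℝ ζ (γ t) (deriv γ t)) t := fun t =>
    (hζ.differentiable (by simp) (γ t)).hasFDerivAt.comp_hasDerivAt t
      (hγ.differentiable (by simp) t).hasDerivAt
  have hdc : Continuous fun t => fderiv ℝ ζ (γ t) (deriv γ t) :=
    ((hζ.continuous_fderiv (by simp)).comp hγ.continuous).clm_apply (hγ.continuous_deriv le_rfl)
  have hftc := intervalIntegral.integral_eq_sub_of_hasDerivAt (a := 0) (b := 1)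
    (fun t _ => hd t) (hdc.intervalIntegrable 0 1)
  have e0 : ζ (γ 0) = 1 := by
    rw [h0 0 le_rfl]
    exact ζ.one_of_mem_closedBall (mem_closedBall_self (by positivity))
  have e1 : ζ (γ 1) = 0 := by
    rw [h1 1 le_rfl]
    refine ζ.zero_of_le_dist ?_
    by_contra hlt
    exact hy (hρV (mem_closedBall.mpr (not_le.mp hlt).le)).2
  simp only [Function.comp_apply, e0, e1] at hftc
  have hle : (1 : ℝ) ≤ (B + 1) * M * ∫ t in (0 : ℝ)..1, ‖deriv γ t‖ / δ (γ t) := by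
    have h2 := intervalIntegral.norm_integral_le_of_norm_le (μ := volume) (a := 0) (b := 1)
      (f := fun t => fderiv ℝ ζ (γ t) (deriv γ t))
      (g := fun t => (B + 1) * M * (‖deriv γ t‖ / δ (γ t))) zero_le_one
      (ae_of_all _ fun t _ => ?_) ((hc.const_mul _).intervalIntegrable 0 1)
    · rw [hftc, intervalIntegral.integral_const_mul] at h2
      simpa using h2
    · refine ((fderiv ℝ ζ (γ t)).le_opNorm _).trans ?_
      calc _ ≤ (B + 1) * M / δ (γ t) * ‖deriv γ t‖ := by gcongr; exact hbound _ (hγU t)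
        _ = _ := by ring
  have hlt : ∫ t in (0 : ℝ)..1, ‖deriv γ t‖ / δ (γ t) < 1 / ((B + 1) * M) := by
    have h3 := (setLIntegral_le_lintegral (Icc (0 : ℝ) 1) (confSpeed δ γ)).trans_lt hr
    unfold confSpeed at h3
    rw [← ofReal_integral_eq_lintegral_ofReal hc.continuousOn.integrableOn_Icc
      (ae_of_all _ fun t => div_nonneg (norm_nonneg _) (hpos _ (hγU t)).le),
      integral_Icc_eq_integral_Ioc, ← intervalIntegral.integral_of_le zero_le_one] at h3
    exact (ENNReal.ofReal_lt_ofReal_iff (by positivity)).mp h3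
  rw [lt_div_iff₀ (by positivity)] at hlt
  linarith

/-! ### From completeness of the base to cutoff functions -/

/-- The identification of `ℂ` with the coordinate plane. -/
noncomputable def planeEquiv : ℂ ≃L[ℝ] Coord 2 :=
  Complex.equivRealProdCLM.trans (ContinuousLinearEquiv.finTwoArrow ℝ ℝ).symm

@[simp] theorem planeEquiv_apply_zero (z : ℂ) : planeEquiv z 0 = z.re := rfl

@[simp] theorem planeEquiv_apply_one (z : ℂ) : planeEquiv z 1 = z.im := rfl

@[simp] theorem planeEquiv_symm_re (p : Coord 2) : (planeEquiv.symm p).re = p 0 := by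
  rw [← planeEquiv_apply_zero, ContinuousLinearEquiv.apply_symm_apply]

@[simp] theorem planeEquiv_symm_im (p : Coord 2) : (planeEquiv.symm p).im = p 1 := by
  rw [← planeEquiv_apply_one, ContinuousLinearEquiv.apply_symm_apply]

theorem planeEquiv_one : planeEquiv 1 = Pi.single 0 1 := by
  ext i; fin_cases i <;> simp

theorem planeEquiv_I : planeEquiv Complex.I = Pi.single 1 1 := by
  ext i; fin_cases i <;> simp

theorem metricInner_baseMetric (δ : Coord 2 → ℝ) (p v w : Coord 2) :
    metricInner (baseMetric δ) p v w = (v 0 * w 0 + v 1 * w 1) / δ p ^ 2 := by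
  simp only [metricInner, baseMetric, Matrix.smul_mulVec, Matrix.one_mulVec, dotProduct,
    Fin.sum_univ_two, Pi.smul_apply, smul_eq_mul]
  ring

theorem sqrt_metricInner_baseMetric {δ : Coord 2 → ℝ} {p : Coord 2} (hp : 0 < δ p) (v : Coord 2) :
    √(metricInner (baseMetric δ) p v v) = ‖planeEquiv.symm v‖ / δ p := by
  rw [metricInner_baseMetric, Real.sqrt_div (by nlinarith [sq_nonneg (v 0), sq_nonneg (v 1)]),
    Real.sqrt_sq hp.le, Complex.norm_eq_sqrt_sq_add_sq]
  simp [sq]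

theorem deriv_planeEquiv_symm_comp (γ : ℝ → Coord 2) (t : ℝ) :
    deriv (planeEquiv.symm ∘ γ) t = planeEquiv.symm (deriv γ t) := by
  rw [← fderiv_apply_one_eq_deriv, ← fderiv_apply_one_eq_deriv,
    ContinuousLinearEquiv.comp_fderiv]
  rfl

theorem curveLength_baseMetric {Ω : Set (Coord 2)} {δ : Coord 2 → ℝ} (hpos : ∀ p ∈ Ω, 0 < δ p)
    {γ : ℝ → Coord 2} (hγ : ∀ t ∈ Icc (0 : ℝ) 1, γ t ∈ Ω) :
    curveLength (baseMetric δ) γ =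
      ∫⁻ t in Icc (0 : ℝ) 1, confSpeed (δ ∘ planeEquiv) (planeEquiv.symm ∘ γ) t := by
  refine setLIntegral_congr_fun measurableSet_Icc fun t ht => ?_
  simp only [confSpeed]
  rw [sqrt_metricInner_baseMetric (hpos _ (hγ t ht)), deriv_planeEquiv_symm_comp]
  simp

/-- Translates the infimum over curves into the relation `JoinedWithin`, from which the triangle
inequality, symmetry and the midpoint property are read off. -/
theorem baseDist_lt_iff {Ω : Set (Coord 2)} {δ : Coord 2 → ℝ} (hpos : ∀ p ∈ Ω, 0 < δ p)
    (p q : Ω) (r : ℝ≥0∞) :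
    baseDist Ω δ p q < r ↔ JoinedWithin (planeEquiv ⁻¹' Ω) (δ ∘ planeEquiv)
      (planeEquiv.symm p) (planeEquiv.symm q) r := by
  constructor
  · intro h
    simp only [baseDist, iInf_lt_iff] at h
    obtain ⟨γ, hγ, hΩ, h0, h1, hr⟩ := h
    -- The curve is controlled only on `[0, 1]`, so the two-sided `deriv` in its length is
    -- meaningful only in the interior; the endpoints form a null set.
    rw [curveLength_baseMetric hpos hΩ, ← restrict_Ioo_eq_restrict_Icc] at hr
    have := joinedWithin_of_curve (U := planeEquiv ⁻¹' Ω) (δ := δ ∘ planeEquiv)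
      (γ := planeEquiv.symm ∘ γ) zero_le_one
      (planeEquiv.symm.contDiff.comp_contDiffOn hγ) (fun t ht => by simpa using hΩ t ht)
      (r := r) ?_
    · simpa [h0, h1] using this
    · rw [← restrict_Ioo_eq_restrict_Icc]
      refine lt_of_eq_of_lt (setLIntegral_congr_fun measurableSet_Ioo fun t ht => ?_) hr
      rw [derivWithin_of_mem_nhds (Icc_mem_nhds ht.1 ht.2)]
      rfl
  · rintro ⟨γ, hγ, hU, h0, h1, hr⟩
    have hΩ : ∀ t ∈ Icc (0 : ℝ) 1, (planeEquiv ∘ γ) t ∈ Ω := fun t _ => hU t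
    refine lt_of_le_of_lt (iInf_le_of_le (planeEquiv ∘ γ) <|
      iInf_le_of_le ((planeEquiv.contDiff.comp hγ).contDiffOn) <| iInf_le_of_le hΩ <|
      iInf_le_of_le (by simp [h0 0 le_rfl]) <| iInf_le _ (by simp [h1 1 le_rfl])) ?_
    rw [curveLength_baseMetric hpos hΩ]
    have : planeEquiv.symm ∘ planeEquiv ∘ γ = γ := by funext t; simp
    rw [this]
    exact (setLIntegral_le_lintegral _ _).trans_lt hr

theorem eq_of_forall_lt_iff_lt {a b : ℝ≥0∞} (h : ∀ r, a < r ↔ b < r) : a = b :=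
  le_antisymm (le_of_forall_gt fun r hr => (h r).2 hr) (le_of_forall_gt fun r hr => (h r).1 hr)

theorem starConvex_preimage_planeEquiv {Ω : Set (Coord 2)} (hs : StarConvex ℝ 0 Ω) :
    StarConvex ℝ 0 (planeEquiv ⁻¹' Ω) := by
  refine StarConvex.is_linear_preimage ?_ planeEquiv.toLinearEquiv.toLinearMap.isLinear
  simpa using hs

/-- On a complete conformal plane domain there are cutoff functions with small gradient. -/
theorem hasCutoffs_of_baseComplete {Ω : Set (Coord 2)} (hΩ : IsOpen Ω) (h0 : (0 : Coord 2) ∈ Ω)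
    (hs : StarConvex ℝ 0 Ω) {δ : Coord 2 → ℝ} (hδ : ContinuousOn δ Ω) (hpos : ∀ p ∈ Ω, 0 < δ p)
    (hcomplete : BaseComplete Ω δ) : HasCutoffs (planeEquiv ⁻¹' Ω) (δ ∘ planeEquiv) := by
  classical
  set U := planeEquiv ⁻¹' Ω with hUdef
  set δ' := δ ∘ planeEquiv with hδ'
  have hU : IsOpen U := hΩ.preimage planeEquiv.continuous
  have hδ'c : ContinuousOn δ' U := hδ.comp planeEquiv.continuous.continuousOn fun z hz => hz
  have hpos' : ∀ z ∈ U, 0 < δ' z := fun z hz => hpos _ hz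
  have hlt := baseDist_lt_iff hpos
  have hsU : StarConvex ℝ 0 U := starConvex_preimage_planeEquiv hs
  have hmemU : ∀ p : Ω, planeEquiv.symm p ∈ U := fun p => by simp [hUdef]
  have hrefl : ∀ z ∈ U, ∀ r, 0 < r → JoinedWithin U δ' z z r := fun z hz r hr =>
    joinedWithin_of_convex (V := {z}) (by simpa using hz) (convex_singleton z) (hpos' z hz)
      (by simp) rfl rfl (by simpa using hr)
  have hself : ∀ p, baseDist Ω δ p p = 0 := fun p =>
    eq_of_forall_lt_iff_lt fun r => by
      rw [hlt]
      exact ⟨fun ⟨_, _, _, _, _, hr⟩ => bot_le.trans_lt hr, hrefl _ (hmemU p) r⟩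
  have hsymm : ∀ p q, baseDist Ω δ p q = baseDist Ω δ q p := fun p q =>
    eq_of_forall_lt_iff_lt fun r => by
      rw [hlt, hlt]
      exact ⟨JoinedWithin.symm, JoinedWithin.symm⟩
  have htri : ∀ p q s, baseDist Ω δ p s ≤ baseDist Ω δ p q + baseDist Ω δ q s := by
    intro p q s
    refine le_of_forall_gt fun r hr => ?_
    obtain ⟨u, hu, v, hv, huv⟩ := ENNReal.exists_add_lt_of_add_lt hr
    exact ((hlt _ _ _).2 (((hlt _ _ _).1 hu).trans ((hlt _ _ _).1 hv))).trans huv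
  have hseg : ∀ V ⊆ U, Convex ℝ V → ∀ m : ℝ, 0 < m → (∀ z ∈ V, m ≤ δ' z) → ∀ p q : Ω,
      planeEquiv.symm p ∈ V → planeEquiv.symm q ∈ V →
      baseDist Ω δ p q ≤ ENNReal.ofReal (‖planeEquiv.symm q - planeEquiv.symm p‖ / m) := by
    intro V hVU hV m hm hmV p q hp hq
    refine le_of_forall_gt fun r hr => (hlt _ _ _).2 ?_
    exact joinedWithin_of_convex hVU hV hm hmV hp hq hr
  have hcont : Continuous fun p : Ω => planeEquiv.symm (p : Coord 2) :=
    planeEquiv.symm.continuous.comp continuous_subtype_val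
  have hnhds : ∀ p : Ω, ∀ V ∈ 𝓝 p, ∃ r : ℝ≥0∞, 0 < r ∧ ∀ q, baseDist Ω δ p q < r → q ∈ V := by
    intro p V hV
    rw [nhds_subtype] at hV
    obtain ⟨W, hW, hWV⟩ := hV
    obtain ⟨r, hr, hrW⟩ := exists_joinedWithin_subset hU hδ'c hpos' (hmemU p)
      (V := planeEquiv ⁻¹' W) (planeEquiv.continuous.continuousAt.preimage_mem_nhds
          (by simpa using hW))
    refine ⟨r, hr, fun q hq => hWV ?_⟩
    simpa using hrW _ ((hlt _ _ _).1 hq)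
  have hball : ∀ p : Ω, ∀ r : ℝ≥0∞, 0 < r → {q | baseDist Ω δ p q < r} ∈ 𝓝 p := by
    intro p r hr
    obtain ⟨R, hR, hRU⟩ := exists_uniform_half_le hU hδ'c hpos' isCompact_singleton
      (singleton_subset_iff.mpr (hmemU p))
    have hdp := hpos' _ (hmemU p)
    have hb : ∀ q : Ω, planeEquiv.symm q ∈ ball (planeEquiv.symm p) R → baseDist Ω δ p q ≤
        ENNReal.ofReal (‖planeEquiv.symm q - planeEquiv.symm p‖ / (δ' (planeEquiv.symm p) / 2)) :=
      fun q hq => hseg (ball (planeEquiv.symm p) R) (fun y hy => (hRU _ rfl y hy).1)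
        (convex_ball _ _) _ (by positivity) (fun y hy => (hRU _ rfl y hy).2) p q
        (mem_ball_self hR) hq
    have ht : Filter.Tendsto (fun q : Ω => ENNReal.ofReal
        (‖planeEquiv.symm q - planeEquiv.symm p‖ / (δ' (planeEquiv.symm p) / 2))) (𝓝 p) (𝓝 0) := by
      have : Continuous fun q : Ω => ENNReal.ofReal
        (‖planeEquiv.symm q - planeEquiv.symm p‖ / (δ' (planeEquiv.symm p) / 2)) :=
        ENNReal.continuous_ofReal.comp ((hcont.sub continuous_const).norm.div_const _)
      simpa using this.tendsto p
    filter_upwards [ht.eventually_lt_const hr,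
      hcont.continuousAt.preimage_mem_nhds (ball_mem_nhds _ hR)] with q h1 h2
    exact (hb q h2).trans_lt h1
  have hmid : ∀ p q, ∀ s t : ℝ≥0∞, 0 < s → 0 < t → baseDist Ω δ p q < s + t →
      ∃ z, baseDist Ω δ p z < s ∧ baseDist Ω δ z q < t := by
    intro p q s t hs ht h
    obtain ⟨z, hz, h1, h2⟩ := ((hlt _ _ _).1 h).exists_between hδ'c hpos' hs ht
    refine ⟨⟨planeEquiv z, hz⟩, (hlt _ _ _).2 (by simpa using h1), (hlt _ _ _).2
        (by simpa using h2)⟩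
  have : LocallyCompactSpace Ω := hΩ.locallyCompactSpace
  have hHR := exists_isCompact_of_completeFor hself hsymm htri hnhds hball hmid hcomplete ⟨0, h0⟩
  -- The segment from the origin lies in the star-shaped domain and has finite length, since `δ` is
  -- bounded below on it.
  have hfin : ∀ p : Ω, baseDist Ω δ ⟨0, h0⟩ p ≠ ⊤ := by
    intro p
    have hsub : segment ℝ 0 (planeEquiv.symm p) ⊆ U := hsU.segment_subset (hmemU p)
    have hcpt : IsCompact (segment ℝ 0 (planeEquiv.symm (p : Coord 2))) := by
      rw [segment_eq_image_lineMap]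
      exact isCompact_Icc.image AffineMap.lineMap_continuous
    obtain ⟨z, hz, hmin⟩ := hcpt.exists_isMinOn ⟨0, left_mem_segment _ _ _⟩ (hδ'c.mono hsub)
    refine ne_top_of_le_ne_top ENNReal.ofReal_ne_top (hseg _ hsub (convex_segment _ _) (δ' z)
      (hpos' z (hsub hz)) (fun y hy => hmin hy) _ p ?_ (right_mem_segment _ _ _))
    simpa using left_mem_segment ℝ (0 : ℂ) _
  -- The distance to the origin, as a real function. It is Lipschitz for the conformal metric, and
  -- its sublevel sets are relatively compact by Hopf-Rinow; the value off `U` is immaterial.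
  set ρ : ℂ → ℝ := fun z => if h : z ∈ U then (baseDist Ω δ ⟨0, h0⟩ ⟨planeEquiv z, h⟩).toReal else 0
    with hρ
  have hρU : ∀ z (h : z ∈ U), ρ z = (baseDist Ω δ ⟨0, h0⟩ ⟨planeEquiv z, h⟩).toReal := fun z h =>
    dif_pos h
  refine hasCutoffs_of_exhaustion hU hδ'c hpos' (ρ := ρ) ?_ ?_
  · intro V hVU hV m hm hmV
    have key : ∀ y ∈ V, ∀ z ∈ V, ρ y - ρ z ≤ ‖y - z‖ / m := by
      intro y hy z hz
      rw [hρU y (hVU hy), hρU z (hVU hz), sub_le_iff_le_add']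
      have h1 := hseg V hVU hV m hm hmV ⟨planeEquiv z, hVU hz⟩ ⟨planeEquiv y, hVU hy⟩
        (by simpa using hz) (by simpa using hy)
      simp only [ContinuousLinearEquiv.symm_apply_apply] at h1
      have h2 := (htri ⟨0, h0⟩ ⟨planeEquiv z, hVU hz⟩ ⟨planeEquiv y, hVU hy⟩).trans
        (add_le_add_right h1 _)
      have h3 := ENNReal.toReal_mono (by simp [hfin]) h2
      rwa [ENNReal.toReal_add (hfin _) ENNReal.ofReal_ne_top,
        ENNReal.toReal_ofReal (by positivity)] at h3
    intro y hy z hz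
    rw [abs_le]
    have h1 := key y hy z hz
    have h2 := key z hz y hy
    rw [norm_sub_rev] at h2
    constructor <;> linarith
  · intro R
    obtain ⟨K, hK, hKR⟩ := hHR (ENNReal.ofReal (R + 1)) ENNReal.ofReal_ne_top
    refine ⟨(fun p : Ω => planeEquiv.symm (p : Coord 2)) '' K, ?_, hK.image hcont, ?_⟩
    · rintro _ ⟨p, -, rfl⟩
      exact hmemU p
    · intro z hz hzR
      refine ⟨⟨planeEquiv z, hz⟩, hKR _ ?_, by simp⟩
      rw [hρU z hz] at hzR
      rw [ENNReal.lt_ofReal_iff_toReal_lt (hfin _)]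
      linarith

/-! ### Partial derivatives and the curvature of a conformal metric -/

theorem pd_congr {n : ℕ} {f g : Coord n → ℝ} {p : Coord n} (h : f =ᶠ[𝓝 p] g) (i : Fin n) :
    pd i f p = pd i g p := by rw [pd, pd, h.fderiv_eq]

theorem pd_eq_of_hasFDerivAt {n : ℕ} {f : Coord n → ℝ} {f' : Coord n →L[ℝ] ℝ} {p : Coord n}
    (h : HasFDerivAt f f' p) (i : Fin n) : pd i f p = f' (Pi.single i 1) := by
  rw [pd, h.fderiv]

@[simp] theorem pd_const {n : ℕ} (i : Fin n) (c : ℝ) (p : Coord n) : pd i (fun _ => c) p = 0 := by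
  simp [pd]

theorem pd_add {n : ℕ} {f g : Coord n → ℝ} {p : Coord n} (hf : DifferentiableAt ℝ f p)
    (hg : DifferentiableAt ℝ g p) (i : Fin n) :
    pd i (fun q => f q + g q) p = pd i f p + pd i g p :=
  pd_eq_of_hasFDerivAt (hf.hasFDerivAt.add hg.hasFDerivAt) i

theorem pd_sub {n : ℕ} {f g : Coord n → ℝ} {p : Coord n} (hf : DifferentiableAt ℝ f p)
    (hg : DifferentiableAt ℝ g p) (i : Fin n) :
    pd i (fun q => f q - g q) p = pd i f p - pd i g p :=
  pd_eq_of_hasFDerivAt (hf.hasFDerivAt.sub hg.hasFDerivAt) i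

theorem pd_neg {n : ℕ} (f : Coord n → ℝ) (p : Coord n) (i : Fin n) :
    pd i (fun q => -f q) p = -pd i f p := by
  simp [pd, fderiv_fun_neg]

theorem pd_mul {n : ℕ} {f g : Coord n → ℝ} {p : Coord n} (hf : DifferentiableAt ℝ f p)
    (hg : DifferentiableAt ℝ g p) (i : Fin n) :
    pd i (fun q => f q * g q) p = f p * pd i g p + pd i f p * g p := by
  have h := pd_eq_of_hasFDerivAt (f := fun q => f q * g q)
    (hf.hasFDerivAt.mul hg.hasFDerivAt) i
  rw [h]
  simp [pd, mul_comm]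

theorem pd_comp {n : ℕ} {f : Coord n → ℝ} {p : Coord n} {φ : ℝ → ℝ} {φ' : ℝ}
    (hφ : HasDerivAt φ φ' (f p)) (hf : DifferentiableAt ℝ f p) (i : Fin n) :
    pd i (fun q => φ (f q)) p = φ' * pd i f p := by
  have h := pd_eq_of_hasFDerivAt (f := fun q => φ (f q))
    (hφ.comp_hasFDerivAt p hf.hasFDerivAt) i
  rw [h]
  simp [pd]

theorem pd_div {n : ℕ} {f g : Coord n → ℝ} {p : Coord n} (hf : DifferentiableAt ℝ f p)
    (hg : DifferentiableAt ℝ g p) (h0 : g p ≠ 0) (i : Fin n) :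
    pd i (fun q => f q / g q) p = (pd i f p * g p - f p * pd i g p) / g p ^ 2 := by
  have h1 : pd i (fun q => (g q)⁻¹) p = -(g p ^ 2)⁻¹ * pd i g p :=
    pd_comp (hasDerivAt_inv h0) hg i
  have h2 := pd_mul (g := fun q => (g q)⁻¹) hf (hg.inv h0) i
  simp only [div_eq_mul_inv]
  rw [h2, h1]
  field_simp
  ring

theorem pd_coord {n : ℕ} (i j : Fin n) (p : Coord n) :
    pd i (fun q => q j) p = if i = j then 1 else 0 := by
  rw [pd_eq_of_hasFDerivAt (hasFDerivAt_apply j p) i]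
  simp [Pi.single_apply, eq_comm]

theorem contDiffOn_pd {n : ℕ} {Ω : Set (Coord n)} (hΩ : IsOpen Ω) {f : Coord n → ℝ} {k m : ℕ∞ω}
    (hf : ContDiffOn ℝ k f Ω) (hm : m + 1 ≤ k) (i : Fin n) : ContDiffOn ℝ m (pd i f) Ω :=
  (hf.fderiv_of_isOpen hΩ hm).clm_apply contDiffOn_const

theorem pd_comm {n : ℕ} {Ω : Set (Coord n)} (hΩ : IsOpen Ω) {f : Coord n → ℝ}
    (hf : ContDiffOn ℝ 2 f Ω) {p : Coord n} (hp : p ∈ Ω) (i j : Fin n) :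
    pd i (pd j f) p = pd j (pd i f) p := by
  have hf2 := hf.contDiffAt (hΩ.mem_nhds hp)
  have hsymm : IsSymmSndFDerivAt ℝ f p := hf2.isSymmSndFDerivAt (by simp)
  have hd : DifferentiableAt ℝ (fderiv ℝ f) p :=
    (hf2.fderiv_right (m := 1) (by norm_num)).differentiableAt (by simp)
  have key : ∀ i j, pd i (pd j f) p = fderiv ℝ (fderiv ℝ f) p (Pi.single i 1) (Pi.single j 1) := by
    intro i j
    have h := hd.hasFDerivAt.clm_apply (hasFDerivAt_const (Pi.single j (1 : ℝ) : Coord n) p)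
    rw [show pd j f = fun q => fderiv ℝ f q (Pi.single j 1) from rfl, pd_eq_of_hasFDerivAt h]
    simp
  rw [key, key]
  exact hsymm _ _

theorem pd_one_div_sq {n : ℕ} {δ : Coord n → ℝ} {p : Coord n} (hδ : DifferentiableAt ℝ δ p)
    (hp : 0 < δ p) (i : Fin n) :
    pd i (fun q => 1 / δ q ^ 2) p = -(2 / δ p ^ 2) * pd i (fun q => Real.log (δ q)) p := by
  rw [pd_comp (Real.hasDerivAt_log hp.ne') hδ i,
    pd_comp (φ := fun x => 1 / x ^ 2) (φ' := -(2 / δ p ^ 3)) ?_ hδ i]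
  · field_simp
  · have h := ((hasDerivAt_pow 2 (δ p)).inv (pow_ne_zero 2 hp.ne'))
    simp only [one_div]
    refine h.congr_deriv ?_
    field_simp
    simp [mul_comm]

theorem christoffel_baseMetric {Ω : Set (Coord 2)} (hΩ : IsOpen Ω) {δ : Coord 2 → ℝ}
    (hδ : ContDiffOn ℝ ∞ δ Ω) (hpos : ∀ p ∈ Ω, 0 < δ p) {p : Coord 2} (hp : p ∈ Ω)
    (k i j : Fin 2) :
    christoffel (baseMetric δ) k i j p =
      -(pd i (fun q => Real.log (δ q)) p * (1 : Matrix (Fin 2) (Fin 2) ℝ) j k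
        + pd j (fun q => Real.log (δ q)) p * (1 : Matrix (Fin 2) (Fin 2) ℝ) i k
        - pd k (fun q => Real.log (δ q)) p * (1 : Matrix (Fin 2) (Fin 2) ℝ) i j) := by
  have hd : DifferentiableAt ℝ δ p :=
    (hδ.contDiffAt (hΩ.mem_nhds hp)).differentiableAt (by simp)
  have h0 := hpos p hp
  have hd2 : DifferentiableAt ℝ (fun q => 1 / δ q ^ 2) p := by
    simp only [one_div]
    exact (hd.fun_pow 2).fun_inv (pow_ne_zero 2 h0.ne')
  have hg : ∀ i a b : Fin 2, pd i (fun q => baseMetric δ q a b) p =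
      -(2 / δ p ^ 2) * pd i (fun q => Real.log (δ q)) p * (1 : Matrix (Fin 2) (Fin 2) ℝ) a b := by
    intro i a b
    simp only [baseMetric, Matrix.smul_apply, smul_eq_mul]
    rw [pd_mul hd2 (differentiableAt_const _), pd_const, pd_one_div_sq hd h0]
    ring
  have hinv : (baseMetric δ p)⁻¹ = (δ p ^ 2) • (1 : Matrix (Fin 2) (Fin 2) ℝ) := by
    refine Matrix.inv_eq_left_inv ?_
    simp only [baseMetric, Matrix.smul_mul, Matrix.mul_smul, Matrix.one_mul, smul_smul]
    rw [one_div_mul_cancel (pow_ne_zero 2 h0.ne'), one_smul]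
  rw [christoffel, hinv, Finset.sum_eq_single k]
  · simp only [hg, Matrix.smul_apply, smul_eq_mul, Matrix.one_apply_eq]
    generalize (1 : Matrix (Fin 2) (Fin 2) ℝ) j k = x
    generalize (1 : Matrix (Fin 2) (Fin 2) ℝ) i k = y
    generalize (1 : Matrix (Fin 2) (Fin 2) ℝ) i j = z
    field_simp
    ring
  · intro l _ hl
    simp [Matrix.one_apply_ne hl.symm]
  · simp

theorem gaussCurvature_baseMetric {Ω : Set (Coord 2)} (hΩ : IsOpen Ω) {δ : Coord 2 → ℝ}
    (hδ : ContDiffOn ℝ ∞ δ Ω) (hpos : ∀ p ∈ Ω, 0 < δ p) {p : Coord 2} (hp : p ∈ Ω) :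
    gaussCurvature (baseMetric δ) p = δ p ^ 2 *
      (pd 0 (pd 0 fun q => Real.log (δ q)) p + pd 1 (pd 1 fun q => Real.log (δ q)) p) := by
  have hch := fun k i j => christoffel_baseMetric hΩ hδ hpos hp k i j
  have hpd : ∀ l k i j, pd l (christoffel (baseMetric δ) k i j) p = pd l (fun q =>
      -(pd i (fun q => Real.log (δ q)) q * (1 : Matrix (Fin 2) (Fin 2) ℝ) j k
        + pd j (fun q => Real.log (δ q)) q * (1 : Matrix (Fin 2) (Fin 2) ℝ) i k
        - pd k (fun q => Real.log (δ q)) q * (1 : Matrix (Fin 2) (Fin 2) ℝ) i j)) p := by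
    intro l k i j
    refine pd_congr ?_ l
    filter_upwards [hΩ.mem_nhds hp] with q hq
    exact christoffel_baseMetric hΩ hδ hpos hq k i j
  have h0 := hpos p hp
  simp only [gaussCurvature, riemann, Fin.sum_univ_two, hpd, hch, baseMetric]
  simp [pd_neg]
  field_simp
  ring

/-! ### The obstruction in coordinates -/

/-- The vector field on `ℂ` with the given components. -/
noncomputable def complexField (Yx Yy : Coord 2 → ℝ) (z : ℂ) : ℂ :=
  planeEquiv.symm ![Yx (planeEquiv z), Yy (planeEquiv z)]

@[simp] theorem complexField_re (Yx Yy : Coord 2 → ℝ) (z : ℂ) :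
    (complexField Yx Yy z).re = Yx (planeEquiv z) := by simp [complexField]

@[simp] theorem complexField_im (Yx Yy : Coord 2 → ℝ) (z : ℂ) :
    (complexField Yx Yy z).im = Yy (planeEquiv z) := by simp [complexField]

theorem contDiffOn_complexField {Ω : Set (Coord 2)} {Yx Yy : Coord 2 → ℝ}
    (hx : ContDiffOn ℝ 1 Yx Ω) (hy : ContDiffOn ℝ 1 Yy Ω) :
    ContDiffOn ℝ 1 (complexField Yx Yy) (planeEquiv ⁻¹' Ω) := by
  refine planeEquiv.symm.contDiff.comp_contDiffOn (contDiffOn_pi.2 fun i => ?_)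
  fin_cases i
  · exact hx.comp planeEquiv.contDiff.contDiffOn fun z hz => hz
  · exact hy.comp planeEquiv.contDiff.contDiffOn fun z hz => hz

theorem planeDiv_complexField {Yx Yy : Coord 2 → ℝ} {z : ℂ}
    (hx : DifferentiableAt ℝ Yx (planeEquiv z)) (hy : DifferentiableAt ℝ Yy (planeEquiv z)) :
    planeDiv (complexField Yx Yy) z = pd 0 Yx (planeEquiv z) + pd 1 Yy (planeEquiv z) := by
  have h1 := hx.hasFDerivAt.comp z planeEquiv.hasFDerivAt
  have h2 := hy.hasFDerivAt.comp z planeEquiv.hasFDerivAt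
  have hd : DifferentiableAt ℝ (complexField Yx Yy) z := by
    refine planeEquiv.symm.differentiableAt.comp z (differentiableAt_pi.2 fun i => ?_)
    fin_cases i
    · exact h1.differentiableAt
    · exact h2.differentiableAt
  have e1 := (Complex.reCLM.hasFDerivAt.comp z hd.hasFDerivAt).congr_of_eventuallyEq
    (f₁ := Yx ∘ planeEquiv) (Filter.Eventually.of_forall fun w => by simp)
  have e2 := (Complex.imCLM.hasFDerivAt.comp z hd.hasFDerivAt).congr_of_eventuallyEq
    (f₁ := Yy ∘ planeEquiv) (Filter.Eventually.of_forall fun w => by simp)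
  have f1 := congrArg (fun L => L 1) (e1.unique h1)
  have f2 := congrArg (fun L => L Complex.I) (e2.unique h2)
  simp only [ContinuousLinearMap.comp_apply, Complex.reCLM_apply, Complex.imCLM_apply,
    ContinuousLinearEquiv.coe_coe, planeEquiv_one, planeEquiv_I] at f1 f2
  rw [planeDiv, f1, f2, pd, pd]

theorem hasFDerivAt_comp_planeEquiv {f : Coord 2 → ℝ} {z : ℂ}
    (hf : DifferentiableAt ℝ f (planeEquiv z)) :
    HasFDerivAt (fun z => f (planeEquiv z)) (planeInner (complexField (pd 0 f) (pd 1 f) z)) z := by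
  refine (hf.hasFDerivAt.comp z planeEquiv.hasFDerivAt).congr_fderiv ?_
  ext v
  have hv : planeEquiv v = v.re • Pi.single 0 1 + v.im • Pi.single 1 1 := by
    ext i; fin_cases i <;> simp
  rw [planeInner_apply]
  simp only [ContinuousLinearMap.comp_apply, ContinuousLinearEquiv.coe_coe, hv, map_add, map_smul,
    Complex.mul_re, Complex.conj_re, Complex.conj_im, complexField_re, complexField_im, pd,
    smul_eq_mul]
  ring

theorem not_exists_field {Ω : Set (Coord 2)} (hΩ : IsOpen Ω) (h0 : (0 : Coord 2) ∈ Ω)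
    (hs : StarConvex ℝ 0 Ω) {δ : Coord 2 → ℝ} (hδ : ContDiffOn ℝ ∞ δ Ω) (hpos : ∀ p ∈ Ω, 0 < δ p)
    (hcomplete : BaseComplete Ω δ) {c : ℝ}
    (hc : ∀ p ∈ Ω, c ≤ gaussCurvature (baseMetric δ) p) {h : ℝ}
    (hh : (1 / 2) * √(-c) < h) {Yx Yy : Coord 2 → ℝ} (hx : ContDiffOn ℝ 1 Yx Ω)
    (hy : ContDiffOn ℝ 1 Yy Ω) (hY : ∀ p ∈ Ω, Yx p ^ 2 + Yy p ^ 2 ≤ 1 / δ p ^ 2)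
    (hdiv : ∀ p ∈ Ω, 2 * h / δ p ^ 2 ≤ pd 0 Yx p + pd 1 Yy p) : False := by
  -- Strictly between `√(-c)` and `2h`, hence positive even if `c = 0`; this is needed to divide by
  -- `a` in the comparison with the hyperbolic disc.
  set a := (√(-c) + 2 * h) / 2 with ha
  have hsq := Real.sqrt_nonneg (-c)
  have ha0 : 0 < a := by linarith
  have hac : -a ^ 2 ≤ c := by
    have h1 : √(-c) ≤ a := by linarith
    have := (Real.sqrt_le_left ha0.le).mp h1
    linarith
  have hlog : ContDiffOn ℝ ∞ (fun q => Real.log (δ q)) Ω := hδ.log fun p hp => (hpos p hp).ne'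
  have hl : ∀ i, ContDiffOn ℝ 1 (pd i fun q => Real.log (δ q)) Ω := fun i =>
    contDiffOn_pd hΩ hlog (by norm_cast) i
  have hdiff : ∀ {f : Coord 2 → ℝ}, ContDiffOn ℝ 1 f Ω → ∀ p ∈ Ω, DifferentiableAt ℝ f p :=
    fun hf p hp => (hf.contDiffAt (hΩ.mem_nhds hp)).differentiableAt (by simp)
  refine not_field_of_curvature_bound (U := planeEquiv ⁻¹' Ω) (hΩ.preimage planeEquiv.continuous)
    (by simpa using h0) (starConvex_preimage_planeEquiv hs) (contDiffOn_complexField hx hy)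
    (δ := δ ∘ planeEquiv) (hδ.continuousOn.comp planeEquiv.continuous.continuousOn fun z hz => hz)
    (fun z hz => hpos _ hz) (hasCutoffs_of_baseComplete hΩ h0 hs hδ.continuousOn hpos hcomplete)
    (contDiffOn_complexField (hl 0) (hl 1)) (fun z hz => hasFDerivAt_comp_planeEquiv
      (hdiff (hlog.of_le (by norm_cast)) _ hz)) ha0 (fun z hz => ?_) (h := h) (by linarith)
    (fun z hz => ?_) (fun z hz => ?_)
  · have hz : planeEquiv z ∈ Ω := hz
    have hd := hpos _ hz
    rw [planeDiv_complexField (hdiff (hl 0) _ hz) (hdiff (hl 1) _ hz), Function.comp_apply,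
      div_le_iff₀ (by positivity)]
    have := hc _ hz
    rw [gaussCurvature_baseMetric hΩ hδ hpos hz] at this
    linarith
  · have hz : planeEquiv z ∈ Ω := hz
    have hd := hpos _ hz
    refine abs_le_of_sq_le_sq' ?_ (by simpa using hd.le) |>.2
    have := hY _ hz
    rw [Complex.sq_norm, Complex.normSq_apply, complexField_re, complexField_im]
    simp only [Function.comp_apply, div_pow, one_pow]
    linarith
  · have hz : planeEquiv z ∈ Ω := hz
    rw [planeDiv_complexField (hdiff hx _ hz) (hdiff hy _ hz)]
    exact hdiv _ hz

/-- A function `H` bounded away from zero by more than half the square root of the curvature bound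
is not the half-divergence of a field of length at most one. -/
theorem not_exists_field_of_lt_iInf {Ω : Set (Coord 2)} (hΩ : IsOpen Ω) (h0 : (0 : Coord 2) ∈ Ω)
    (hs : StarConvex ℝ 0 Ω) {δ : Coord 2 → ℝ} (hδ : ContDiffOn ℝ ∞ δ Ω) (hpos : ∀ p ∈ Ω, 0 < δ p)
    (hcomplete : BaseComplete Ω δ) {c : ℝ}
    (hc : ∀ p ∈ Ω, c ≤ gaussCurvature (baseMetric δ) p) {H : Coord 2 → ℝ}
    (hH : ContinuousOn H Ω) (hlt : (1 / 2) * √(-c) < ⨅ p : Ω, |H p|) {Yx Yy : Coord 2 → ℝ}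
    (hx : ContDiffOn ℝ 1 Yx Ω) (hy : ContDiffOn ℝ 1 Yy Ω)
    (hY : ∀ p ∈ Ω, Yx p ^ 2 + Yy p ^ 2 ≤ 1 / δ p ^ 2)
    (hdiv : ∀ p ∈ Ω, pd 0 Yx p + pd 1 Yy p = 2 * H p / δ p ^ 2) : False := by
  set h := ⨅ p : Ω, |H p| with hh
  have hle : ∀ p ∈ Ω, h ≤ |H p| := fun p hp =>
    ciInf_le ⟨0, by rintro _ ⟨q, rfl⟩; exact abs_nonneg _⟩ (⟨p, hp⟩ : Ω)
  have h0' : 0 < h := by linarith [Real.sqrt_nonneg (-c)]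
  have hpre : IsPreconnected Ω := (hs.isPathConnected h0).isConnected.isPreconnected
  have hne : ∀ p ∈ Ω, H p ≠ 0 := fun p hp h1 => by
    have := hle p hp
    rw [h1, abs_zero] at this
    linarith
  -- A continuous nonvanishing function on a connected set has a sign. In the negative case the
  -- field is replaced by its opposite.
  have hsign : (∀ p ∈ Ω, 0 < H p) ∨ ∀ p ∈ Ω, H p < 0 := by
    by_contra hcon
    push Not at hcon
    obtain ⟨⟨p, hp, hp'⟩, q, hq, hq'⟩ := hcon
    obtain ⟨w, hw, hw0⟩ := hpre.intermediate_value hp hq hH ⟨hp', hq'⟩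
    exact hne w hw hw0
  rcases hsign with hsign | hsign
  · refine not_exists_field hΩ h0 hs hδ hpos hcomplete hc hlt hx hy hY fun p hp => ?_
    rw [hdiv p hp]
    have := hle p hp
    rw [abs_of_pos (hsign p hp)] at this
    gcongr
  · refine not_exists_field hΩ h0 hs hδ hpos hcomplete hc hlt hx.neg hy.neg (fun p hp => ?_)
      fun p hp => ?_
    · simpa using hY p hp
    · have := hle p hp
      rw [abs_of_neg (hsign p hp)] at this
      have e := hdiv p hp
      have e0 : pd 0 (fun q => -Yx q) p = -pd 0 Yx p := pd_neg Yx p 0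
      have e1 : pd 1 (fun q => -Yy q) p = -pd 1 Yy p := pd_neg Yy p 1
      rw [e0, e1, ← neg_add, e, ← neg_div]
      gcongr
      linarith

/-! ### Radial averages and the Calabi potential -/

section RadialAverage

variable {E : Type*} [NormedAddCommGroup E] [NormedSpace ℝ E]

theorem smul_mem_of_starConvex {Ω : Set E} (hs : StarConvex ℝ 0 Ω) {p : E} (hp : p ∈ Ω) {t : ℝ}
    (ht : t ∈ Icc (0 : ℝ) 1) : t • p ∈ Ω :=
  hs.smul_mem hp ht.1 ht.2

theorem exists_bound_fderiv_smul [ProperSpace E] {Ω : Set E} (hΩ : IsOpen Ω)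
    (hs : StarConvex ℝ 0 Ω) {f : E → ℝ}
    (hf : ContDiffOn ℝ 1 f Ω) {p : E} (hp : p ∈ Ω) :
    ∃ s ∈ 𝓝 p, s ⊆ Ω ∧ ∃ B : ℝ, ∀ t ∈ Icc (0 : ℝ) 1, ∀ x ∈ s,
      ‖t • t • fderiv ℝ f (t • x)‖ ≤ B := by
  obtain ⟨r, hr, hrΩ⟩ := Metric.nhds_basis_closedBall.mem_iff.mp (hΩ.mem_nhds hp)
  refine ⟨closedBall p r, closedBall_mem_nhds p hr, hrΩ, ?_⟩
  have hc : ContinuousOn (fun q : ℝ × E => q.1 • q.1 • fderiv ℝ f (q.1 • q.2))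
      (Icc (0 : ℝ) 1 ×ˢ closedBall p r) := by
    refine continuousOn_fst.smul (continuousOn_fst.smul ?_)
    exact (hf.continuousOn_fderiv_of_isOpen hΩ le_rfl).comp
      (continuousOn_fst.smul continuousOn_snd)
      fun q hq => smul_mem_of_starConvex hs (hrΩ hq.2) hq.1
  obtain ⟨B, hB⟩ := (isCompact_Icc.prod (isCompact_closedBall p r)).exists_bound_of_continuousOn hc
  exact ⟨B, fun t ht x hx => hB (t, x) ⟨ht, hx⟩⟩

theorem continuousOn_smul_fderiv {Ω : Set E} (hΩ : IsOpen Ω) (hs : StarConvex ℝ 0 Ω) {f : E → ℝ}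
    (hf : ContDiffOn ℝ 1 f Ω) {p : E} (hp : p ∈ Ω) :
    ContinuousOn (fun t : ℝ => t • t • fderiv ℝ f (t • p)) (Icc 0 1) :=
  continuousOn_id.smul (continuousOn_id.smul ((hf.continuousOn_fderiv_of_isOpen hΩ le_rfl).comp
    (continuousOn_id.smul continuousOn_const) fun _ ht => smul_mem_of_starConvex hs hp ht))

theorem continuousOn_radial {Ω : Set E} (hs : StarConvex ℝ 0 Ω) {f : E → ℝ}
    (hf : ContinuousOn f Ω) {p : E} (hp : p ∈ Ω) :
    ContinuousOn (fun t : ℝ => t * f (t • p)) (Icc 0 1) :=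
  continuousOn_id.mul (hf.comp (continuousOn_id.smul continuousOn_const)
    fun _ ht => smul_mem_of_starConvex hs hp ht)

theorem hasFDerivAt_radial {Ω : Set E} (hΩ : IsOpen Ω) {f : E → ℝ} (hf : ContDiffOn ℝ 1 f Ω)
    {p : E} {t : ℝ} (ht : t • p ∈ Ω) :
    HasFDerivAt (fun x => t * f (t • x)) (t • t • fderiv ℝ f (t • p)) p := by
  have h1 := ((hf.contDiffAt (hΩ.mem_nhds ht)).differentiableAt (by simp)).hasFDerivAt
  have h2 := (h1.comp p ((hasFDerivAt_id p).const_smul t)).const_mul t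
  refine h2.congr_fderiv ?_
  ext v
  simp

theorem aestronglyMeasurable_uIoc {F : Type*} [NormedAddCommGroup F] {g : ℝ → F}
    (hg : ContinuousOn g (Icc 0 1)) : AEStronglyMeasurable g (volume.restrict (uIoc 0 1)) := by
  rw [uIoc_of_le zero_le_one]
  exact hg.aestronglyMeasurable_of_subset_isCompact isCompact_Icc measurableSet_Ioc
    Ioc_subset_Icc_self

theorem hasFDerivAt_integral_radial [ProperSpace E] {Ω : Set E} (hΩ : IsOpen Ω)
    (hs : StarConvex ℝ 0 Ω) {f : E → ℝ} (hf : ContDiffOn ℝ 1 f Ω) {p : E} (hp : p ∈ Ω) :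
    HasFDerivAt (fun x => ∫ t in (0 : ℝ)..1, t * f (t • x))
      (∫ t in (0 : ℝ)..1, t • t • fderiv ℝ f (t • p)) p := by
  obtain ⟨s, hsp, hsΩ, B, hB⟩ := exists_bound_fderiv_smul hΩ hs hf hp
  have hI : ∀ {t : ℝ}, t ∈ uIoc (0 : ℝ) 1 → t ∈ Icc (0 : ℝ) 1 := fun ht => by
    rw [uIoc_of_le zero_le_one] at ht
    exact Ioc_subset_Icc_self ht
  refine intervalIntegral.hasFDerivAt_integral_of_dominated_of_fderiv_le (bound := fun _ => B)
    (F := fun x t => t * f (t • x)) (F' := fun x t => t • t • fderiv ℝ f (t • x))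
    hsp ?_ ?_ ?_ ?_ ?_ ?_
  · filter_upwards [hΩ.mem_nhds hp] with x hx
    exact aestronglyMeasurable_uIoc (continuousOn_radial hs hf.continuousOn hx)
  · refine ContinuousOn.intervalIntegrable ?_
    rw [uIcc_of_le zero_le_one]
    exact continuousOn_radial hs hf.continuousOn hp
  · exact aestronglyMeasurable_uIoc (continuousOn_smul_fderiv hΩ hs hf hp)
  · exact ae_of_all _ fun t ht x hx => hB t (hI ht) x hx
  · exact intervalIntegrable_const
  · exact ae_of_all _ fun t ht x hx => hasFDerivAt_radial hΩ hf
      (smul_mem_of_starConvex hs (hsΩ hx) (hI ht))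

theorem contDiffOn_integral_radial [ProperSpace E] {Ω : Set E} (hΩ : IsOpen Ω)
    (hs : StarConvex ℝ 0 Ω) {f : E → ℝ} (hf : ContDiffOn ℝ 1 f Ω) :
    ContDiffOn ℝ 1 (fun x => ∫ t in (0 : ℝ)..1, t * f (t • x)) Ω := by
  have hd := fun p hp => hasFDerivAt_integral_radial hΩ hs hf (p := p) hp
  rw [show (1 : ℕ∞ω) = 0 + 1 by simp, contDiffOn_succ_iff_fderiv_of_isOpen hΩ]
  refine ⟨fun p hp => (hd p hp).differentiableAt.differentiableWithinAt, by simp, ?_⟩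
  rw [contDiffOn_zero]
  refine ContinuousOn.congr (f := fun p => ∫ t in (0 : ℝ)..1, t • t • fderiv ℝ f (t • p)) ?_
    fun p hp => (hd p hp).fderiv
  intro p hp
  refine ContinuousAt.continuousWithinAt ?_
  obtain ⟨s, hsp, hsΩ, B, hB⟩ := exists_bound_fderiv_smul hΩ hs hf hp
  have hI : ∀ {t : ℝ}, t ∈ uIoc (0 : ℝ) 1 → t ∈ Icc (0 : ℝ) 1 := fun ht => by
    rw [uIoc_of_le zero_le_one] at ht
    exact Ioc_subset_Icc_self ht
  refine intervalIntegral.continuousAt_of_dominated_interval (bound := fun _ => B) ?_ ?_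
    intervalIntegrable_const ?_
  · filter_upwards [hΩ.mem_nhds hp] with x hx
    exact aestronglyMeasurable_uIoc (continuousOn_smul_fderiv hΩ hs hf hx)
  · filter_upwards [hsp] with x hx
    exact ae_of_all _ fun t ht => hB t (hI ht) x hx
  · refine ae_of_all _ fun t ht => ?_
    have hmem := smul_mem_of_starConvex hs hp (hI ht)
    have hc : ContinuousAt (fderiv ℝ f) (t • p) :=
      (hf.continuousOn_fderiv_of_isOpen hΩ le_rfl).continuousAt (hΩ.mem_nhds hmem)
    have hc' : ContinuousAt (fun x : E => fderiv ℝ f (t • x)) p :=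
      ContinuousAt.comp (f := fun x : E => t • x) hc (continuous_const_smul t).continuousAt
    exact (hc'.const_smul t).const_smul t

/-- After differentiating under the integral sign, the integrand is the derivative of `t² f(tp)`, so
the integral over `[0, 1]` is `f p`. -/
theorem two_mul_integral_radial_add [ProperSpace E] {Ω : Set E} (hΩ : IsOpen Ω)
    (hs : StarConvex ℝ 0 Ω) {f : E → ℝ} (hf : ContDiffOn ℝ 1 f Ω) {p : E} (hp : p ∈ Ω) :
    2 * (∫ t in (0 : ℝ)..1, t * f (t • p))
      + fderiv ℝ (fun x => ∫ t in (0 : ℝ)..1, t * f (t • x)) p p = f p := by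
  have hmem : ∀ t ∈ Icc (0 : ℝ) 1, t • p ∈ Ω := fun t ht => smul_mem_of_starConvex hs hp ht
  have hi1 : IntervalIntegrable (fun t : ℝ => t * f (t • p)) volume 0 1 := by
    refine ContinuousOn.intervalIntegrable ?_
    rw [uIcc_of_le zero_le_one]
    exact continuousOn_radial hs hf.continuousOn hp
  have hi2 : IntervalIntegrable (fun t : ℝ => t • t • fderiv ℝ f (t • p)) volume 0 1 := by
    refine ContinuousOn.intervalIntegrable ?_
    rw [uIcc_of_le zero_le_one]
    exact continuousOn_smul_fderiv hΩ hs hf hp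
  have hi3 : IntervalIntegrable (fun t : ℝ => (t • t • fderiv ℝ f (t • p)) p) volume 0 1 :=
    ⟨hi2.1.apply_continuousLinearMap p, hi2.2.apply_continuousLinearMap p⟩
  rw [(hasFDerivAt_integral_radial hΩ hs hf hp).fderiv,
    ContinuousLinearMap.intervalIntegral_apply hi2, ← intervalIntegral.integral_const_mul,
    ← intervalIntegral.integral_add (hi1.const_mul 2) hi3]
  have hd : ∀ t ∈ uIcc (0 : ℝ) 1, HasDerivAt (fun t : ℝ => t ^ 2 * f (t • p))
      (2 * (t * f (t • p)) + (t • t • fderiv ℝ f (t • p)) p) t := by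
    intro t ht
    rw [uIcc_of_le zero_le_one] at ht
    have h1 := ((hf.contDiffAt (hΩ.mem_nhds (hmem t ht))).differentiableAt (by simp)).hasFDerivAt
    have h2 := h1.comp_hasDerivAt t ((hasDerivAt_id t).smul_const p)
    refine ((hasDerivAt_pow 2 t).mul h2).congr_deriv ?_
    simp
    ring
  rw [intervalIntegral.integral_eq_sub_of_hasDerivAt hd ((hi1.const_mul 2).add hi3)]
  simp

end RadialAverage

theorem contDiffOn_div_sq {Ω : Set (Coord 2)} {δ τ : Coord 2 → ℝ} (hδ : ContDiffOn ℝ ∞ δ Ω)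
    (hpos : ∀ p ∈ Ω, 0 < δ p) (hτ : ContDiffOn ℝ ∞ τ Ω) :
    ContDiffOn ℝ 1 (fun p => τ p / δ p ^ 2) Ω :=
  ((hτ.div (hδ.pow 2) fun p hp => pow_ne_zero 2 (hpos p hp).ne')).of_le (by norm_cast)

theorem contDiffOn_calabi {Ω : Set (Coord 2)} (hΩ : IsOpen Ω) (hs : StarConvex ℝ 0 Ω)
    {δ τ : Coord 2 → ℝ} (hδ : ContDiffOn ℝ ∞ δ Ω) (hpos : ∀ p ∈ Ω, 0 < δ p)
    (hτ : ContDiffOn ℝ ∞ τ Ω) : ContDiffOn ℝ 1 (calabi δ τ) Ω :=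
  contDiffOn_const.mul (contDiffOn_integral_radial hΩ hs (contDiffOn_div_sq hδ hpos hτ))

/-- The Euler-type identity for the Calabi potential. -/
theorem calabi_identity {Ω : Set (Coord 2)} (hΩ : IsOpen Ω) (hs : StarConvex ℝ 0 Ω)
    {δ τ : Coord 2 → ℝ} (hδ : ContDiffOn ℝ ∞ δ Ω) (hpos : ∀ p ∈ Ω, 0 < δ p)
    (hτ : ContDiffOn ℝ ∞ τ Ω) {p : Coord 2} (hp : p ∈ Ω) :
    2 * calabi δ τ p + p 0 * pd 0 (calabi δ τ) p + p 1 * pd 1 (calabi δ τ) p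
      = 2 * τ p / δ p ^ 2 := by
  have hf := contDiffOn_div_sq hδ hpos hτ
  have h1 := two_mul_integral_radial_add hΩ hs hf hp
  have h2 := (hasFDerivAt_integral_radial hΩ hs hf hp).differentiableAt
  have h3 : ∀ i, pd i (calabi δ τ) p = 2 * fderiv ℝ (fun x : Coord 2 =>
      ∫ t in (0 : ℝ)..1, t * (τ (t • x) / δ (t • x) ^ 2)) p (Pi.single i 1) := fun i =>
    (pd_eq_of_hasFDerivAt (h2.hasFDerivAt.const_mul 2) i)
  have h4 : p = p 0 • Pi.single 0 1 + p 1 • Pi.single 1 1 := by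
    ext i; fin_cases i <;> simp
  have h5 := congrArg (fderiv ℝ (fun x : Coord 2 =>
      ∫ t in (0 : ℝ)..1, t * (τ (t • x) / δ (t • x) ^ 2)) p) h4
  rw [map_add, map_smul, map_smul, smul_eq_mul, smul_eq_mul] at h5
  rw [h3, h3, calabi]
  rw [h5] at h1
  linear_combination 2 * h1

/-! ### Divergence form of the mean curvature of a graph in `𝔼³(M, τ)` -/

theorem sum_christoffel_mul {n : ℕ} {g : MetricField n} {p : Coord n} (hsymm : (g p).IsSymm)
    (hdet : (g p).det ≠ 0) (N : Coord n) (i j : Fin n) :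
    ∑ k, christoffel g k i j p * (g p *ᵥ N) k = (1 / 2) * ∑ l, N l *
      (pd i (fun q => g q j l) p + pd j (fun q => g q i l) p - pd l (fun q => g q i j) p) := by
  have hN : (g p *ᵥ N) ᵥ* (g p)⁻¹ = N := by
    rw [← Matrix.vecMul_transpose, hsymm.eq, Matrix.vecMul_vecMul,
      Matrix.mul_nonsing_inv _ (isUnit_iff_ne_zero.mpr hdet), Matrix.vecMul_one]
  have hNl : ∀ l, N l = ∑ k, (g p *ᵥ N) k * (g p)⁻¹ k l := fun l => (congrFun hN l).symm
  simp only [christoffel]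
  simp_rw [mul_assoc, ← Finset.mul_sum, Finset.sum_mul]
  rw [Finset.sum_comm]
  congr 1
  refine Finset.sum_congr rfl fun l _ => ?_
  conv_rhs => rw [hNl l, Finset.sum_mul]
  refine Finset.sum_congr rfl fun k _ => ?_
  ring

/-- Pairing with `N` lowers the index of the Christoffel symbols and so cancels the inverse metric.
Only first derivatives of the metric coefficients remain, which keeps the later computation
polynomial in them. -/
theorem secondForm_apply {g : MetricField 3} {X : Coord 2 → Coord 3} {p : Coord 2}
    (hsymm : (g (X p)).IsSymm) (hdet : (g (X p)).det ≠ 0) (N : Coord 3) (a b : Fin 2) :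
    secondForm g X N p a b =
      ∑ k, pd a (fun q => tangentVec X b q k) p * (g (X p) *ᵥ N) k
      + (1 / 2) * ∑ i, ∑ j, tangentVec X a p i * tangentVec X b p j * ∑ l, N l *
        (pd i (fun q => g q j l) (X p) + pd j (fun q => g q i l) (X p)
          - pd l (fun q => g q i j) (X p)) := by
  have h := sum_christoffel_mul hsymm hdet N
  simp only [secondForm, Matrix.of_apply, metricInner, covDeriv, dotProduct, add_mul,
    Finset.sum_add_distrib]
  congr 1
  have h2 : ∀ i j, (1 / 2) * (tangentVec X a p i * tangentVec X b p j * ∑ l, N l *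
        (pd i (fun q => g q j l) (X p) + pd j (fun q => g q i l) (X p)
          - pd l (fun q => g q i j) (X p))) = ∑ k, tangentVec X a p i * tangentVec X b p j *
          (christoffel g k i j (X p) * (g (X p) *ᵥ N) k) := by
    intro i j
    rw [← Finset.mul_sum, h i j]
    ring
  simp_rw [Finset.sum_mul]
  rw [Finset.mul_sum, Finset.sum_comm]
  refine Finset.sum_congr rfl fun i _ => ?_
  rw [Finset.mul_sum, Finset.sum_comm]
  refine Finset.sum_congr rfl fun j _ => ?_
  rw [h2]
  refine Finset.sum_congr rfl fun k _ => ?_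
  ring

/-- The projection `proj` as a continuous linear map. -/
noncomputable def projCLM : Coord 3 →L[ℝ] Coord 2 :=
  ContinuousLinearMap.pi ![ContinuousLinearMap.proj 0, ContinuousLinearMap.proj 1]

theorem projCLM_apply (q : Coord 3) : projCLM q = proj q := by
  ext i; fin_cases i <;> rfl

theorem hasFDerivAt_proj (q : Coord 3) : HasFDerivAt proj projCLM q :=
  projCLM.hasFDerivAt.congr_of_eventuallyEq
    (Filter.Eventually.of_forall fun q => (projCLM_apply q).symm)

theorem contDiff_proj {n : ℕ∞ω} : ContDiff ℝ n proj := by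
  rw [show proj = projCLM from funext fun q => (projCLM_apply q).symm]
  exact projCLM.contDiff

theorem pd_comp_proj {F : Coord 2 → ℝ} {q : Coord 3} (hF : DifferentiableAt ℝ F (proj q))
    (i : Fin 3) : pd i (fun q => F (proj q)) q = ![pd 0 F (proj q), pd 1 F (proj q), 0] i := by
  have h := pd_eq_of_hasFDerivAt (f := fun q => F (proj q))
    (hF.hasFDerivAt.comp q (hasFDerivAt_proj q)) i
  rw [h, ContinuousLinearMap.comp_apply, projCLM_apply]
  have h0 : proj (Pi.single 0 1) = Pi.single 0 1 := by ext j; fin_cases j <;> simp [proj]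
  have h1 : proj (Pi.single 1 1) = Pi.single 1 1 := by ext j; fin_cases j <;> simp [proj]
  have h2 : proj (Pi.single 2 1) = 0 := by ext j; fin_cases j <;> simp [proj]
  fin_cases i
  · simp [h0, pd]
  · simp [h1, pd]
  · simp [h2]

@[simp] theorem proj_graphMap (u : Coord 2 → ℝ) (p : Coord 2) : proj (graphMap u p) = p := by
  ext i; fin_cases i <;> rfl

theorem tangentVec_graphMap (u : Coord 2 → ℝ) (a : Fin 2) (p : Coord 2) :
    tangentVec (graphMap u) a p = ![if a = 0 then 1 else 0, if a = 1 then 1 else 0, pd a u p] := by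
  ext k
  fin_cases k
  · exact pd_coord a 0 p
  · exact pd_coord a 1 p
  · rfl

/-- The matrix of `E (dx² + dy²) + (dz + A dx + B dy)²`. -/
def sasakiMatrix (E A B : ℝ) : Matrix (Fin 3) (Fin 3) ℝ :=
  !![E + A ^ 2, A * B, A; A * B, E + B ^ 2, B; A, B, 1]

theorem metricE_eq (δ τ : Coord 2 → ℝ) (q : Coord 3) :
    metricE δ τ q = sasakiMatrix (1 / δ (proj q) ^ 2) (calabi δ τ (proj q) * proj q 1)
      (-(calabi δ τ (proj q) * proj q 0)) := by
  ext i j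
  fin_cases i <;> fin_cases j <;>
    simp [metricE, sasakiMatrix, horizontal, connectionForm, proj] <;> ring

theorem sasakiMatrix_isSymm (E A B : ℝ) : (sasakiMatrix E A B).IsSymm := by
  ext i j
  fin_cases i <;> fin_cases j <;> rfl

theorem det_sasakiMatrix (E A B : ℝ) : (sasakiMatrix E A B).det = E ^ 2 := by
  simp [sasakiMatrix, Matrix.det_fin_three]
  ring

theorem trace_inv_mul_fin_two (I J : Matrix (Fin 2) (Fin 2) ℝ) :
    (I⁻¹ * J).trace =
      (I 1 1 * J 0 0 - I 0 1 * J 1 0 - I 1 0 * J 0 1 + I 0 0 * J 1 1) / I.det := by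
  rw [Matrix.inv_def, Matrix.adjugate_fin_two, Ring.inverse_eq_inv']
  rw [Matrix.trace_fin_two, Matrix.mul_apply, Matrix.mul_apply, Fin.sum_univ_two,
    Fin.sum_univ_two]
  simp only [Matrix.smul_apply, Matrix.of_apply, Matrix.cons_val_zero, Matrix.cons_val_one,
    Matrix.cons_val', smul_eq_mul]
  simp
  ring

theorem differentiableAt_sasakiMatrix {E A B : Coord 2 → ℝ} {p : Coord 2}
    (hE : DifferentiableAt ℝ E p) (hA : DifferentiableAt ℝ A p) (hB : DifferentiableAt ℝ B p)
    (j l : Fin 3) : DifferentiableAt ℝ (fun x => sasakiMatrix (E x) (A x) (B x) j l) p := by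
  fin_cases j <;> fin_cases l <;> simp [sasakiMatrix] <;> fun_prop

theorem pd_sasakiMatrix {E A B : Coord 2 → ℝ} {p : Coord 2}
    (hE : DifferentiableAt ℝ E p) (hA : DifferentiableAt ℝ A p) (hB : DifferentiableAt ℝ B p)
    (i : Fin 2) (j l : Fin 3) :
    pd i (fun x => sasakiMatrix (E x) (A x) (B x) j l) p =
      !![pd i E p + 2 * A p * pd i A p, A p * pd i B p + pd i A p * B p, pd i A p;
        A p * pd i B p + pd i A p * B p, pd i E p + 2 * B p * pd i B p, pd i B p;
        pd i A p, pd i B p, 0] j l := by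
  have hsq : ∀ {F : Coord 2 → ℝ}, DifferentiableAt ℝ F p →
      pd i (fun x => E x + F x ^ 2) p = pd i E p + 2 * F p * pd i F p := by
    intro F hF
    have h := pd_add hE (hF.fun_mul hF) i
    rw [pd_mul hF hF] at h
    simp only [sq]
    rw [h]
    ring
  fin_cases j <;> fin_cases l
  · exact hsq hA
  · exact pd_mul hA hB i
  · rfl
  · exact pd_mul hA hB i
  · exact hsq hB
  · rfl
  · rfl
  · rfl
  · exact pd_const i 1 p

theorem pd_sqrt_one_add_div {E P Q : Coord 2 → ℝ} {p : Coord 2} (hE : DifferentiableAt ℝ E p)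
    (hP : DifferentiableAt ℝ P p) (hQ : DifferentiableAt ℝ Q p) (hpos : 0 < E p) (i : Fin 2) :
    DifferentiableAt ℝ (fun x => √(1 + (P x ^ 2 + Q x ^ 2) / E x)) p ∧
    pd i (fun x => √(1 + (P x ^ 2 + Q x ^ 2) / E x)) p =
      1 / (2 * √(1 + (P p ^ 2 + Q p ^ 2) / E p)) *
        (((2 * P p * pd i P p + 2 * Q p * pd i Q p) * E p - (P p ^ 2 + Q p ^ 2) * pd i E p)
          / E p ^ 2) := by
  have hne : 1 + (P p ^ 2 + Q p ^ 2) / E p ≠ 0 := by positivity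
  have hnum : DifferentiableAt ℝ (fun x => P x ^ 2 + Q x ^ 2) p :=
    (hP.fun_pow 2).fun_add (hQ.fun_pow 2)
  have hdiv : DifferentiableAt ℝ (fun x => (P x ^ 2 + Q x ^ 2) / E x) p := by
    simp only [div_eq_mul_inv]
    exact hnum.fun_mul (hE.fun_inv hpos.ne')
  have hin : DifferentiableAt ℝ (fun x => 1 + (P x ^ 2 + Q x ^ 2) / E x) p := hdiv.const_add 1
  have hsq : ∀ {F : Coord 2 → ℝ}, DifferentiableAt ℝ F p →
      pd i (fun x => F x ^ 2) p = 2 * F p * pd i F p := by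
    intro F hF
    have h := pd_mul hF hF i
    simp only [sq]
    rw [h]
    ring
  refine ⟨hin.sqrt hne, ?_⟩
  rw [pd_comp (Real.hasDerivAt_sqrt hne) hin i, pd_add (differentiableAt_const 1) hdiv i,
    pd_const, zero_add, pd_div hnum hE hpos.ne' i, pd_add (hP.fun_pow 2) (hQ.fun_pow 2) i,
    hsq hP, hsq hQ]

/-- The divergence form of the mean curvature for a Killing fibration with unit vertical field.
Orthogonality to the tangent vectors determines the horizontal part of `N` from `ν = ⟨N, ∂_z⟩`, and
normalization with the upward choice gives `ν = 1/W`. The identity is then algebraic in the first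
and second order data. -/
theorem meanCurvature_sasaki {E A B u : Coord 2 → ℝ} {p : Coord 2} (hE : DifferentiableAt ℝ E p)
    (hA : DifferentiableAt ℝ A p) (hB : DifferentiableAt ℝ B p) (hpos : 0 < E p)
    (hu0 : DifferentiableAt ℝ (pd 0 u) p) (hu1 : DifferentiableAt ℝ (pd 1 u) p)
    (huu : pd 1 (pd 0 u) p = pd 0 (pd 1 u) p) {g : MetricField 3}
    (hg : ∀ q, g q = sasakiMatrix (E (proj q)) (A (proj q)) (B (proj q))) {N : Coord 3}
    (hN : IsUpwardUnitNormal g u p N) :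
    pd 0 (fun x => (pd 0 u x + A x) /
        √(1 + ((pd 0 u x + A x) ^ 2 + (pd 1 u x + B x) ^ 2) / E x)) p
      + pd 1 (fun x => (pd 1 u x + B x) /
        √(1 + ((pd 0 u x + A x) ^ 2 + (pd 1 u x + B x) ^ 2) / E x)) p
      = 2 * E p * meanCurvature g (graphMap u) N p := by
  have hP : DifferentiableAt ℝ (fun x => pd 0 u x + A x) p := hu0.fun_add hA
  have hQ : DifferentiableAt ℝ (fun x => pd 1 u x + B x) p := hu1.fun_add hB
  obtain ⟨hWd, -⟩ := pd_sqrt_one_add_div hE hP hQ hpos 0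
  have hWi := fun i => (pd_sqrt_one_add_div hE hP hQ hpos i).2
  have hW2 : √(1 + ((pd 0 u p + A p) ^ 2 + (pd 1 u p + B p) ^ 2) / E p) ^ 2 =
      1 + ((pd 0 u p + A p) ^ 2 + (pd 1 u p + B p) ^ 2) / E p :=
    Real.sq_sqrt (by positivity)
  have hW0 : 0 < √(1 + ((pd 0 u p + A p) ^ 2 + (pd 1 u p + B p) ^ 2) / E p) :=
    Real.sqrt_pos.mpr (by positivity)
  rw [pd_div hP hWd hW0.ne', pd_div hQ hWd hW0.ne', hWi, hWi, pd_add hu0 hA, pd_add hu0 hA,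
    pd_add hu1 hB, pd_add hu1 hB, huu]
  have hgp : g (graphMap u p) = sasakiMatrix (E p) (A p) (B p) := by rw [hg, proj_graphMap]
  have hdg : ∀ i j l, pd i (fun q => g q j l) (graphMap u p) =
      ![pd 0 (fun x => sasakiMatrix (E x) (A x) (B x) j l) p,
        pd 1 (fun x => sasakiMatrix (E x) (A x) (B x) j l) p, 0] i := by
    intro i j l
    have h := pd_comp_proj (F := fun x => sasakiMatrix (E x) (A x) (B x) j l) (q := graphMap u p)
      (by rw [proj_graphMap]; exact differentiableAt_sasakiMatrix hE hA hB j l) i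
    rw [proj_graphMap] at h
    rw [← h]
    simp only [hg]
  have hII := fun a b => secondForm_apply (g := g) (X := graphMap u) (p := p)
    (by rw [hgp]; exact sasakiMatrix_isSymm _ _ _)
    (by rw [hgp, det_sasakiMatrix]; positivity) N a b
  have hDX : ∀ a b k, pd a (fun q => tangentVec (graphMap u) b q k) p =
      ![0, 0, pd a (pd b u) p] k := by
    intro a b k
    simp only [tangentVec_graphMap]
    fin_cases k
    · exact pd_const a _ p
    · exact pd_const a _ p
    · rfl
  obtain ⟨hN1, hN2, hN3⟩ := hN
  have hN10 := hN1 0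
  have hN11 := hN1 1
  simp only [metricInner, hgp, tangentVec_graphMap] at hN10 hN11 hN2 hN3
  simp [sasakiMatrix, dotProduct, Matrix.mulVec, Fin.sum_univ_three] at hN10 hN11 hN2 hN3
  have hI : ∀ a b, firstForm g (graphMap u) p a b = metricInner g (graphMap u p)
    (tangentVec (graphMap u) a p) (tangentVec (graphMap u) b p) := fun a b => rfl
  rw [meanCurvature, trace_inv_mul_fin_two, Matrix.det_fin_two]
  simp only [hII, hI, hDX, hdg, pd_sasakiMatrix hE hA hB]
  simp only [metricInner, hgp, tangentVec_graphMap]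
  simp [sasakiMatrix, dotProduct, Matrix.mulVec, Fin.sum_univ_three]
  generalize √(1 + ((pd 0 u p + A p) ^ 2 + (pd 1 u p + B p) ^ 2) / E p) = W at *
  rw [huu]
  clear hII hI hDX hdg hWi hgp hWd huu hP hQ hN1
  generalize pd 0 u p = ux, pd 1 u p = uy, pd 0 (pd 0 u) p = uxx, pd 0 (pd 1 u) p = uxy,
    pd 1 (pd 1 u) p = uyy, pd 0 E p = E0, pd 1 E p = E1, pd 0 A p = A0, pd 1 A p = A1,
    pd 0 B p = B0, pd 1 B p = B1, E p = e, A p = a, B p = b, N 0 = n0, N 1 = n1, N 2 = n2 at *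
  clear hE hA hB hu0 hu1 hg
  -- The components of the generalized gradient and the angle function are taken as variables: in
  -- these terms the connection coefficients drop out of the normal and of the determinant of the
  -- first fundamental form.
  obtain ⟨P, rfl⟩ : ∃ P, ux = P - a := ⟨ux + a, by ring⟩
  obtain ⟨Q, rfl⟩ : ∃ Q, uy = Q - b := ⟨uy + b, by ring⟩
  obtain ⟨ν, rfl⟩ : ∃ ν, n2 = ν - a * n0 - b * n1 := ⟨n2 + a * n0 + b * n1, by ring⟩
  have e0 : n0 = -(P * ν) / e := by
    field_simp
    linear_combination hN10
  have e1 : n1 = -(Q * ν) / e := by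
    field_simp
    linear_combination hN11
  have hW3 : W ^ 2 * e = e + P ^ 2 + Q ^ 2 := by
    rw [hW2]
    field_simp
    ring
  have hν : ν = W⁻¹ := by
    have h1 : 0 < ν := by nlinarith
    have h2 : (ν * W) ^ 2 = 1 := by
      have h3 : e * (n0 ^ 2 + n1 ^ 2) + ν ^ 2 = 1 := by linear_combination hN2
      rw [e0, e1] at h3
      field_simp at h3
      have h4 : e * ((ν * W) ^ 2 - 1) = 0 := by linear_combination h3 + ν ^ 2 * hW3
      have := (mul_eq_zero.mp h4).resolve_left hpos.ne'
      linarith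
    have h5 : ν * W = 1 := by
      have : 0 < ν * W := by positivity
      nlinarith
    exact eq_inv_of_mul_eq_one_left h5
  -- The area element of the graph is `W` times that of the base.
  have hdet : (e + a ^ 2 + a * (P - a) + (P - a) * (a + (P - a))) *
      (e + b ^ 2 + b * (Q - b) + (Q - b) * (b + (Q - b))) -
      (a * b + a * (Q - b) + (P - a) * (b + (Q - b))) *
      (a * b + b * (P - a) + (Q - b) * (a + (P - a))) = e ^ 2 * W ^ 2 := by
    linear_combination -e * hW3
  rw [hdet, e0, e1, hν]
  clear hN10 hN11 hN2 hN3 hdet e0 e1 hν hW2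
  field_simp
  linear_combination 2 * e * (uxx + A0 + uyy + B1) * hW3

theorem contDiffOn_one_div_sq {Ω : Set (Coord 2)} {δ : Coord 2 → ℝ} (hδ : ContDiffOn ℝ ∞ δ Ω)
    (hpos : ∀ p ∈ Ω, 0 < δ p) : ContDiffOn ℝ 1 (fun p => 1 / δ p ^ 2) Ω :=
  contDiffOn_div_sq hδ hpos contDiffOn_const

theorem contDiffOn_coord {Ω : Set (Coord 2)} (i : Fin 2) :
    ContDiffOn ℝ 1 (fun p : Coord 2 => p i) Ω :=
  (contDiff_apply ℝ ℝ i).contDiffOn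

/-- With `Y` the generalized gradient over `W`, the length bound is `(P² + Q²)/W² ≤ E`, immediate
from the definition of `W`, and the divergence is `2EH` with `E = 1/δ²`. -/
theorem not_isEntireGraphE {Ω : Set (Coord 2)} (hΩ : IsOpen Ω) (h0 : (0 : Coord 2) ∈ Ω)
    (hs : StarConvex ℝ 0 Ω) {δ : Coord 2 → ℝ} (hδ : ContDiffOn ℝ ∞ δ Ω) (hpos : ∀ p ∈ Ω, 0 < δ p)
    (hcomplete : BaseComplete Ω δ) {c : ℝ}
    (hc : ∀ p ∈ Ω, c ≤ gaussCurvature (baseMetric δ) p) {H : Coord 2 → ℝ}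
    (hH : ContinuousOn H Ω) (hlt : (1 / 2) * √(-c) < ⨅ p : Ω, |H p|) {τ : Coord 2 → ℝ}
    (hτ : ContDiffOn ℝ ∞ τ Ω) {u : Coord 2 → ℝ} : ¬ IsEntireGraphE Ω δ τ H u := by
  rintro ⟨hu, hmean⟩
  have hC := contDiffOn_calabi hΩ hs hδ hpos hτ
  have hE := contDiffOn_one_div_sq hδ hpos
  have hA : ContDiffOn ℝ 1 (fun p => calabi δ τ p * p 1) Ω := hC.mul (contDiffOn_coord 1)
  have hB : ContDiffOn ℝ 1 (fun p => -(calabi δ τ p * p 0)) Ω := (hC.mul (contDiffOn_coord 0)).neg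
  have hu' : ∀ i, ContDiffOn ℝ 1 (pd i u) Ω := fun i => contDiffOn_pd hΩ hu (by norm_num) i
  set E : Coord 2 → ℝ := fun p => 1 / δ p ^ 2 with hEdef
  set A : Coord 2 → ℝ := fun p => calabi δ τ p * p 1 with hAdef
  set B : Coord 2 → ℝ := fun p => -(calabi δ τ p * p 0) with hBdef
  have hEpos : ∀ p ∈ Ω, 0 < E p := fun p hp => by
    have := hpos p hp
    simp only [hEdef]
    positivity
  have hP : ContDiffOn ℝ 1 (fun x => pd 0 u x + A x) Ω := (hu' 0).add hA
  have hQ : ContDiffOn ℝ 1 (fun x => pd 1 u x + B x) Ω := (hu' 1).add hB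
  have hWarg : ∀ p ∈ Ω, 0 < 1 + ((pd 0 u p + A p) ^ 2 + (pd 1 u p + B p) ^ 2) / E p :=
    fun p hp => by
      have := hEpos p hp
      positivity
  have hW : ContDiffOn ℝ 1 (fun x
      => √(1 + ((pd 0 u x + A x) ^ 2 + (pd 1 u x + B x) ^ 2) / E x)) Ω :=
    (contDiffOn_const.add (((hP.pow 2).add (hQ.pow 2)).div hE fun p hp => (hEpos p hp).ne')).sqrt
      fun p hp => (hWarg p hp).ne'
  have hW0 : ∀ p ∈ Ω, √(1 + ((pd 0 u p + A p) ^ 2 + (pd 1 u p + B p) ^ 2) / E p) ≠ 0 :=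
    fun p hp => (Real.sqrt_pos.mpr (hWarg p hp)).ne'
  have hd : ∀ {f : Coord 2 → ℝ}, ContDiffOn ℝ 1 f Ω → ∀ p ∈ Ω, DifferentiableAt ℝ f p :=
    fun hf p hp => (hf.contDiffAt (hΩ.mem_nhds hp)).differentiableAt (by simp)
  refine not_exists_field_of_lt_iInf hΩ h0 hs hδ hpos hcomplete hc hH hlt
    (Yx := fun x => (pd 0 u x + A x) /
      √(1 + ((pd 0 u x + A x) ^ 2 + (pd 1 u x + B x) ^ 2) / E x))
    (Yy := fun x => (pd 1 u x + B x) /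
      √(1 + ((pd 0 u x + A x) ^ 2 + (pd 1 u x + B x) ^ 2) / E x))
    (hP.div hW hW0) (hQ.div hW hW0) (fun p hp => ?_) fun p hp => ?_
  · rw [div_pow, div_pow, Real.sq_sqrt (hWarg p hp).le, ← add_div, div_le_iff₀ (hWarg p hp)]
    have h1 := hEpos p hp
    change _ ≤ E p * _
    rw [mul_add, mul_div_cancel₀ _ h1.ne']
    linarith
  · obtain ⟨N, hN, hNH⟩ := hmean p hp
    rw [meanCurvature_sasaki (hd hE p hp) (hd hA p hp) (hd hB p hp) (hEpos p hp)
      (hd (hu' 0) p hp) (hd (hu' 1) p hp) (pd_comm hΩ hu hp 1 0) (metricE_eq δ τ) hN, hNH]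
    simp only [hEdef]
    ring

/-! ### Spacelike graphs in `𝕃³(M, τ)` -/

theorem metricInner_metricL (δ τ : Coord 2 → ℝ) (q v w : Coord 3) :
    metricInner (metricL δ τ) q v w = 1 / δ (proj q) ^ 2 * (v 0 * w 0 + v 1 * w 1)
      - (-(calabi δ τ (proj q) * q 1) * v 0 + calabi δ τ (proj q) * q 0 * v 1 + v 2)
        * (-(calabi δ τ (proj q) * q 1) * w 0 + calabi δ τ (proj q) * q 0 * w 1 + w 2) := by
  simp [metricInner, metricL, horizontal, connectionForm, dotProduct, Matrix.mulVec,
    Fin.sum_univ_three]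
  ring

/-- The field is the generalized gradient turned by a right angle. Its mixed second derivatives of
`u` cancel in the divergence, and the Euler-type identity for the Calabi potential gives `2τ/δ²`, so
`τ` plays the part of a mean curvature. -/
theorem not_isEntireSpacelikeGraph {Ω : Set (Coord 2)} (hΩ : IsOpen Ω) (h0 : (0 : Coord 2) ∈ Ω)
    (hs : StarConvex ℝ 0 Ω) {δ : Coord 2 → ℝ} (hδ : ContDiffOn ℝ ∞ δ Ω) (hpos : ∀ p ∈ Ω, 0 < δ p)
    (hcomplete : BaseComplete Ω δ) {c : ℝ}
    (hc : ∀ p ∈ Ω, c ≤ gaussCurvature (baseMetric δ) p) {τ : Coord 2 → ℝ}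
    (hτ : ContDiffOn ℝ ∞ τ Ω) (hlt : (1 / 2) * √(-c) < ⨅ p : Ω, |τ p|)
    {u : Coord 2 → ℝ} : ¬ IsEntireSpacelikeGraph Ω δ τ u := by
  rintro ⟨hu, hspace⟩
  have hC := contDiffOn_calabi hΩ hs hδ hpos hτ
  have hu' : ∀ i, ContDiffOn ℝ 1 (pd i u) Ω := fun i => contDiffOn_pd hΩ hu (by norm_num) i
  have hA : ContDiffOn ℝ 1 (fun p => calabi δ τ p * p 1) Ω := hC.mul (contDiffOn_coord 1)
  have hB : ContDiffOn ℝ 1 (fun p => calabi δ τ p * p 0) Ω := hC.mul (contDiffOn_coord 0)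
  have hd : ∀ {f : Coord 2 → ℝ}, ContDiffOn ℝ 1 f Ω → ∀ p ∈ Ω, DifferentiableAt ℝ f p :=
    fun hf p hp => (hf.contDiffAt (hΩ.mem_nhds hp)).differentiableAt (by simp)
  refine not_exists_field_of_lt_iInf hΩ h0 hs hδ hpos hcomplete hc hτ.continuousOn hlt
    ((hu' 1).add hB) (hA.sub (hu' 0)) (fun p hp => ?_) fun p hp => ?_
  · have h1 := (hspace p hp).det_pos
    have hE : 0 < 1 / δ p ^ 2 := by
      have := hpos p hp
      positivity
    rw [Matrix.det_fin_two] at h1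
    simp only [firstForm, Matrix.of_apply, metricInner_metricL, proj_graphMap,
      tangentVec_graphMap] at h1
    simp [graphMap] at h1
    simp only [one_div] at hE ⊢
    -- The determinant of the first fundamental form factors as `E (E - |Y|²)` with `E = δ⁻²`, so
    -- spacelikeness is exactly `|Y| < 1/δ`.
    have h2 : 0 < (δ p ^ 2)⁻¹ * ((δ p ^ 2)⁻¹ - ((pd 1 u p + calabi δ τ p * p 0) ^ 2
        + (calabi δ τ p * p 1 - pd 0 u p) ^ 2)) := by
      linear_combination h1
    have h3 := (mul_pos_iff_of_pos_left hE).mp h2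
    linarith
  · rw [pd_add (hd (hu' 1) p hp) (hd hB p hp), pd_sub (hd hA p hp) (hd (hu' 0) p hp),
      pd_mul (hd hC p hp) (hd (contDiffOn_coord 0) p hp),
      pd_mul (hd hC p hp) (hd (contDiffOn_coord 1) p hp), pd_coord, pd_coord, pd_comm hΩ hu hp 1 0,
      ← calabi_identity hΩ hs hδ hpos hτ hp]
    simp
    ring

/-! ### Lifting paths through a local homeomorphism -/

/-- `Γ` is a lift on `[0, T]` of the path `γ` through `f`, starting at `s₀`. -/
structure IsPathLift {S X : Type*} [TopologicalSpace S] (f : S → X) (γ : ℝ → X) (s₀ : S) (T : ℝ)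
    (Γ : ℝ → S) : Prop where
  continuousOn : ContinuousOn Γ (Icc 0 T)
  zero : Γ 0 = s₀
  lifts : ∀ t ∈ Icc 0 T, f (Γ t) = γ t

namespace IsPathLift

theorem mono {S X : Type*} [TopologicalSpace S] {f : S → X} {γ : ℝ → X} {s₀ : S} {T T' : ℝ}
    {Γ : ℝ → S} (h : IsPathLift f γ s₀ T Γ) (hT : T' ≤ T) :
    IsPathLift f γ s₀ T' Γ :=
  ⟨h.continuousOn.mono (Icc_subset_Icc_right hT), h.zero,
    fun t ht => h.lifts t (Icc_subset_Icc_right hT ht)⟩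

variable {S X : Type*} [TopologicalSpace S] [TopologicalSpace X] {f : S → X} {γ : ℝ → X} {s₀ : S}

theorem eqOn [T2Space S] (hf : IsLocalHomeomorph f) {T : ℝ} (hT : 0 ≤ T) {Γ Γ' : ℝ → S}
    (h : IsPathLift f γ s₀ T Γ) (h' : IsPathLift f γ s₀ T Γ') : EqOn Γ Γ' (Icc 0 T) :=
  (T2Space.isSeparatedMap f).eqOn_of_comp_eqOn hf.isLocallyInjective isPreconnected_Icc
    h.continuousOn h'.continuousOn (fun t ht => (h.lifts t ht).trans (h'.lifts t ht).symm)
    (left_mem_Icc.mpr hT) (h.zero.trans h'.zero.symm)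

theorem extend {τ T : ℝ} (hτ : 0 ≤ τ) (hτT : τ ≤ T) (hγ : Continuous γ) {Γ : ℝ → S}
    (h : IsPathLift f γ s₀ τ Γ) {e : OpenPartialHomeomorph S X} (he : EqOn f e e.source)
    (hs : Γ τ ∈ e.source) (ht : ∀ t ∈ Icc τ T, γ t ∈ e.target) :
    ∃ Γ', IsPathLift f γ s₀ T Γ' := by
  classical
  set Γ' : ℝ → S := fun t => if t ≤ τ then Γ t else e.symm (γ t) with hΓ'
  have h1 : ∀ t ≤ τ, Γ' t = Γ t := fun t ht => if_pos ht
  have hτe : e.symm (γ τ) = Γ τ := by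
    rw [← h.lifts τ (right_mem_Icc.mpr hτ), he hs, e.left_inv hs]
  have h2 : ∀ t, τ ≤ t → Γ' t = e.symm (γ t) := by
    intro t ht
    rcases ht.eq_or_lt with rfl | hlt
    · rw [h1 _ le_rfl, hτe]
    · exact if_neg (not_le.mpr hlt)
  refine ⟨Γ', ?_, (h1 0 hτ).trans h.zero, fun t htT => ?_⟩
  · rw [← Icc_union_Icc_eq_Icc hτ hτT]
    refine ContinuousOn.union_of_isClosed ?_ ?_ isClosed_Icc isClosed_Icc
    · exact h.continuousOn.congr fun t ht => h1 t ht.2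
    · exact (e.continuousOn_symm.comp hγ.continuousOn ht).congr fun t ht => h2 t ht.1
  · rcases le_total t τ with hle | hle
    · rw [h1 t hle]
      exact h.lifts t ⟨htT.1, hle⟩
    · have := ht t ⟨hle, htT.2⟩
      rw [h2 t hle, he (e.map_target this), e.right_inv this]

/-- A path lifts through a local homeomorphism provided that every lift on a half-open interval
has a limit point at the end. -/
theorem exists_of_limit [T2Space S] [T2Space X] (hf : IsLocalHomeomorph f) (hγ : Continuous γ)
    (h0 : f s₀ = γ 0)
    (hlim : ∀ T ∈ Ioc (0 : ℝ) 1, ∀ Γ : ℝ → S, ContinuousOn Γ (Ico 0 T) →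
      (∀ t ∈ Ico 0 T, f (Γ t) = γ t) → ∃ q : S, ∃ t : ℕ → ℝ, (∀ n, t n ∈ Ico 0 T) ∧
        Filter.Tendsto t Filter.atTop (𝓝 T) ∧ Filter.Tendsto (Γ ∘ t) Filter.atTop (𝓝 q)) :
    ∃ Γ, IsPathLift f γ s₀ 1 Γ := by
  set A : Set ℝ := {T | T ∈ Icc (0 : ℝ) 1 ∧ ∃ Γ, IsPathLift f γ s₀ T Γ} with hA
  have hA0 : (0 : ℝ) ∈ A := by
    refine ⟨by simp, fun _ => s₀, continuousOn_const, rfl, ?_⟩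
    intro t ht
    rw [Icc_self] at ht
    rw [ht, h0]
  have hbdd : BddAbove A := ⟨1, fun t ht => ht.1.2⟩
  set T := sSup A with hT
  have hT0 : 0 ≤ T := le_csSup hbdd hA0
  have hT1 : T ≤ 1 := csSup_le ⟨0, hA0⟩ fun t ht => ht.1.2
  have hlt : ∀ t ∈ Ico 0 T, ∃ Γ, IsPathLift f γ s₀ t Γ := by
    intro t ht
    obtain ⟨t', ⟨-, Γ, hΓ⟩, htt'⟩ := exists_lt_of_lt_csSup ⟨0, hA0⟩ ht.2
    exact ⟨Γ, hΓ.mono htt'.le⟩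
  -- A point over the supremal time `T` near which lifts can be brought at times near `T`. The case
  -- `T = 0` uses the initial point itself, since the limit hypothesis concerns only `T > 0`.
  have key : ∃ q : S, f q = γ T ∧ ∀ V ∈ 𝓝 q, ∀ W ∈ 𝓝 T, ∃ τ ∈ W, τ ∈ Icc 0 T ∧
      ∃ Γ, IsPathLift f γ s₀ τ Γ ∧ Γ τ ∈ V := by
    rcases hT0.eq_or_lt with hT0 | hT0
    · refine ⟨s₀, by rw [h0, ← hT0], fun V hV W hW => ?_⟩
      obtain ⟨-, Γ, hΓ⟩ := hA0
      refine ⟨0, ?_, by simp [hT0.symm], Γ, hΓ, ?_⟩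
      · rw [← hT0] at hW
        exact mem_of_mem_nhds hW
      · rw [hΓ.zero]
        exact mem_of_mem_nhds hV
    · have : Nonempty S := ⟨s₀⟩
      choose! G hG using hlt
      -- The lifts on the various intervals agree by uniqueness, so their diagonal values form one
      -- lift on the half-open interval.
      have hGG : ∀ t ∈ Ico 0 T, EqOn (fun t => G t t) (G t) (Icc 0 t) := by
        intro t ht x hx
        have hxT : x ∈ Ico 0 T := ⟨hx.1, hx.2.trans_lt ht.2⟩
        exact (hG x hxT).eqOn hf hx.1 ((hG t ht).mono hx.2) (right_mem_Icc.mpr hx.1)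
      have hcont : ContinuousOn (fun t => G t t) (Ico 0 T) := by
        intro t ht
        obtain ⟨t', htt', ht'T⟩ := exists_between ht.2
        have ht' : t' ∈ Ico 0 T := ⟨ht.1.trans htt'.le, ht'T⟩
        have hc := ((hG t' ht').continuousOn.congr (hGG t' ht')) t ⟨ht.1, htt'.le⟩
        refine hc.mono_of_mem_nhdsWithin ?_
        filter_upwards [self_mem_nhdsWithin, mem_nhdsWithin_of_mem_nhds (Iio_mem_nhds htt')]
          with x hx hx'
        exact ⟨hx.1, le_of_lt hx'⟩
      obtain ⟨q, t, ht, htT, hq⟩ := hlim T ⟨hT0, hT1⟩ (fun t => G t t) hcont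
        fun t ht => (hG t ht).lifts t (right_mem_Icc.mpr ht.1)
      refine ⟨q, ?_, fun V hV W hW => ?_⟩
      · have h1 : Filter.Tendsto (fun n => f (G (t n) (t n))) Filter.atTop (𝓝 (f q)) :=
          hf.continuous.continuousAt.tendsto.comp hq
        have h2 : Filter.Tendsto (fun n => f (G (t n) (t n))) Filter.atTop (𝓝 (γ T)) := by
          refine (hγ.continuousAt.tendsto.comp htT).congr fun n => ?_
          exact ((hG _ (ht n)).lifts _ (right_mem_Icc.mpr (ht n).1)).symm
        exact tendsto_nhds_unique h1 h2
      · obtain ⟨n, hnV, hnW⟩ := ((hq.eventually hV).and (htT.eventually hW)).exists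
        exact ⟨t n, hnW, Ico_subset_Icc_self (ht n), G (t n), hG _ (ht n), hnV⟩
  obtain ⟨q, hq, hkey⟩ := key
  obtain ⟨e, hqe, hfe⟩ := hf q
  have hTe : γ T ∈ e.target := by
    rw [← hq, hfe]
    exact e.map_source hqe
  obtain ⟨ε, hε, hball⟩ := Metric.isOpen_iff.mp (e.open_target.preimage hγ) T hTe
  obtain ⟨τ, hτW, hτ, Γ, hΓ, hΓe⟩ := hkey e.source (e.open_source.mem_nhds hqe) (ball T ε)
    (ball_mem_nhds T hε)
  rw [mem_ball, Real.dist_eq, abs_lt] at hτW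
  -- The local inverse at `q` continues the lift past `T`, which contradicts maximality unless the
  -- new time is `1`.
  have hext := hΓ.extend (T := min 1 (T + ε / 2)) hτ.1
    (le_min (hτ.2.trans hT1) (by linarith [hτ.2])) hγ (e := e) (fun x _ => congrFun hfe x) hΓe ?_
  · have hmem : min 1 (T + ε / 2) ∈ A :=
      ⟨⟨le_min zero_le_one (by linarith), min_le_left _ _⟩, hext⟩
    have hle := le_csSup hbdd hmem
    have h1 : min 1 (T + ε / 2) = 1 := by
      rcases min_choice 1 (T + ε / 2) with h | h
      · exact h
      · rw [h] at hle
        linarith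
    rwa [h1] at hext
  · intro t ht
    refine hball ?_
    rw [mem_ball, Real.dist_eq, abs_lt]
    have := ht.2.trans (min_le_right _ _)
    constructor <;> linarith [ht.1]

end IsPathLift

/-! ### Complete spacelike surfaces and their sections over the base -/

section Surface

variable {S : Type*} [TopologicalSpace S] [ChartedSpace (EuclideanSpace ℝ (Fin 2)) S]

/-- The inverse function theorem for a map from a surface to the plane. -/
theorem exists_openPartialHomeomorph_of_injective [IsManifold (𝓡 2) 2 S] {f : S → Coord 2}
    (hf : ContMDiff (𝓡 2) 𝓘(ℝ, Coord 2) 2 f) (s : S)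
    (hinj : ∀ v : TangentSpace (𝓡 2) s, mfderiv (𝓡 2) 𝓘(ℝ, Coord 2) f s v = 0 → v = 0) :
    ∃ e : OpenPartialHomeomorph S (Coord 2), s ∈ e.source ∧ EqOn f e e.source ∧
      ContMDiffAt 𝓘(ℝ, Coord 2) (𝓡 2) 2 e.symm (f s) := by
  set c := chartAt (EuclideanSpace ℝ (Fin 2)) s with hc
  set F : EuclideanSpace ℝ (Fin 2) → Coord 2 := f ∘ c.symm with hF
  have hcs : s ∈ c.source := mem_chart_source _ s
  have hct : c s ∈ c.target := mem_chart_target _ s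
  have hcsymm : ContMDiffAt (𝓡 2) (𝓡 2) 2 c.symm (c s) :=
    (contMDiffOn_chart_symm (I := 𝓡 2) (n := 2) (x := s)).contMDiffAt (c.open_target.mem_nhds hct)
  have hFc : ContDiffAt ℝ 2 F (c s) :=
    contMDiffAt_iff_contDiffAt.mp ((hf _).comp (c s) hcsymm)
  let F' : EuclideanSpace ℝ (Fin 2) →L[ℝ] Coord 2 := mfderiv (𝓡 2) 𝓘(ℝ, Coord 2) f s
  have hFd : HasFDerivAt F F' (c s) := by
    have h : HasFDerivWithinAt F F' (range (𝓡 2)) (c s) :=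
      ((hf s).mdifferentiableAt (by simp)).hasMFDerivAt.2
    rw [ModelWithCorners.range_eq_univ, hasFDerivWithinAt_univ] at h
    exact h
  have hker : Function.Injective F' := (injective_iff_map_eq_zero F').mpr hinj
  let L : EuclideanSpace ℝ (Fin 2) ≃L[ℝ] Coord 2 :=
    (LinearEquiv.ofInjectiveOfFinrankEq (F' : EuclideanSpace ℝ (Fin 2) →ₗ[ℝ] Coord 2) hker
      (by simp)).toContinuousLinearEquiv
  have hL : HasFDerivAt F (L : EuclideanSpace ℝ (Fin 2) →L[ℝ] Coord 2) (c s) := by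
    refine hFd.congr_fderiv ?_
    ext v
    rfl
  set G := hFc.toOpenPartialHomeomorph F hL (by simp) with hG
  have hGF : ∀ x, G x = F x := fun x => rfl
  have hFs : F (c s) = f s := by simp [hF, c.left_inv hcs]
  refine ⟨c.trans G, ?_, ?_, ?_⟩
  · rw [OpenPartialHomeomorph.trans_source]
    exact ⟨hcs, hFc.mem_toOpenPartialHomeomorph_source hL (by simp)⟩
  · intro x hx
    rw [OpenPartialHomeomorph.trans_source] at hx
    rw [OpenPartialHomeomorph.coe_trans, Function.comp_apply, hGF, hF, Function.comp_apply,
      c.left_inv hx.1]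
  · have h1 : ContDiffAt ℝ 2 G.symm (f s) := by
      rw [← hFs]
      exact hFc.to_localInverse hL (by simp)
    have h2 : G.symm (f s) = c s := by
      rw [← hFs]
      exact hFc.localInverse_apply_image hL (by simp)
    rw [OpenPartialHomeomorph.coe_trans_symm]
    refine ContMDiffAt.comp (f s) ?_ (contMDiffAt_iff_contDiffAt.mpr h1)
    rw [h2]
    exact hcsymm

/-- Dropping the negative square of the connection form bounds the metric by the pullback of the
base metric. Hence the projection does not decrease lengths of spacelike vectors, and its
differential has no kernel on a spacelike tangent plane. -/
theorem metricInner_metricL_le (δ τ : Coord 2 → ℝ) (q v : Coord 3) :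
    metricInner (metricL δ τ) q v v ≤ 1 / δ (proj q) ^ 2 * (v 0 ^ 2 + v 1 ^ 2) := by
  rw [metricInner_metricL]
  nlinarith [sq_nonneg (-(calabi δ τ (proj q) * q 1) * v 0 + calabi δ τ (proj q) * q 0 * v 1 + v 2)]

theorem contMDiff_proj_comp {φ : S → Coord 3} (hφ : ContMDiff (𝓡 2) 𝓘(ℝ, Coord 3) 2 φ) :
    ContMDiff (𝓡 2) 𝓘(ℝ, Coord 2) 2 fun s => proj (φ s) :=
  (contMDiff_iff_contDiff.mpr contDiff_proj).comp hφ

/-- The projection of a spacelike surface to the base is a local diffeomorphism. -/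
theorem IsSpacelikeImmersion.exists_openPartialHomeomorph [IsManifold (𝓡 2) 2 S]
    {Ω : Set (Coord 2)} {δ τ : Coord 2 → ℝ} {φ : S → Coord 3} (h : IsSpacelikeImmersion Ω δ τ φ)
    (s : S) : ∃ e : OpenPartialHomeomorph S (Coord 2), s ∈ e.source ∧
      EqOn (fun s => proj (φ s)) e e.source ∧
      ContMDiffAt 𝓘(ℝ, Coord 2) (𝓡 2) 2 e.symm (proj (φ s)) := by
  refine exists_openPartialHomeomorph_of_injective (contMDiff_proj_comp h.contMDiff) s
    fun v hv => ?_
  by_contra hne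
  have h1 := h.spacelike s v hne
  have hd := (hasFDerivAt_proj (φ s)).hasMFDerivAt.comp s
    ((h.contMDiff s).mdifferentiableAt (by simp)).hasMFDerivAt
  set w : Coord 3 := mfderiv (𝓡 2) 𝓘(ℝ, Coord 3) φ s v with hw
  have hv' : proj w = 0 := by
    rw [← projCLM_apply]
    have h2 : mfderiv (𝓡 2) 𝓘(ℝ, Coord 2) (fun s => proj (φ s)) s v = projCLM w :=
      congrArg (fun L => L v) hd.mfderiv
    rw [← h2]
    exact hv
  have h3 := metricInner_metricL_le δ τ (φ s) w
  have e0 : w 0 = 0 := congrFun hv' 0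
  have e1 : w 1 = 0 := congrFun hv' 1
  rw [e0, e1] at h3
  simp only [ne_eq, OfNat.ofNat_ne_zero, not_false_eq_true, zero_pow, add_zero, mul_zero] at h3
  exact absurd h1 (not_lt.mpr h3)

theorem IsSpacelikeImmersion.isLocalHomeomorph [IsManifold (𝓡 2) 2 S]
    {Ω : Set (Coord 2)} {δ τ : Coord 2 → ℝ} {φ : S → Coord 3} (h : IsSpacelikeImmersion Ω δ τ φ) :
    IsLocalHomeomorph fun s => proj (φ s) :=
  IsLocalHomeomorph.mk _ fun s =>
    let ⟨e, h1, h2, _⟩ := h.exists_openPartialHomeomorph s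
    ⟨e, h1, h2⟩

/-- A continuous lift of a `C²` map through the projection of a spacelike surface is `C²`. -/
theorem IsSpacelikeImmersion.contMDiffWithinAt_lift [IsManifold (𝓡 2) 2 S]
    {Ω : Set (Coord 2)} {δ τ : Coord 2 → ℝ} {φ : S → Coord 3} (h : IsSpacelikeImmersion Ω δ τ φ)
    {V : Type*} [NormedAddCommGroup V] [NormedSpace ℝ V] {A : Set V} {x : V} (hx : x ∈ A)
    {Γ : V → S} (hΓ : ContinuousWithinAt Γ A x) {γ : V → Coord 2} (hγ : ContDiffWithinAt ℝ 2 γ A x)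
    (hlift : ∀ y ∈ A, proj (φ (Γ y)) = γ y) :
    ContMDiffWithinAt 𝓘(ℝ, V) (𝓡 2) 2 Γ A x := by
  obtain ⟨e, hse, hfe, he⟩ := h.exists_openPartialHomeomorph (Γ x)
  rw [hlift x hx] at he
  have h1 : ContMDiffWithinAt 𝓘(ℝ, V) (𝓡 2) 2 (e.symm ∘ γ) A x :=
    he.comp_contMDiffWithinAt x (contMDiffWithinAt_iff_contDiffWithinAt.mpr hγ)
  have h2 : ∀ y ∈ A, Γ y ∈ e.source → Γ y = (e.symm ∘ γ) y := by
    intro y hy hye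
    rw [Function.comp_apply, ← hlift y hy]
    have := hfe hye
    simp only at this
    rw [this, e.left_inv hye]
  refine h1.congr_of_eventuallyEq ?_ (h2 x hx hse)
  filter_upwards [self_mem_nhdsWithin, hΓ (e.open_source.mem_nhds hse)] with y hy hye
  exact h2 y hy hye

end Surface

section Surface

variable {S : Type*} [TopologicalSpace S] [ChartedSpace (EuclideanSpace ℝ (Fin 2)) S]

/-- A lift of a base segment is no longer than the segment, whose speed is at most `M`. This makes
the lift Cauchy at the end of its interval. -/
theorem IsSpacelikeImmersion.inducedDist_lift_le [IsManifold (𝓡 2) 2 S]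
    {Ω : Set (Coord 2)} {δ τ : Coord 2 → ℝ} {φ : S → Coord 3} (h : IsSpacelikeImmersion Ω δ τ φ)
    {p v : Coord 2} {M T : ℝ} (hM : 0 ≤ M) {Γ : ℝ → S} (hΓ : ContinuousOn Γ (Ico 0 T))
    (hlift : ∀ t ∈ Ico 0 T, proj (φ (Γ t)) = p + t • v)
    (hbound : ∀ t ∈ Ico 0 T, 1 / δ (p + t • v) ^ 2 * (v 0 ^ 2 + v 1 ^ 2) ≤ M ^ 2)
    {a b : ℝ} (ha : a ∈ Ico 0 T) (hb : b ∈ Ico 0 T) :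
    inducedDist (metricL δ τ) φ (Γ a) (Γ b) ≤ ENNReal.ofReal (M * |b - a|) := by
  set η : ℝ → ℝ := fun t => a + (b - a) * t with hη
  have hηT : ∀ t ∈ Icc (0 : ℝ) 1, η t ∈ Ico 0 T := fun t ht => by
    have := (convex_Ico 0 T).add_smul_sub_mem ha hb ht
    simpa [hη, mul_comm] using this
  have hηc : Continuous η := by fun_prop
  have hηd : ∀ t, HasDerivAt η (b - a) t := fun t => by
    exact (((hasDerivAt_id t).const_mul (b - a)).const_add a).congr_deriv (mul_one _)
  have hγ : ContDiff ℝ 2 fun t => p + η t • v := by fun_prop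
  have hsmooth : ContMDiffOn 𝓘(ℝ, ℝ) (𝓡 2) 1 (Γ ∘ η) (Icc 0 1) := fun t ht =>
    (h.contMDiffWithinAt_lift ht ((hΓ.comp hηc.continuousOn hηT) t ht)
      hγ.contDiffAt.contDiffWithinAt fun y hy => hlift _ (hηT y hy)).of_le (by norm_num)
  have hle : inducedDist (metricL δ τ) φ (Γ a) (Γ b) ≤ curveLength (metricL δ τ) (φ ∘ Γ ∘ η) :=
    iInf_le_of_le (Γ ∘ η) <| iInf_le_of_le hsmooth <| iInf_le_of_le (by simp [hη]) <|
      iInf_le_of_le (by simp [hη]) le_rfl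
  refine hle.trans ?_
  rw [curveLength, ← restrict_Ioo_eq_restrict_Icc]
  refine (setLIntegral_mono' (g := fun _ => ENNReal.ofReal (M * |b - a|)) measurableSet_Ioo
    fun t ht => ?_).trans (by simp)
  have htI := Ioo_subset_Icc_self ht
  refine ENNReal.ofReal_le_ofReal ?_
  by_cases hd : DifferentiableAt ℝ (φ ∘ Γ ∘ η) t
  · set w := deriv (φ ∘ Γ ∘ η) t with hw
    have h1 : HasDerivAt (proj ∘ φ ∘ Γ ∘ η) (projCLM w) t :=
      (hasFDerivAt_proj _).comp_hasDerivAt t hd.hasDerivAt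
    have h2 : HasDerivAt (fun t => p + η t • v) ((b - a) • v) t :=
      ((hηd t).smul_const v).const_add p
    have h3 : projCLM w = (b - a) • v := by
      refine h1.unique (h2.congr_of_eventuallyEq ?_)
      filter_upwards [Ioo_mem_nhds ht.1 ht.2] with x hx
      exact hlift _ (hηT x (Ioo_subset_Icc_self hx))
    rw [projCLM_apply] at h3
    have e0 : w 0 = (b - a) * v 0 := congrFun h3 0
    have e1 : w 1 = (b - a) * v 1 := congrFun h3 1
    refine (Real.sqrt_le_left (by positivity)).mpr ?_
    refine (metricInner_metricL_le δ τ _ w).trans ?_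
    have h4 : proj ((φ ∘ Γ ∘ η) t) = p + η t • v := hlift _ (hηT t htI)
    have h5 := hbound _ (hηT t htI)
    rw [h4, e0, e1, mul_pow M, sq_abs]
    calc _ = (1 / δ (p + η t • v) ^ 2 * (v 0 ^ 2 + v 1 ^ 2)) * (b - a) ^ 2 := by ring
      _ ≤ _ := by gcongr
  -- Where the derivative does not exist it has the default value zero, so the bound is trivial and
  -- differentiability need not be proved.
  · rw [deriv_zero_of_not_differentiableAt hd]
    simp only [metricInner, zero_dotProduct, Real.sqrt_zero]
    positivity

/-- Segments in the base lift to a complete spacelike surface. -/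
theorem IsCompleteSpacelike.exists_lift [IsManifold (𝓡 2) 2 S] [T2Space S]
    {Ω : Set (Coord 2)} {δ τ : Coord 2 → ℝ} (hδ : ContinuousOn δ Ω) (hpos : ∀ p ∈ Ω, 0 < δ p)
    {φ : S → Coord 3} (h : IsCompleteSpacelike Ω δ τ φ) {p v : Coord 2}
    (hseg : ∀ t ∈ Icc (0 : ℝ) 1, p + t • v ∈ Ω) {s₀ : S} (hs₀ : proj (φ s₀) = p) :
    ∃ Γ, IsPathLift (fun s => proj (φ s)) (fun t : ℝ => p + t • v) s₀ 1 Γ := by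
  have hγ : Continuous fun t : ℝ => p + t • v := by fun_prop
  have hc : ContinuousOn (fun t : ℝ => 1 / δ (p + t • v) ^ 2 * (v 0 ^ 2 + v 1 ^ 2)) (Icc 0 1) := by
    refine ContinuousOn.mul ?_ continuousOn_const
    refine continuousOn_const.div ((hδ.comp hγ.continuousOn hseg).pow 2) fun t ht => ?_
    exact pow_ne_zero 2 (hpos _ (hseg t ht)).ne'
  obtain ⟨B, hB⟩ := isCompact_Icc.exists_bound_of_continuousOn hc
  -- A positive constant with `B ≤ M²`, so that a bound on the squared speed becomes a bound on the
  -- speed.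
  set M := 1 + |B| with hMdef
  have hM : 0 < M := by positivity
  have hBM : B ≤ M ^ 2 := by nlinarith [le_abs_self B, abs_nonneg B]
  refine IsPathLift.exists_of_limit h.immersion.isLocalHomeomorph hγ (by simpa using hs₀) ?_
  intro T hT Γ hΓ hlift
  have hbound : ∀ t ∈ Ico 0 T, 1 / δ (p + t • v) ^ 2 * (v 0 ^ 2 + v 1 ^ 2) ≤ M ^ 2 := fun t ht =>
    ((le_abs_self _).trans (hB t ⟨ht.1, ht.2.le.trans hT.2⟩)).trans hBM
  set t : ℕ → ℝ := fun n => T * (1 - 1 / ((n : ℝ) + 1)) with ht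
  have htT : Filter.Tendsto t Filter.atTop (𝓝 T) := by
    have := (tendsto_one_div_add_atTop_nhds_zero_nat (𝕜 := ℝ)).const_sub 1 |>.const_mul T
    simpa [ht] using this
  have htI : ∀ n, t n ∈ Ico 0 T := by
    intro n
    have h1 : 0 < 1 / ((n : ℝ) + 1) := by positivity
    have h2 : 1 / ((n : ℝ) + 1) ≤ 1 := by
      rw [div_le_one (by positivity)]
      linarith [n.cast_nonneg (α := ℝ)]
    have hT0 := hT.1
    constructor
    · simp only [ht]
      exact mul_nonneg hT0.le (by linarith)
    · simp only [ht]
      nlinarith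
  obtain ⟨q, hq⟩ := h.complete (Γ ∘ t) fun ε hε => by
    obtain ⟨r, hr0, hr⟩ := ENNReal.lt_iff_exists_nnreal_btwn.mp hε
    have hr0' : (0 : ℝ) < r := by exact_mod_cast hr0
    obtain ⟨N, hN⟩ := Metric.cauchySeq_iff.mp htT.cauchySeq (r / M) (by positivity)
    refine ⟨N, fun m hm n hn => ?_⟩
    refine (h.immersion.inducedDist_lift_le hM.le hΓ hlift hbound (htI m) (htI n)).trans_lt ?_
    refine lt_of_le_of_lt ?_ hr
    rw [← ENNReal.ofReal_coe_nnreal]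
    refine ENNReal.ofReal_le_ofReal ?_
    have := hN n hn m hm
    rw [Real.dist_eq, lt_div_iff₀ hM] at this
    linarith
  exact ⟨q, t, htI, htT, hq⟩

/-- A complete spacelike surface admits a continuous section over the star-shaped base. -/
theorem IsCompleteSpacelike.exists_section [IsManifold (𝓡 2) 2 S] [T2Space S] [Nonempty S]
    {Ω : Set (Coord 2)} (hs : StarConvex ℝ 0 Ω) {δ τ : Coord 2 → ℝ}
    (hδ : ContinuousOn δ Ω) (hpos : ∀ p ∈ Ω, 0 < δ p)
    {φ : S → Coord 3} (h : IsCompleteSpacelike Ω δ τ φ) :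
    ∃ σ : Coord 2 → S, ContinuousOn σ Ω ∧ ∀ p ∈ Ω, proj (φ (σ p)) = p := by
  classical
  obtain ⟨s₀⟩ := ‹Nonempty S›
  -- The segment from the projection of an arbitrary point to the origin is lifted first, which
  -- gives a base point of the surface over the star centre.
  obtain ⟨Γ₀, hΓ₀⟩ := h.exists_lift hδ hpos (p := proj (φ s₀)) (v := -proj (φ s₀)) (s₀ := s₀)
    (fun t ht => by
      have := smul_mem_of_starConvex hs (h.immersion.mem s₀) (t := 1 - t)
        ⟨by linarith [ht.2], by linarith [ht.1]⟩
      rw [sub_smul, one_smul] at this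
      rwa [smul_neg, ← sub_eq_add_neg]) rfl
  have h1 : proj (φ (Γ₀ 1)) = 0 := by
    have := hΓ₀.lifts 1 (right_mem_Icc.mpr zero_le_one)
    simpa using this
  have hex := fun (p : Ω) => h.exists_lift hδ hpos (p := 0) (v := (p : Coord 2)) (s₀ := Γ₀ 1)
    (fun t ht => by rw [zero_add]; exact smul_mem_of_starConvex hs p.2 ht) h1
  choose G hG using hex
  -- The rays are lifted one by one. Joint continuity follows because all lifts start at the same
  -- point and the projection is a local homeomorphism with Hausdorff source.
  have hcont : Continuous fun q : unitInterval × Ω => G q.2 q.1 := by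
    refine h.immersion.isLocalHomeomorph.continuous_lift (T2Space.isSeparatedMap _)
      ⟨fun q : unitInterval × Ω => (q.1 : ℝ) • (q.2 : Coord 2), by fun_prop⟩ ?_ ?_ ?_
    · funext q
      have := (hG q.2).lifts q.1 q.1.2
      simpa using this
    · have : (fun x : Ω => G x ((0 : unitInterval) : ℝ)) = fun _ => Γ₀ 1 :=
        funext fun x => (hG x).zero
      simp only [this]
      exact continuous_const
    · intro p
      exact (hG p).continuousOn.comp_continuous continuous_subtype_val fun t => t.2
  refine ⟨fun p => if hp : p ∈ Ω then G ⟨p, hp⟩ 1 else s₀, ?_, ?_⟩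
  · rw [continuousOn_iff_continuous_domRestrict]
    have h2 : Continuous fun p : Ω => G p 1 :=
      hcont.comp (f := fun p : Ω => ((1 : unitInterval), p)) (by fun_prop)
    refine h2.congr fun p => ?_
    simp
  · intro p hp
    have := (hG ⟨p, hp⟩).lifts 1 (right_mem_Icc.mpr zero_le_one)
    simpa [hp] using this

theorem metricInner_comm_metricL (δ τ : Coord 2 → ℝ) (q v w : Coord 3) :
    metricInner (metricL δ τ) q v w = metricInner (metricL δ τ) q w v := by
  rw [metricInner_metricL, metricInner_metricL]
  ring

theorem tangentVec_eq_of_hasFDerivAt {X : Coord 2 → Coord 3} {L : Coord 2 →L[ℝ] Coord 3}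
    {p : Coord 2} (hX : HasFDerivAt X L p) (a : Fin 2) : tangentVec X a p = L (Pi.single a 1) := by
  ext k
  exact pd_eq_of_hasFDerivAt (hasFDerivAt_pi'.mp hX k) a

/-- A complete spacelike surface gives rise to an entire spacelike graph. -/
theorem IsCompleteSpacelike.exists_isEntireSpacelikeGraph [IsManifold (𝓡 2) 2 S] [T2Space S]
    [Nonempty S] {Ω : Set (Coord 2)} (hΩ : IsOpen Ω) (hs : StarConvex ℝ 0 Ω) {δ τ : Coord 2 → ℝ}
    (hδ : ContinuousOn δ Ω) (hpos : ∀ p ∈ Ω, 0 < δ p)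
    {φ : S → Coord 3} (h : IsCompleteSpacelike Ω δ τ φ) :
    ∃ u : Coord 2 → ℝ, IsEntireSpacelikeGraph Ω δ τ u := by
  obtain ⟨σ, hσ, hsec⟩ := h.exists_section hs hδ hpos
  have hσ2 : ∀ p ∈ Ω, ContMDiffAt 𝓘(ℝ, Coord 2) (𝓡 2) 2 σ p := fun p hp =>
    (h.immersion.contMDiffWithinAt_lift hp (hσ p hp) (γ := fun q => q)
      contDiff_id.contDiffAt.contDiffWithinAt hsec).contMDiffAt (hΩ.mem_nhds hp)
  have hφσ : ∀ p ∈ Ω, ContDiffAt ℝ 2 (φ ∘ σ) p := fun p hp =>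
    contMDiffAt_iff_contDiffAt.mp ((h.immersion.contMDiff _).comp p (hσ2 p hp))
  set u : Coord 2 → ℝ := fun p => φ (σ p) 2 with hu
  have hX : ∀ p ∈ Ω, graphMap u p = φ (σ p) := by
    intro p hp
    have := hsec p hp
    ext k
    fin_cases k
    · exact (congrFun this 0).symm
    · exact (congrFun this 1).symm
    · rfl
  refine ⟨u, fun p hp => (contDiffAt_pi.mp (hφσ p hp) 2).contDiffWithinAt, fun p hp => ?_⟩
  let dσ : Coord 2 →L[ℝ] TangentSpace (𝓡 2) (σ p) := mfderiv 𝓘(ℝ, Coord 2) (𝓡 2) σ p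
  let dφ : TangentSpace (𝓡 2) (σ p) →L[ℝ] Coord 3 := mfderiv (𝓡 2) 𝓘(ℝ, Coord 3) φ (σ p)
  have hd : HasFDerivAt (φ ∘ σ) (dφ.comp dσ) p := by
    have := (((h.immersion.contMDiff (σ p)).mdifferentiableAt (by simp)).hasMFDerivAt).comp p
      (((hσ2 p hp).mdifferentiableAt (by simp)).hasMFDerivAt)
    exact hasMFDerivAt_iff_hasFDerivAt.mp this
  have hdX : HasFDerivAt (graphMap u) (dφ.comp dσ) p := by
    refine hd.congr_of_eventuallyEq ?_
    filter_upwards [hΩ.mem_nhds hp] with q hq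
    exact hX q hq
  have hproj : ∀ x : Coord 2, proj (dφ (dσ x)) = x := by
    intro x
    have h1 := (hasFDerivAt_proj (φ (σ p))).comp p hd
    have h2 : HasFDerivAt (proj ∘ φ ∘ σ) (ContinuousLinearMap.id ℝ (Coord 2)) p := by
      refine (hasFDerivAt_id p).congr_of_eventuallyEq ?_
      filter_upwards [hΩ.mem_nhds hp] with q hq
      exact hsec q hq
    have h3 := congrArg (fun L => L x) (h1.unique h2)
    rw [← projCLM_apply]
    exact h3
  have hI : ∀ a b, firstForm (metricL δ τ) (graphMap u) p a b = metricInner (metricL δ τ) (φ (σ p))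
      (dφ (dσ (Pi.single a 1))) (dφ (dσ (Pi.single b 1))) := by
    intro a b
    rw [firstForm, Matrix.of_apply, tangentVec_eq_of_hasFDerivAt hdX,
      tangentVec_eq_of_hasFDerivAt hdX, hX p hp]
    rfl
  refine Matrix.PosDef.of_dotProduct_mulVec_pos ?_ fun x hx => ?_
  · ext a b
    rw [Matrix.conjTranspose_apply, hI, hI, star_trivial, metricInner_comm_metricL]
  -- The section is inverted by the projection, so its differential is injective and spacelikeness
  -- of the immersion applies to `dσ x`.
  · have hne : dσ x ≠ 0 := fun h0 => hx <| by
      rw [← hproj x, h0, map_zero]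
      ext i
      fin_cases i <;> rfl
    have h1 : 0 < metricInner (metricL δ τ) (φ (σ p)) (dφ (dσ x)) (dφ (dσ x)) :=
      h.immersion.spacelike (σ p) (dσ x) hne
    have h2 : dφ (dσ x) = x 0 • dφ (dσ (Pi.single 0 1)) + x 1 • dφ (dσ (Pi.single 1 1)) := by
      have h4 : x = x 0 • Pi.single 0 1 + x 1 • Pi.single 1 1 := by
        ext i; fin_cases i <;> simp
      conv_lhs => rw [h4]
      rw [map_add, map_smul, map_smul, map_add, map_smul, map_smul]
    rw [h2] at h1
    refine h1.trans_le (le_of_eq ?_)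
    simp only [dotProduct, Matrix.mulVec, Fin.sum_univ_two, hI, star_trivial, metricInner_metricL,
      Pi.add_apply, Pi.smul_apply, smul_eq_mul]
    ring

end Surface

end GBCV

theorem corollary4p5
    (Ω : Set (GBCV.Coord 2)) (hΩ : IsOpen Ω) (h0 : (0 : GBCV.Coord 2) ∈ Ω)
    (hstar : StarConvex ℝ 0 Ω)
    (δ : GBCV.Coord 2 → ℝ) (hδ : ContDiffOn ℝ ∞ δ Ω) (hpos : ∀ p ∈ Ω, 0 < δ p)
    (hcomplete : GBCV.BaseComplete Ω δ)
    (c : ℝ) (hc : IsGLB (GBCV.gaussCurvature (GBCV.baseMetric δ) '' Ω) c) (hc0 : c ≤ 0) :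
    (∀ H : GBCV.Coord 2 → ℝ, ContDiffOn ℝ ∞ H Ω →
      (1 / 2) * √(-c) < ⨅ p : Ω, |H p| →
      ∀ τ : GBCV.Coord 2 → ℝ, ContDiffOn ℝ ∞ τ Ω →
        ¬ ∃ u : GBCV.Coord 2 → ℝ, GBCV.IsEntireGraphE Ω δ τ H u) ∧
    (∀ τ : GBCV.Coord 2 → ℝ, ContDiffOn ℝ ∞ τ Ω →
      (1 / 2) * √(-c) < ⨅ p : Ω, |τ p| →
      (∀ (S : Type*) [TopologicalSpace S] [T2Space S] [Nonempty S]
        [ChartedSpace (EuclideanSpace ℝ (Fin 2)) S] [IsManifold (𝓡 2) 2 S],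
        ¬ ∃ φ : S → GBCV.Coord 3, GBCV.IsCompleteSpacelike Ω δ τ φ) ∧
      ¬ ∃ u : GBCV.Coord 2 → ℝ, GBCV.IsEntireSpacelikeGraph Ω δ τ u) := by
  have hc' : ∀ p ∈ Ω, c ≤ GBCV.gaussCurvature (GBCV.baseMetric δ) p := fun p hp =>
    hc.1 (Set.mem_image_of_mem _ hp)
  refine ⟨?_, fun τ hτ hlt => ⟨?_, ?_⟩⟩
  · rintro H hH hlt τ hτ ⟨u, hu⟩
    exact GBCV.not_isEntireGraphE hΩ h0 hstar hδ hpos hcomplete hc' hH.continuousOn hlt hτ hu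
  · rintro S _ _ _ _ _ ⟨φ, hφ⟩
    obtain ⟨u, hu⟩ := hφ.exists_isEntireSpacelikeGraph hΩ hstar hδ.continuousOn hpos
    exact GBCV.not_isEntireSpacelikeGraph hΩ h0 hstar hδ hpos hcomplete hc' hτ hlt hu
  · rintro ⟨u, hu⟩
    exact GBCV.not_isEntireSpacelikeGraph hΩ h0 hstar hδ hpos hcomplete hc' hτ hlt hu
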